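/- Let $D\subset\mathbb R^d$ be a bounded domain (open, connected, non-empty), let $\lambda:\overline D\to(0,\infty)$ and $g:\overline D\to\mathbb R$ be continuous, and let $\rho:D\to[0,\infty)$ be a continuous probability density. *The process $W_{\mu}$.* Let $\mathcal S(\overline D)$ be the set of lower semicontinuous functions $\overline D\to\mathbb R\cup\{+\infty\}$, with the $\sigma$-algebra generated by the maps $f\mapsto\inf_K f$, $K\subset\overline D$ compact (the Borel $\sigma$-algebra of $\Gamma$-convergence). For an integrable function $\mu\ge 0$ on $\overline D$, $W_\mu$ denotes a random element of $\mathcal S(\overline D)$ such that (i) for every closed $C\subset\overline D$, $\min_C W_\mu$ is exponentially distributed with rate $\int_C\mu(x)\,dx$ (an exponential variable of rate $0$ is $+\infty$ almost surely, and $\min_\emptyset=+\infty$); (ii) for any finite family of pairwise disjoint closed sets $C_1,\dots,C_m\subset\overline D$, the variables $\min_{C_1}W_\mu,\dots,\min_{C_m}W_\mu$ are independent. *$k$-th argmins.* For $f:\overline D\to\mathbb R\cup\{+\infty\}$ put $m_1(f)=\inf_{\overline D}f$, $M_1(f)=\{x: f(x)=m_1(f)\}$ and, for $k\ge2$, $m_k(f)=\inf\{f(x):x\in\overline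 D\setminus\bigcup_{i<k}M_i(f)\}$ and $M_k(f)=\{x: m_{k-1}(f)<f(x)=m_k(f)\}$. The elements of $M_k(f)$ are the $k$-th argmins of $f$. **Theorem.** Let $x_1,x_2,\dots$ be distinct points of $D$ whose empirical measures $\frac1n\sum_{i=1}^n\delta_{x_i}$ converge weakly to $\rho(x)\,dx$ as $n\to\infty$. Let $\xi_1,\xi_2,\dots$ be independent non-negative random variables, not necessarily identically distributed, whose distribution functions $F_i$ satisfy $F_i(t)=t+O(t^2)$ near zero, uniformly in $i$: there are $A$ and $\delta>0$ with $|F_i(t)-t|\le At^2$ for all $i$ and all $0\le t\le\delta$. Define $$f_n(x)=\begin{cases}\dfrac{n}{\lambda(x_i)}\,\xi_i+g(x_i), & x=x_i,\ i=1,\dots,n,\\ +\infty, &\text{otherwise,}\end{cases}$$ and $\tilde\lambda=\lambda\rho$ on $D$, $\tilde\lambda=0$ on $\overline D\setminus D$. Then a process $W_{\tilde\lambda}$ exists and, for every such process and every $k\in\mathbb N$: almost surely each of $M_1(W_{\tilde\lambda}+g),\dots,M_k(W_{\tilde\lambda}+g)$ is a single point; the probability that each of $M_1(f_n),\dots,M_k(f_n)$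 is a single point tends to $1$ as $n\to\infty$; and the joint distribution of the first $k$ argmins of $f_n$ converges weakly, as $n\to\infty$, to the joint distribution of the first $k$ argmins of $W_{\tilde\lambda}+g$. (For a function $f$, the first $k$ argmins are the $k$-tuple whose $j$-th entry is a fixed choice, depending only on the set $M_j(f)$, of an element of $M_j(f)$, and is $0$ if $M_j(f)=\emptyset$.) -/

import Mathlib

open MeasureTheory ProbabilityTheory Filter Topology

/-- The space `𝒮(X)` of lower semicontinuous functions on `X` with values in `ℝ ∪ {+∞}`. -/
def LSCFun (X : Type*) [TopologicalSpace X] : Type _ :=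
  {f : X → EReal // LowerSemicontinuous f ∧ ∀ x, f x ≠ ⊥}

/-- The infimum of a function over a set (equal to `+∞` over the empty set). Over a closed subset
of a compact space, the infimum of a lower semicontinuous function is a minimum. -/
noncomputable def infOn {X : Type*} (f : X → EReal) (C : Set X) : EReal :=
  ⨅ x ∈ C, f x

/-- The σ-algebra on `𝒮(X)` generated by the evaluations of minima over compact sets. For a compact
metric space `X` this is the Borel σ-algebra of the (metrizable) topology of Γ-convergence. -/
instance LSCFun.instMeasurableSpace (X : Type*) [TopologicalSpace X] :
    MeasurableSpace (LSCFun X) :=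
  MeasurableSpace.generateFrom
    {s | ∃ (K : Set X) (t : ℝ), IsCompact K ∧ s = {f : LSCFun X | (t : EReal) < infOn f.1 K}}

/-- `IsExtremeValueLaw D lam ν`: the probability measure `ν` on `𝒮(closure D)` is the law of the
extreme value process `W_lam` with (nonnegative, integrable) intensity `lam`.
The minimum over a closed set `C` is exponential with rate `∫_C lam`, that is,
`P(min_C W > t) = exp (- t ∫_C lam)` for all `t ≥ 0`. If the rate is `0`, this says that the
minimum is `+∞` almost surely. Minima over disjoint closed sets are independent. -/
structure IsExtremeValueLaw {d : ℕ} (D : Set (EuclideanSpace ℝ (Fin d)))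
    (lam : EuclideanSpace ℝ (Fin d) → ℝ) (ν : Measure (LSCFun (closure D))) : Prop where
  isProbabilityMeasure : IsProbabilityMeasure ν
  exponential : ∀ C : Set (closure D), IsClosed C → ∀ t : ℝ, 0 ≤ t →
    ν {f | (t : EReal) < infOn f.1 C} =
      ENNReal.ofReal (Real.exp (-((∫ x in (Subtype.val '' C), lam x) * t)))
  indep : ∀ (m : ℕ) (C : Fin m → Set (closure D)), (∀ i, IsClosed (C i)) →
    (∀ i j, i ≠ j → Disjoint (C i) (C j)) →
    iIndepFun (fun (i : Fin m) (f : LSCFun (closure D)) => infOn f.1 (C i)) ν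

section Argmins

variable {X : Type*}

/-- `argminUnion f k` is `M₁(f) ∪ ⋯ ∪ M_k(f)`, the union of the sets of `i`-th argmins, `i ≤ k`
(see `argminUnion_eq`). -/
noncomputable def argminUnion (f : X → EReal) : ℕ → Set X
  | 0 => ∅
  | 1 => {x | f x = ⨅ y, f y}
  | k + 2 => argminUnion f (k + 1) ∪
      {x | infOn f (argminUnion f k)ᶜ < f x ∧ f x = infOn f (argminUnion f (k + 1))ᶜ}

/-- `kthMin f j` is `m_{j+1}(f)`, the infimum of `f` outside `M₁(f) ∪ ⋯ ∪ M_j(f)`. -/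
noncomputable def kthMin (f : X → EReal) (j : ℕ) : EReal :=
  infOn f (argminUnion f j)ᶜ

/-- `kthArgmin f j` is `M_{j+1}(f)`, the set of `(j+1)`-th argmins of `f` (indices start at `0`). -/
noncomputable def kthArgmin (f : X → EReal) : ℕ → Set X
  | 0 => {x | f x = kthMin f 0}
  | j + 1 => {x | kthMin f j < f x ∧ f x = kthMin f (j + 1)}

theorem argminUnion_succ (f : X → EReal) (k : ℕ) :
    argminUnion f (k + 1) = argminUnion f k ∪ kthArgmin f k := by
  cases k with
  | zero => simp [argminUnion, kthArgmin, kthMin, infOn]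
  | succ k => rfl

theorem argminUnion_eq (f : X → EReal) (k : ℕ) :
    argminUnion f k = ⋃ i < k, kthArgmin f i := by
  induction k with
  | zero => simp [argminUnion]
  | succ k ih => rw [argminUnion_succ, ih, Set.biUnion_lt_succ]

end Argmins

open Classical in
/-- The first `k` argmins of `f`: the `j`-th coordinate (`j = 0, …, k - 1`) is an element of
`kthArgmin f j`, the only one if this set is a singleton (and the junk value `0` if it is empty). -/
noncomputable def firstArgmins {d : ℕ} {D : Set (EuclideanSpace ℝ (Fin d))} (k : ℕ)
    (f : closure D → EReal) : Fin k → EuclideanSpace ℝ (Fin d) :=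
  fun j => if h : (kthArgmin f j).Nonempty then (h.some : EuclideanSpace ℝ (Fin d)) else 0

/-- The function `f + g` on `closure D`. -/
noncomputable def addReal {d : ℕ} {D : Set (EuclideanSpace ℝ (Fin d))}
    (f : LSCFun (closure D)) (g : EuclideanSpace ℝ (Fin d) → ℝ) : closure D → EReal :=
  fun y => f.1 y + (g y : EReal)

/-- The function on `closure D` with value `(n / lam (x i)) * ξ i + g (x i)` at the points
`x i`, `i < n`, and `+∞` elsewhere (for distinct points `x i`; see the two lemmas below). -/
noncomputable def responseFun {d : ℕ} (D : Set (EuclideanSpace ℝ (Fin d)))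
    (lam g : EuclideanSpace ℝ (Fin d) → ℝ) (x : ℕ → EuclideanSpace ℝ (Fin d))
    (n : ℕ) (ξ : ℕ → ℝ) : closure D → EReal :=
  fun y => ⨅ (i : ℕ) (_ : i < n ∧ x i = y), ((n / lam (x i) * ξ i + g (x i) : ℝ) : EReal)

theorem responseFun_apply {d : ℕ} {D : Set (EuclideanSpace ℝ (Fin d))}
    {lam g : EuclideanSpace ℝ (Fin d) → ℝ} {x : ℕ → EuclideanSpace ℝ (Fin d)}
    (hx : Function.Injective x) {n i : ℕ} (hi : i < n) (ξ : ℕ → ℝ) (y : closure D)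
    (hy : x i = y) :
    responseFun D lam g x n ξ y = ((n / lam (x i) * ξ i + g (x i) : ℝ) : EReal) := by
  refine le_antisymm (iInf₂_le i ⟨hi, hy⟩) (le_iInf₂ fun j hj => ?_)
  rw [hx (hj.2.trans hy.symm)]

theorem responseFun_eq_top {d : ℕ} {D : Set (EuclideanSpace ℝ (Fin d))}
    {lam g : EuclideanSpace ℝ (Fin d) → ℝ} {x : ℕ → EuclideanSpace ℝ (Fin d)}
    {n : ℕ} (ξ : ℕ → ℝ) (y : closure D) (hy : ∀ i < n, x i ≠ y) :
    responseFun D lam g x n ξ y = ⊤ := by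
  simp only [responseFun, iInf_eq_top]
  exact fun i hi => absurd hi.2 (hy i hi.1)

/-! The argument compares void probabilities. For a threshold `t`, the event `f_n > t` everywhere
has probability `∏ (1 - F_i(λ(x_i)(t - g)(x_i)/n))` by independence. Since `F_i(u) = u + O(u²)` and
the points equidistribute, this tends to `exp(-∫ λ (t - g)⁺ ρ)`. The process `W + g` has exactly
this void probability. Both facts hold for thresholds that are step functions on a finite partition
into cells with null boundaries (`IsUnitRateNoise.tendsto_measure_lt_responseField`,
`IsExtremeLaw.measure_aboveSet`).

Space is cut into small cells and the range of values into short slots. The void pattern records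
which cells exceed which levels. A prescribed set of pairs lies in the pattern exactly when one step
threshold is exceeded, so its probability is a void probability. Inclusion probabilities determine
the law of a random subset of a finite set, hence the pattern of `f_n` converges in law to that of
`W + g` (`tendsto_measure_finset_eq`, `tendsto_measure_subset_voidPattern`).

The pattern determines the cells of the first `k` argmins, and shows that these are unique, on a
good event: no two low points share a cell, no two cells have their minima in one slot, and at least
`k` points are low (`kthArgmin_of_good`). This event has probability close to one for the limit and,
for large `n`, for `f_n` (`exists_good_discretization`). Close pairs are rare because two
independent points with law `ρ dx` rarely share a small cell. Slot collisions are rare because the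
minima over different cells are independent. Convergence in law of the argmins follows because the
cells have small diameter.

Existence of `W` comes from a Poisson process on space times `[0, ∞)` with intensity `λρ dx dt`: the
value of `W` at a point is the smallest mark there (`exists_isExtremeLaw`). -/

set_option linter.unusedSectionVars false

/-! ### Successive argmins and ranks -/

section OrderedArgmins

variable {X : Type*}

theorem argminUnion_mono (f : X → EReal) : Monotone (argminUnion f) :=
  monotone_nat_of_le_succ fun k => by
    rw [argminUnion_succ]; exact Set.subset_union_left

theorem kthMin_mono (f : X → EReal) : Monotone (kthMin f) := fun _ _ h =>
  biInf_mono fun _ hx hx' => hx (argminUnion_mono f h hx')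

theorem apply_eq_kthMin {f : X → EReal} {j : ℕ} {x : X} (h : x ∈ kthArgmin f j) :
    f x = kthMin f j := by
  cases j with
  | zero => exact h
  | succ j => exact h.2

theorem apply_le_kthMin {f : X → EReal} {j : ℕ} {x : X} (h : x ∈ argminUnion f (j + 1)) :
    f x ≤ kthMin f j := by
  rw [argminUnion_eq] at h
  simp only [Set.mem_iUnion] at h
  obtain ⟨i, hi, hx⟩ := h
  rw [apply_eq_kthMin hx]
  exact kthMin_mono f (by omega)

/-- The `j`-th argmins are the minimizers outside the previous ones. -/
theorem kthArgmin_eq_minimizers (f : X → EReal) (j : ℕ) :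
    kthArgmin f j = {x | x ∉ argminUnion f j ∧ ∀ y ∉ argminUnion f j, f x ≤ f y} := by
  have key : ∀ j (x : X), x ∉ argminUnion f j →
      ((∀ y ∉ argminUnion f j, f x ≤ f y) ↔ f x = kthMin f j) := by
    intro j x hx
    constructor
    · intro h
      exact le_antisymm (le_iInf₂ h) (iInf₂_le x hx)
    · intro h y hy
      rw [h]
      exact iInf₂_le y hy
  induction j with
  | zero =>
    ext x
    have h0 : x ∉ argminUnion f 0 := by simp [argminUnion]
    simp only [Set.mem_ofPred_eq, key 0 x h0, h0, not_false_eq_true, true_and]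
    rfl
  | succ j ih =>
    ext x
    constructor
    · intro hx
      have hx' : x ∉ argminUnion f (j + 1) := fun h => (apply_le_kthMin h).not_gt hx.1
      exact ⟨hx', (key _ x hx').2 hx.2⟩
    · rintro ⟨hx, hmin⟩
      have h2 := (key _ x hx).1 hmin
      -- If the value equalled the previous minimum, `x` would be a minimizer at stage `j` and would
      -- already have been removed.
      refine ⟨lt_of_le_of_ne (h2 ▸ kthMin_mono f (Nat.le_succ j)) fun h => hx ?_, h2⟩
      have hx' : x ∉ argminUnion f j := fun h => hx (argminUnion_mono f (Nat.le_succ j) h)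
      rw [argminUnion_succ, ih]
      exact Or.inr ⟨hx', (key _ x hx').2 h.symm⟩

theorem argminUnion_congr {f f' : X → EReal} (h : ∀ x y, f x ≤ f y ↔ f' x ≤ f' y) (j : ℕ) :
    argminUnion f j = argminUnion f' j := by
  induction j with
  | zero => rfl
  | succ j ih => simp only [argminUnion_succ, kthArgmin_eq_minimizers, ih, h]

/-- The sets of `j`-th argmins depend only on the order relation between the values. -/
theorem kthArgmin_congr {f f' : X → EReal} (h : ∀ x y, f x ≤ f y ↔ f' x ≤ f' y) (j : ℕ) :
    kthArgmin f j = kthArgmin f' j := by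
  simp only [kthArgmin_eq_minimizers, argminUnion_congr h, h]

/-- When the values up to `f y` are finitely many and distinct, removing argmins removes one point
at a time in increasing order. A point with `j` points strictly below it is therefore reached at
stage `j`. -/
theorem argminUnion_eq_setOf_lt {f : X → EReal} (j : ℕ) : ∀ y : X, {z | f z ≤ f y}.Finite →
    Set.InjOn f {z | f z ≤ f y} → {z | f z < f y}.ncard = j →
    argminUnion f j = {z | f z < f y} ∧ kthArgmin f j = {y} := by
  induction j with
  | zero =>
    intro y hfin hinj hcard
    have hlt : {z | f z < f y} = ∅ :=
      (Set.ncard_eq_zero (hfin.subset fun z (hz : f z < f y) => hz.le)).1 hcard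
    have hU : argminUnion f 0 = {z | f z < f y} := by rw [hlt]; rfl
    refine ⟨hU, ?_⟩
    rw [kthArgmin_eq_minimizers, hU]
    ext x
    simp only [Set.mem_ofPred_eq, not_lt, Set.mem_singleton_iff]
    constructor
    · rintro ⟨h1, h2⟩
      exact hinj (h2 y le_rfl) (le_refl (f y)) (le_antisymm (h2 y le_rfl) h1)
    · rintro rfl
      exact ⟨le_rfl, fun z hz => hz⟩
  | succ j ih =>
    intro y hfin hinj hcard
    have hsub : {z | f z < f y} ⊆ {z | f z ≤ f y} := fun z (hz : f z < f y) => hz.le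
    have hne : {z | f z < f y}.Nonempty := by
      rw [← Set.ncard_pos (hfin.subset hsub), hcard]; omega
    -- The highest point `y'` below `y` has rank `j`. By injectivity, the strict sublevel set of `y`
    -- is that of `y'` together with `y'` itself.
    obtain ⟨y', hy', hmax⟩ := Set.exists_max_image _ f (hfin.subset hsub) hne
    have hy'lt : f y' < f y := hy'
    have hsub' : {z | f z ≤ f y'} ⊆ {z | f z ≤ f y} := fun z (hz : f z ≤ f y') =>
      hz.trans hy'lt.le
    have heq : {z | f z < f y} = insert y' {z | f z < f y'} := by
      ext z
      simp only [Set.mem_ofPred_eq, Set.mem_insert_iff]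
      constructor
      · intro hz
        rcases (hmax z hz).lt_or_eq with h | h
        · exact Or.inr h
        · exact Or.inl (hinj hz.le hy'lt.le h)
      · rintro (rfl | h)
        · exact hy'lt
        · exact h.trans hy'lt
    have hfin' : {z | f z < f y'}.Finite :=
      hfin.subset fun z (hz : f z < f y') => (hz.trans hy'lt).le
    rw [heq, Set.ncard_insert_of_notMem (by simp) hfin'] at hcard
    obtain ⟨h1, h2⟩ := ih y' (hfin.subset hsub') (hinj.mono hsub') (by omega)
    have hU : argminUnion f (j + 1) = {z | f z < f y} := by
      rw [argminUnion_succ, h1, h2, heq, Set.union_singleton]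
    refine ⟨hU, ?_⟩
    rw [kthArgmin_eq_minimizers, hU]
    ext x
    simp only [Set.mem_ofPred_eq, not_lt, Set.mem_singleton_iff]
    constructor
    · rintro ⟨h1, h2⟩
      exact hinj (h2 y le_rfl) (le_refl (f y)) (le_antisymm (h2 y le_rfl) h1)
    · rintro rfl
      exact ⟨le_rfl, fun z hz => hz⟩

/-- The rank strictly increases with the value, so it injects the sublevel set into an initial
segment of the integers of the same cardinality. Hence every rank is attained. -/
theorem exists_ncard_lt_eq {f : X → EReal} {T : EReal} (hfin : {z | f z ≤ T}.Finite)
    (hinj : Set.InjOn f {z | f z ≤ T}) {j : ℕ} (hj : j < {z | f z ≤ T}.ncard) :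
    ∃ y, f y ≤ T ∧ {z | f z < f y}.ncard = j := by
  classical
  have hsub : ∀ y, f y ≤ T → {z | f z < f y} ⊆ {z | f z ≤ T} := fun y hy z hz =>
    (le_of_lt hz).trans hy
  have hlt : ∀ y y', f y' ≤ T → f y < f y' →
      {z | f z < f y}.ncard < {z | f z < f y'}.ncard := by
    intro y y' hy' h
    refine Set.ncard_lt_ncard ⟨fun z (hz : f z < f y) => hz.trans h, fun hs => ?_⟩
      (hfin.subset (hsub y' hy'))
    exact lt_irrefl (f y) (hs (show f y < f y' from h))
  have hsurj := Finset.surj_on_of_inj_on_of_card_le (s := hfin.toFinset)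
    (t := Finset.range {z | f z ≤ T}.ncard) (fun y _ => {z | f z < f y}.ncard)
    (by
      intro y hy
      rw [Set.Finite.mem_toFinset] at hy
      rw [Finset.mem_range]
      refine Set.ncard_lt_ncard ⟨hsub y hy, fun hs => ?_⟩ hfin
      exact lt_irrefl (f y) (hs hy))
    (by
      intro y y' hy hy' h
      rw [Set.Finite.mem_toFinset] at hy hy'
      rcases lt_trichotomy (f y) (f y') with h1 | h1 | h1
      · exact absurd h (hlt y y' hy' h1).ne
      · exact hinj hy hy' h1
      · exact absurd h (hlt y' y hy h1).ne')
    (by rw [Finset.card_range, Set.ncard_eq_toFinset_card _ hfin])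
  obtain ⟨y, hy, h⟩ := hsurj j (Finset.mem_range.2 hj)
  rw [Set.Finite.mem_toFinset] at hy
  exact ⟨y, hy, h.symm⟩

end OrderedArgmins

/-! ### Reading the argmins off a void pattern -/

section Pattern

variable {X ι : Type*} [Fintype ι]

open Classical in
/-- The pairs `(a, l)` such that `F > s l` on the cell with index `a`. -/
noncomputable def voidPattern (c : X → ι) (s : ℕ → ℝ) (L : ℕ) (F : X → EReal) :
    Finset (ι × ℕ) :=
  (Finset.univ ×ˢ Finset.range (L + 1)).filter fun p => ∀ y, c y = p.1 → (s p.2 : EReal) < F y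

theorem mem_voidPattern {c : X → ι} {s : ℕ → ℝ} {L : ℕ} {F : X → EReal} {a : ι} {l : ℕ}
    (hl : l ≤ L) : (a, l) ∈ voidPattern c s L F ↔ ∀ y, c y = a → (s l : EReal) < F y := by
  simp [voidPattern, hl]

/-- According to the pattern `κ`, the minimum over the cell `a` lies in the time slot `l`. -/
def IsSlot (κ : Finset (ι × ℕ)) (a : ι) (l : ℕ) : Prop := (a, l) ∈ κ ∧ (a, l + 1) ∉ κ

/-- No two cells have their minima in the same time slot. -/
def DistinctSlots (L : ℕ) (κ : Finset (ι × ℕ)) : Prop :=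
  ∀ a b, a ≠ b → ∀ l < L, ¬(IsSlot κ a l ∧ IsSlot κ b l)

/-- The minimum over the cell `a` is the `j`-th smallest, according to the pattern `κ`. -/
def IsRankCell (L : ℕ) (κ : Finset (ι × ℕ)) (j : ℕ) (a : ι) : Prop :=
  ∃ l < L, IsSlot κ a l ∧ {b | (b, l) ∉ κ}.ncard = j

open Classical in
/-- The representative (under `rep`) of the cell with the `j`-th smallest minimum. -/
noncomputable def rankRep {V : Type*} [Zero V] (rep : ι → V) (L : ℕ) (κ : Finset (ι × ℕ))
    (j : ℕ) : V :=
  if h : ∃ a, IsRankCell L κ j a then rep h.choose else 0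

/-- This is the deterministic core. Low points have distinct cells, hence are finitely many, and
distinct slots, hence have distinct values. The rank of a low point is then the number of cells that
are not void at the lower end of its slot, which the pattern records. -/
theorem kthArgmin_of_good {c : X → ι} {s : ℕ → ℝ} (hs : Monotone s) {L : ℕ} {F : X → EReal}
    (h0 : ∀ y, (s 0 : EReal) < F y)
    (hcell : ∀ y y', F y ≤ s L → F y' ≤ s L → c y = c y' → y = y')
    (hslot : DistinctSlots L (voidPattern c s L F))
    {k : ℕ} (hk : ∃ t : Finset X, k ≤ t.card ∧ ∀ y ∈ t, F y ≤ s L) {j : ℕ} (hj : j < k) :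
    ∃ y, kthArgmin F j = {y} ∧
      ∀ {V : Type*} [Zero V] (rep : ι → V),
        rankRep rep L (voidPattern c s L F) j = rep (c y) := by
  set κ := voidPattern c s L F with hκ
  set S : Set X := {z | F z ≤ s L} with hS
  have hcS : Set.InjOn c S := fun y hy y' hy' h => hcell y y' hy hy' h
  have hfin : S.Finite := Set.Finite.of_finite_image (Set.toFinite (c '' S)) hcS
  have hsl : ∀ l ≤ L, (s l : EReal) ≤ s L := fun l hl => EReal.coe_le_coe_iff.2 (hs hl)
  -- the slot of a point of `S`
  have hslotOf : ∀ y ∈ S, ∃ l < L, (s l : EReal) < F y ∧ F y ≤ s (l + 1) := by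
    intro y hy
    classical
    have hex : ∃ l, F y ≤ s l := ⟨L, hy⟩
    have h1 := Nat.find_spec hex
    have h2 : Nat.find hex ≤ L := Nat.find_min' hex hy
    -- The base level lies strictly below all values, so the first level reaching `F y` has a
    -- predecessor, and the two bound the slot of `y`.
    have h3 : Nat.find hex ≠ 0 := fun h => by
      rw [h] at h1; exact (h0 y).not_ge h1
    obtain ⟨l, hl⟩ := Nat.exists_eq_succ_of_ne_zero h3
    refine ⟨l, by omega, not_le.1 (Nat.find_min hex (by omega)), ?_⟩
    rw [hl] at h1
    exact h1
  have hisSlot : ∀ y ∈ S, ∀ l < L, (s l : EReal) < F y → F y ≤ s (l + 1) →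
      IsSlot κ (c y) l := by
    intro y hy l hl h1 h2
    refine ⟨(mem_voidPattern hl.le).2 fun y' hy' => ?_, fun h => ?_⟩
    · by_contra hcon
      have hy'S : y' ∈ S := (not_lt.1 hcon).trans (hsl l hl.le)
      rw [hcS hy'S hy hy'] at hcon
      exact hcon h1
    · exact ((mem_voidPattern (by omega)).1 h y rfl).not_ge h2
  have hsame : ∀ y ∈ S, ∀ y' ∈ S, ∀ l < L, (s l : EReal) < F y → F y ≤ s (l + 1) →
      (s l : EReal) < F y' → F y' ≤ s (l + 1) → y = y' := by
    intro y hy y' hy' l hl h1 h2 h3 h4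
    by_contra hne
    exact hslot (c y) (c y') (fun h => hne (hcS hy hy' h)) l hl
      ⟨hisSlot y hy l hl h1 h2, hisSlot y' hy' l hl h3 h4⟩
  have hinj : Set.InjOn F S := by
    intro y hy y' hy' h
    obtain ⟨l, hl, h1, h2⟩ := hslotOf y hy
    exact hsame y hy y' hy' l hl h1 h2 (h ▸ h1) (h ▸ h2)
  obtain ⟨t, ht, htS⟩ := hk
  have hcard : j < S.ncard := by
    have := Set.ncard_le_ncard (s := (t : Set X)) (t := S) (fun y hy => htS y hy) hfin
    rw [Set.ncard_coe_finset] at this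
    omega
  obtain ⟨y, hyS, hy⟩ := exists_ncard_lt_eq hfin hinj hcard
  have hle : {z | F z ≤ F y} ⊆ S := fun z (hz : F z ≤ F y) => hz.trans hyS
  refine ⟨y, (argminUnion_eq_setOf_lt j y (hfin.subset hle) (hinj.mono hle) hy).2, ?_⟩
  intro V _ rep
  obtain ⟨l, hl, h1, h2⟩ := hslotOf y hyS
  have hrank : IsRankCell L κ j (c y) := by
    refine ⟨l, hl, hisSlot y hyS l hl h1 h2, ?_⟩
    rw [← hy]
    -- A cell fails at level `s l` exactly when it contains a point with value at most `s l`. A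
    -- point below `y` has such a value, since otherwise it would share the slot of `y`.
    have : {b | (b, l) ∉ κ} = c '' {z | F z < F y} := by
      ext b
      simp only [Set.mem_ofPred_eq, hκ, mem_voidPattern hl.le, Set.mem_image]
      push Not
      constructor
      · rintro ⟨z, hzb, hz⟩
        exact ⟨z, hz.trans_lt h1, hzb⟩
      · rintro ⟨z, hz, hzb⟩
        refine ⟨z, hzb, ?_⟩
        by_contra hcon
        have := hsame z (hle hz.le) y hyS l hl (not_le.1 hcon) (hz.le.trans h2) h1 h2
        exact hz.ne (by rw [this])
    rw [this]
    exact (hcS.mono fun z (hz : F z < F y) => hle hz.le).ncard_image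
  have hmono : ∀ b l l', l ≤ l' → l' ≤ L → (b, l) ∉ κ → (b, l') ∉ κ := by
    intro b l l' hll hl' h h'
    refine h ((mem_voidPattern (hll.trans hl')).2 fun z hz => ?_)
    exact (EReal.coe_le_coe_iff.2 (hs hll)).trans_lt ((mem_voidPattern hl').1 h' z hz)
  have hlt : ∀ a a' l l', l < l' → l' < L → IsSlot κ a l → IsSlot κ a' l' →
      {b | (b, l) ∉ κ}.ncard < {b | (b, l') ∉ κ}.ncard := by
    intro a a' l l' hll hl' ha ha'
    refine Set.ncard_lt_ncard ⟨fun b hb => hmono b l l' hll.le hl'.le hb, fun hsub => ?_⟩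
      (Set.toFinite _)
    exact hsub (hmono a (l + 1) l' hll hl'.le ha.2) ha.1
  have hex : ∃ a, IsRankCell L κ j a := ⟨_, hrank⟩
  -- The cell chosen in `rankRep` must be that of `y`: the count of non-void cells differs between
  -- occupied slots, and a slot is occupied by one cell only.
  rw [rankRep, dif_pos hex]
  congr 1
  obtain ⟨l', hl', hs', hc'⟩ := hex.choose_spec
  obtain ⟨l, hl, hs1, hc1⟩ := hrank
  rcases lt_trichotomy l l' with h | h | h
  · exact absurd (hlt _ _ l l' h hl' hs1 hs') (by omega)
  · subst h
    by_contra hne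
    exact hslot _ _ hne l hl ⟨hs', hs1⟩
  · exact absurd (hlt _ _ l' l h hl hs' hs1) (by omega)

end Pattern

/-! ### Partitions into small cells with null boundaries -/

section Cells

variable {X : Type*}

/-- The index of the cell of `y` in the partition generated by `U 0, …, U (r - 1)`. -/
def cell (U : ℕ → Set X) (r : ℕ) (y : X) : Fin r → Prop := fun i => y ∈ U i

theorem cell_eq_iff {U : ℕ → Set X} {r : ℕ} {y z : X} :
    cell U r y = cell U r z ↔ ∀ i < r, (y ∈ U i ↔ z ∈ U i) := by
  constructor
  · intro h i hi
    exact iff_of_eq (congrFun h ⟨i, hi⟩)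
  · intro h
    funext i
    exact propext (h i i.2)

theorem cell_eq_of_le {U : ℕ → Set X} {r r' : ℕ} (h : r ≤ r') {y z : X}
    (hyz : cell U r' y = cell U r' z) : cell U r y = cell U r z :=
  cell_eq_iff.2 fun i hi => cell_eq_iff.1 hyz i (hi.trans_le h)

/-- A function whose oscillation on the cells tends to zero. -/
def CellUniform (U : ℕ → Set X) (t : X → ℝ) : Prop :=
  ∀ ε > 0, ∀ᶠ r in atTop, ∀ y z, cell U r y = cell U r z → |t y - t z| < ε

theorem cellUniform_comp_cell (U : ℕ → Set X) {r : ℕ} (h : (Fin r → Prop) → ℝ) :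
    CellUniform U fun y => h (cell U r y) := by
  intro ε hε
  filter_upwards [eventually_ge_atTop r] with r' hr' y z hyz
  simpa [cell_eq_of_le hr' hyz] using hε

theorem CellUniform.sub {U : ℕ → Set X} {t u : X → ℝ} (ht : CellUniform U t)
    (hu : CellUniform U u) : CellUniform U fun y => t y - u y := by
  intro ε hε
  filter_upwards [ht (ε / 2) (half_pos hε), hu (ε / 2) (half_pos hε)] with r h1 h2 y z hyz
  have h1 := abs_lt.1 (h1 y z hyz)
  have h2 := abs_lt.1 (h2 y z hyz)
  rw [abs_lt]; constructor <;> linarith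

theorem CellUniform.max_zero {U : ℕ → Set X} {t : X → ℝ} (ht : CellUniform U t) :
    CellUniform U fun y => max (t y) 0 := by
  intro ε hε
  filter_upwards [ht ε hε] with r h1 y z hyz
  exact (abs_max_sub_max_le_abs _ _ _).trans_lt (h1 y z hyz)

theorem CellUniform.exists_approx {U : ℕ → Set X} {t : X → ℝ} (ht : CellUniform U t)
    {ε : ℝ} (hε : 0 < ε) :
    ∃ r, ∃ v : (Fin r → Prop) → ℝ, ∀ y, |t y - v (cell U r y)| < ε := by
  classical
  obtain ⟨r, hr⟩ := (ht ε hε).exists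
  refine ⟨r, fun a => if h : ∃ y, cell U r y = a then t h.choose else 0, fun y => ?_⟩
  have h : ∃ z, cell U r z = cell U r y := ⟨y, rfl⟩
  simp only [dif_pos h]
  exact hr _ _ h.choose_spec.symm

theorem CellUniform.exists_bound {U : ℕ → Set X} {t : X → ℝ} (ht : CellUniform U t) :
    ∃ C, 0 ≤ C ∧ ∀ y, |t y| ≤ C := by
  obtain ⟨r, v, h⟩ := ht.exists_approx one_pos
  refine ⟨∑ a, |v a| + 1, by positivity, fun y => ?_⟩
  have h1 : |v (cell U r y)| ≤ ∑ a, |v a| :=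
    Finset.single_le_sum (f := fun a => |v a|) (fun a _ => abs_nonneg _) (Finset.mem_univ _)
  have h2 := abs_sub_abs_le_abs_sub (t y) (v (cell U r y))
  linarith [h y]

theorem CellUniform.mul {U : ℕ → Set X} {t u : X → ℝ} (ht : CellUniform U t)
    (hu : CellUniform U u) : CellUniform U fun y => t y * u y := by
  obtain ⟨A, hA0, hA⟩ := ht.exists_bound
  obtain ⟨B, hB0, hB⟩ := hu.exists_bound
  intro ε hε
  have hδ : 0 < ε / (A + B + 1) := by positivity
  filter_upwards [ht _ hδ, hu _ hδ] with r h1 h2 y z hyz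
  have h1 := h1 y z hyz
  have h2 := h2 y z hyz
  have : t y * u y - t z * u z = t y * (u y - u z) + (t y - t z) * u z := by ring
  calc |t y * u y - t z * u z| ≤ |t y| * |u y - u z| + |t y - t z| * |u z| := by
        rw [this, ← abs_mul, ← abs_mul]; exact abs_add_le _ _
    _ ≤ A * (ε / (A + B + 1)) + (ε / (A + B + 1)) * B := by
        gcongr
        · exact hA y
        · exact hB z
    _ = ε * ((A + B) / (A + B + 1)) := by ring
    _ < ε * 1 := by
        gcongr
        rw [div_lt_one (by positivity)]; linarith
    _ = ε := mul_one _

/-- The probability that two independent points fall into the same cell. -/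
noncomputable def cellCollision [MeasurableSpace X] (U : ℕ → Set X) (m : Measure X) (r : ℕ) : ℝ :=
  (m.prod m).real {p | cell U r p.1 = cell U r p.2}

variable [MetricSpace X] [MeasurableSpace X]

/-- A sequence of open sets with null boundaries, containing arbitrarily small neighbourhoods of
every point. -/
structure IsFineBasis (U : ℕ → Set X) (m : Measure X) : Prop where
  isOpen : ∀ i, IsOpen (U i)
  null : ∀ i, m (frontier (U i)) = 0
  fine : ∀ x, ∀ ε > 0, ∃ i, x ∈ U i ∧ ∀ y ∈ U i, ∀ z ∈ U i, dist y z < ε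

/-- Around each point of a dense sequence, every interval of radii contains one for which the ball
has a null frontier. -/
theorem exists_isFineBasis [BorelSpace X] [TopologicalSpace.SeparableSpace X] [Nonempty X] (m : Measure X)
    [SFinite m] : ∃ U : ℕ → Set X, IsFineBasis U m := by
  have hr : ∀ p : ℕ × ℕ, ∃ r ∈ Set.Ioo (1 / (2 * ((p.1 : ℝ) + 1))) (1 / ((p.1 : ℝ) + 1)),
      m (frontier (Metric.thickening r {TopologicalSpace.denseSeq X p.2})) = 0 := fun p =>
    exists_null_frontier_thickening m _ (by
      apply one_div_lt_one_div_of_lt <;> linarith [(Nat.cast_nonneg p.1 : (0 : ℝ) ≤ p.1)])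
  choose r hr hnull using hr
  refine ⟨fun i => Metric.thickening (r i.unpair) {TopologicalSpace.denseSeq X i.unpair.2},
    fun i => Metric.isOpen_thickening, fun i => hnull _, fun x ε hε => ?_⟩
  -- The lower bound on the radius makes the ball around a nearby dense point contain `x`; the upper
  -- bound makes its diameter less than `ε`.
  obtain ⟨n, hn⟩ := exists_nat_one_div_lt (half_pos hε)
  obtain ⟨j, hj⟩ := (TopologicalSpace.denseRange_denseSeq X).exists_dist_lt x
    (ε := 1 / (2 * ((n : ℝ) + 1))) (by positivity)
  refine ⟨Nat.pair n j, ?_, ?_⟩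
  · simp only [Nat.unpair_pair, Metric.thickening_singleton, Metric.mem_ball]
    exact hj.trans (hr (n, j)).1
  · simp only [Nat.unpair_pair, Metric.thickening_singleton, Metric.mem_ball]
    intro y hy z hz
    have h2 := (hr (n, j)).2
    have h3 := dist_triangle_right y z (TopologicalSpace.denseSeq X j)
    simp only at h2
    linarith

namespace IsFineBasis

variable {U : ℕ → Set X} {m : Measure X}

/-- By compactness finitely many small basis sets cover the space. Once all their indices are below
`r`, two points of one cell lie in a common small set. -/
theorem eventually_dist_lt [CompactSpace X] (hU : IsFineBasis U m) {ε : ℝ} (hε : 0 < ε) :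
    ∀ᶠ r in atTop, ∀ y z, cell U r y = cell U r z → dist y z < ε := by
  choose i hi hdist using fun x => hU.fine x ε hε
  obtain ⟨t, ht⟩ := isCompact_univ.elim_finite_subcover (fun x => U (i x))
    (fun x => hU.isOpen _) (fun x _ => Set.mem_iUnion.2 ⟨x, hi x⟩)
  filter_upwards [eventually_gt_atTop (t.sup i)] with r hr y z hyz
  obtain ⟨x, hx⟩ := Set.mem_iUnion.1 (ht (Set.mem_univ y))
  obtain ⟨hxt, hxy⟩ := Set.mem_iUnion.1 hx
  have hlt : i x < r := (Finset.le_sup hxt).trans_lt hr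
  exact hdist x y hxy z ((cell_eq_iff.1 hyz _ hlt).1 hxy)

theorem cellUniform_of_continuous [CompactSpace X] (hU : IsFineBasis U m) {t : X → ℝ}
    (ht : Continuous t) : CellUniform U t := by
  intro ε hε
  have huc := CompactSpace.uniformContinuous_of_continuous ht
  obtain ⟨δ, hδ, h⟩ := Metric.uniformContinuous_iff.1 huc ε hε
  filter_upwards [hU.eventually_dist_lt hδ] with r hr y z hyz
  rw [← Real.dist_eq]
  exact h (hr y z hyz)

theorem measurable_cell [BorelSpace X] (hU : IsFineBasis U m) (r : ℕ) : Measurable (cell U r) :=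
  measurable_pi_lambda _ fun i => measurable_mem.2 (hU.isOpen i).measurableSet

theorem measurableSet_cell [BorelSpace X] (hU : IsFineBasis U m) (r : ℕ) (a : Fin r → Prop) :
    MeasurableSet {y | cell U r y = a} := hU.measurable_cell r (measurableSet_singleton a)

theorem measurable_of_cellUniform [BorelSpace X] (hU : IsFineBasis U m) {t : X → ℝ}
    (ht : CellUniform U t) : Measurable t := by
  choose r v h using fun n : ℕ => ht.exists_approx (ε := 1 / ((n : ℝ) + 1)) (by positivity)
  refine measurable_of_tendsto_metrizable
    (f := fun n y => v n (cell U (r n) y)) (fun n => ?_) (tendsto_pi_nhds.2 fun y => ?_)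
  · exact (measurable_of_countable (v n)).comp (hU.measurable_cell (r n))
  · rw [tendsto_iff_dist_tendsto_zero]
    refine squeeze_zero (fun _ => dist_nonneg) (fun n => ?_)
      (tendsto_one_div_add_atTop_nhds_zero_nat (𝕜 := ℝ))
    rw [dist_comm, Real.dist_eq]
    exact (h n y).le

theorem integrable_of_cellUniform [BorelSpace X] [IsFiniteMeasure m] (hU : IsFineBasis U m)
    {t : X → ℝ} (ht : CellUniform U t) : Integrable t m := by
  obtain ⟨C, _, hC⟩ := ht.exists_bound
  exact Integrable.of_bound (hU.measurable_of_cellUniform ht).aestronglyMeasurable C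
    (Eventually.of_forall hC)

/-- Away from the frontiers of the generating sets, membership in each of them is locally constant,
and so is the cell. -/
theorem null_frontier_cell (hU : IsFineBasis U m) (r : ℕ) (a : Fin r → Prop) :
    m (frontier {y | cell U r y = a}) = 0 := by
  refine measure_mono_null (t := ⋃ i : Fin r, frontier (U i)) ?_
    (measure_iUnion_null fun i => hU.null i)
  intro y hy
  by_contra hcon
  simp only [Set.mem_iUnion, not_exists] at hcon
  have h1 : ∀ i : Fin r, ∀ᶠ z in 𝓝 y, (z ∈ U i ↔ y ∈ U i) := by
    intro i
    by_cases hyi : y ∈ U i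
    · filter_upwards [(hU.isOpen i).mem_nhds hyi] with z hz
      simp [hz, hyi]
    · have : y ∉ closure (U i) := fun hcl => hcon i ⟨hcl, fun hint => hyi (interior_subset hint)⟩
      filter_upwards [isClosed_closure.isOpen_compl.mem_nhds this] with z hz
      simp only [hyi, iff_false]
      exact fun h => hz (subset_closure h)
  have h2 : ∀ᶠ z in 𝓝 y, cell U r z = cell U r y := by
    filter_upwards [eventually_all.2 h1] with z hz
    exact cell_eq_iff.2 fun i hi => hz ⟨i, hi⟩
  by_cases hya : cell U r y = a
  · exact hy.2 (mem_interior_iff_mem_nhds.2 (by filter_upwards [h2] with z hz using hz.trans hya))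
  · have : {y | cell U r y = a}ᶜ ∈ 𝓝 y := by
      filter_upwards [h2] with z hz h using hya (hz ▸ h)
    exact mem_closure_iff_nhds.1 hy.1 _ this |>.elim fun z hz => hz.1 hz.2

/-- The laws of `W` are prescribed on closed sets only, while cells need not be closed. Each cell is
a finite intersection of open sets and complements of open sets, and open sets in a metric space are
increasing unions of closed ones. -/
theorem exists_isClosed_exhaustion (hU : IsFineBasis U m) (r : ℕ) (a : Fin r → Prop) :
    ∃ C : ℕ → Set X, (∀ j, IsClosed (C j)) ∧ Monotone C ∧ ⋃ j, C j = {y | cell U r y = a} := by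
  have h : ∀ i : Fin r, ∃ C : ℕ → Set X, (∀ j, IsClosed (C j)) ∧ Monotone C ∧
      ⋃ j, C j = {y | (y ∈ U i) = a i} := by
    intro i
    by_cases hai : a i
    · obtain ⟨F, hF, -, hFU, hmono⟩ := (hU.isOpen i).exists_iUnion_isClosed
      refine ⟨F, hF, hmono, hFU.trans ?_⟩
      ext y; simp [hai]
    · refine ⟨fun _ => (U i)ᶜ, fun _ => (hU.isOpen i).isClosed_compl, fun _ _ _ => le_rfl, ?_⟩
      ext y; simp [hai]
  choose C hC hmono hCU using h
  refine ⟨fun j => ⋂ i, C i j, fun j => isClosed_iInter fun i => hC i j,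
    fun j j' hjj => Set.iInter_mono fun i => hmono i hjj, ?_⟩
  ext y
  simp only [Set.mem_iUnion, Set.mem_iInter, Set.mem_ofPred_eq]
  constructor
  · rintro ⟨j, hj⟩
    funext i
    exact (hCU i).subset (Set.mem_iUnion.2 ⟨j, hj i⟩)
  · intro hy
    have h1 : ∀ i, ∃ j, y ∈ C i j := fun i =>
      Set.mem_iUnion.1 ((hCU i).symm.subset (congrFun hy i))
    choose j hj using h1
    exact ⟨Finset.univ.sup j, fun i => hmono i (Finset.le_sup (Finset.mem_univ i)) (hj i)⟩

theorem measurableSet_cell_eq [BorelSpace X] (hU : IsFineBasis U m) (r : ℕ) :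
    MeasurableSet {p : X × X | cell U r p.1 = cell U r p.2} := by
  have : {p : X × X | cell U r p.1 = cell U r p.2} =
      (fun p : X × X => (cell U r p.1, cell U r p.2)) ⁻¹' {q | q.1 = q.2} := rfl
  rw [this]
  exact (((hU.measurable_cell r).comp measurable_fst).prodMk
    ((hU.measurable_cell r).comp measurable_snd)) (Set.toFinite _).measurableSet

/-- The collision events decrease to the diagonal, which is null for the product measure because `m`
has no atoms. -/
theorem tendsto_cellCollision [BorelSpace X] [SecondCountableTopology X] [IsFiniteMeasure m]
    [NullSingletonClass m] (hU : IsFineBasis U m) : Tendsto (cellCollision U m) atTop (𝓝 0) := by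
  have h1 : Tendsto (fun r => (m.prod m) {p | cell U r p.1 = cell U r p.2}) atTop
      (𝓝 ((m.prod m) (⋂ r, {p | cell U r p.1 = cell U r p.2}))) :=
    tendsto_measure_iInter_atTop (fun r => (hU.measurableSet_cell_eq r).nullMeasurableSet)
      (fun r r' h p hp => cell_eq_of_le h hp) ⟨0, measure_ne_top _ _⟩
  have h2 : (m.prod m) (⋂ r, {p | cell U r p.1 = cell U r p.2}) = 0 := by
    have : (⋂ r, {p : X × X | cell U r p.1 = cell U r p.2}) ⊆ Set.diagonal X := by
      intro p hp
      by_contra hne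
      obtain ⟨i, hi, hd⟩ := hU.fine p.1 (dist p.1 p.2) (dist_pos.2 hne)
      have := Set.mem_iInter.1 hp (i + 1)
      exact lt_irrefl _ (hd _ hi _ ((cell_eq_iff.1 this i (Nat.lt_succ_self i)).1 hi))
    refine measure_mono_null this ?_
    rw [Measure.prod_apply isClosed_diagonal.measurableSet]
    have : ∀ x : X, Prod.mk x ⁻¹' Set.diagonal X = {x} := by
      intro x; ext y; simp [eq_comm]
    simp [this]
  rw [h2] at h1
  exact (ENNReal.tendsto_toReal_zero_iff (fun _ => measure_ne_top _ _)).2 h1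

/-- The rectangles formed by pairs of fine cells are disjoint, and those indexed by `J` lie inside
the coarse collision event. This turns union bounds over pairs of cells into collision
probabilities. -/
theorem sum_mul_le_cellCollision [BorelSpace X] [IsFiniteMeasure m]
    (hU : IsFineBasis U m) {r r' : ℕ} (J : Finset ((Fin r' → Prop) × (Fin r' → Prop)))
    (hJ : ∀ p ∈ J, ∀ y z, cell U r' y = p.1 → cell U r' z = p.2 → cell U r y = cell U r z) :
    ∑ p ∈ J, m.real {y | cell U r' y = p.1} * m.real {y | cell U r' y = p.2} ≤
      cellCollision U m r := by
  have h1 : ∀ p ∈ J, m.real {y | cell U r' y = p.1} * m.real {y | cell U r' y = p.2} =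
      (m.prod m).real ({y | cell U r' y = p.1} ×ˢ {y | cell U r' y = p.2}) := fun p _ => by
    rw [measureReal_prod_prod]
  rw [Finset.sum_congr rfl h1, ← measureReal_biUnion_finset]
  · refine measureReal_mono ?_
    intro q hq
    simp only [Set.mem_iUnion] at hq
    obtain ⟨p, hp, h1, h2⟩ := hq
    exact hJ p hp _ _ h1 h2
  · intro p _ q _ hpq
    refine Set.disjoint_left.2 fun z hz hz' => hpq ?_
    exact Prod.ext (hz.1.symm.trans hz'.1) (hz.2.symm.trans hz'.2)
  · intro p _
    exact (hU.measurableSet_cell _ _).prod (hU.measurableSet_cell _ _)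

theorem sum_cell_eq_one [BorelSpace X] [IsProbabilityMeasure m] (hU : IsFineBasis U m) (r : ℕ) :
    ∑ a, m.real {y | cell U r y = a} = 1 := by
  rw [← measureReal_biUnion_finset]
  · have : (⋃ a ∈ Finset.univ, {y | cell U r y = a}) = Set.univ := by
      ext y; simp
    rw [this, probReal_univ]
  · intro p _ q _ hpq
    exact Set.disjoint_left.2 fun z hz hz' => hpq (hz.symm.trans hz')
  · exact fun a _ => hU.measurableSet_cell _ _

theorem integral_comp_cell [BorelSpace X] [IsFiniteMeasure m] (hU : IsFineBasis U m) {r : ℕ}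
    (v : (Fin r → Prop) → ℝ) {w : X → ℝ} (hw : Integrable w m) :
    ∫ y, w y * v (cell U r y) ∂m = ∑ a, v a * ∫ y in {y | cell U r y = a}, w y ∂m := by
  have h1 : ∀ a, v a * ∫ y in {y | cell U r y = a}, w y ∂m =
      ∫ y, {y | cell U r y = a}.indicator (fun y => v a * w y) y ∂m := fun a => by
    rw [integral_indicator (hU.measurableSet_cell _ _), integral_const_mul]
  simp only [h1]
  rw [← integral_finsetSum _ fun a _ =>
    ((hw.const_mul (v a)).indicator (hU.measurableSet_cell r a))]
  refine integral_congr_ae (Eventually.of_forall fun y => ?_)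
  simp only
  rw [Finset.sum_eq_single (cell U r y)]
  · simp [mul_comm]
  · intro b _ hb
    exact Set.indicator_of_notMem (fun h => hb h.symm) _
  · simp

end IsFineBasis

end Cells

theorem abs_exp_neg_sub_exp_neg_le {a b : ℝ} (ha : 0 ≤ a) (hb : 0 ≤ b) :
    |Real.exp (-a) - Real.exp (-b)| ≤ |a - b| := by
  wlog h : a ≤ b generalizing a b
  · rw [abs_sub_comm, abs_sub_comm a b]
    exact this hb ha (not_le.1 h).le
  have h1 : Real.exp (-b) ≤ Real.exp (-a) := Real.exp_le_exp.2 (by linarith)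
  rw [abs_of_nonneg (by linarith), abs_of_nonpos (by linarith)]
  have h2 : Real.exp (-b) = Real.exp (-a) * Real.exp (-(b - a)) := by
    rw [← Real.exp_add]; congr 1; ring
  have h3 := Real.add_one_le_exp (-(b - a))
  have h4 : Real.exp (-a) ≤ 1 := Real.exp_le_one_iff.2 (by linarith)
  have h5 := Real.exp_pos (-a)
  rw [h2]
  nlinarith

/-- This serves for events such as `aboveSet t`, uncountable intersections which step thresholds
approximate from inside and outside. -/
theorem nullMeasurableSet_of_sandwich {α : Type*} [MeasurableSpace α] {μ : Measure α}
    [IsFiniteMeasure μ] {S : Set α}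
    (h : ∀ ε > 0, ∃ A B, MeasurableSet A ∧ MeasurableSet B ∧ A ⊆ S ∧ S ⊆ B ∧
      μ.real B - μ.real A ≤ ε) : NullMeasurableSet S μ := by
  choose A B hA hB hAS hSB hAB using fun n : ℕ => h (1 / ((n : ℝ) + 1)) (by positivity)
  have hsub : ⋃ n, A n ⊆ S := Set.iUnion_subset hAS
  refine (MeasurableSet.iUnion hA).nullMeasurableSet.congr (ae_eq_set.2 ⟨?_, ?_⟩)
  · rw [Set.sdiff_eq_empty.2 hsub, measure_empty]
  · have hle : ∀ n : ℕ, μ.real (S \ ⋃ n, A n) ≤ 1 / ((n : ℝ) + 1) := fun n =>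
      calc μ.real (S \ ⋃ n, A n) ≤ μ.real (B n \ A n) :=
            measureReal_mono (Set.sdiff_subset_sdiff (hSB n) (Set.subset_iUnion A n))
        _ = μ.real (B n) - μ.real (A n) :=
            measureReal_sdiff ((hAS n).trans (hSB n)) (hA n)
        _ ≤ _ := hAB n
    have h0 : μ.real (S \ ⋃ n, A n) ≤ 0 :=
      ge_of_tendsto' (tendsto_one_div_add_atTop_nhds_zero_nat (𝕜 := ℝ)) hle
    exact (measureReal_eq_zero_iff).1 (le_antisymm h0 measureReal_nonneg)

/-! ### Void probabilities of the extreme value process -/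

section ExtremeLaw

variable {X : Type*} [MetricSpace X] [CompactSpace X] [MeasurableSpace X] [BorelSpace X]

/-- The exponent of the void probability below the threshold `t`. -/
noncomputable def voidExponent (lam : X → ℝ) (m : Measure X) (t : X → ℝ) : ℝ :=
  ∫ y, lam y * max (t y) 0 ∂m

/-- The extreme value law with intensity `lam dm` on a compact space. -/
structure IsExtremeLaw (lam : X → ℝ) (m : Measure X) (ν : Measure (LSCFun X)) : Prop where
  exponential : ∀ C : Set X, IsClosed C → ∀ t : ℝ, 0 ≤ t →
    ν {f | (t : EReal) < infOn f.1 C} =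
      ENNReal.ofReal (Real.exp (-((∫ y in C, lam y ∂m) * t)))
  indep : ∀ (n : ℕ) (C : Fin n → Set X), (∀ i, IsClosed (C i)) →
    (∀ i j, i ≠ j → Disjoint (C i) (C j)) →
    iIndepFun (fun (i : Fin n) (f : LSCFun X) => infOn f.1 (C i)) ν

/-- A closed subset of a compact space is compact, so a lower semicontinuous function attains its
minimum there and the strict inequality survives the infimum. -/
theorem lt_infOn_iff {f : X → EReal} (hf : LowerSemicontinuous f) {C : Set X} (hC : IsClosed C)
    (t : ℝ) : (t : EReal) < infOn f C ↔ ∀ y ∈ C, (t : EReal) < f y := by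
  constructor
  · exact fun h y hy => h.trans_le (iInf₂_le y hy)
  · intro h
    rcases C.eq_empty_or_nonempty with rfl | hne
    · simp [infOn]
    · obtain ⟨y, hy, hmin⟩ := (hf.lowerSemicontinuousOn C).exists_isMinOn hne hC.isCompact
      exact (h y hy).trans_le (le_iInf₂ fun z hz => hmin hz)

theorem measurableSet_lt_infOn {C : Set X} (hC : IsClosed C) (t : ℝ) :
    MeasurableSet {f : LSCFun X | (t : EReal) < infOn f.1 C} :=
  MeasurableSpace.measurableSet_generateFrom ⟨C, t, hC.isCompact, rfl⟩

/-- The functions that exceed the threshold `t` everywhere. -/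
def aboveSet (t : X → ℝ) : Set (LSCFun X) := {f | ∀ y, (t y : EReal) < f.1 y}

theorem aboveSet_anti {t u : X → ℝ} (h : ∀ y, t y ≤ u y) : aboveSet u ⊆ aboveSet t :=
  fun _ hf y => (EReal.coe_le_coe_iff.2 (h y)).trans_lt (hf y)

variable {U : ℕ → Set X} {m : Measure X} [IsFiniteMeasure m] {lam : X → ℝ}
  {ν : Measure (LSCFun X)}

theorem aboveSet_cell_eq_iInter {r : ℕ} {C : (Fin r → Prop) → ℕ → Set X}
    (hC : ∀ a j, IsClosed (C a j)) (hCU : ∀ a, ⋃ j, C a j = {y | cell U r y = a})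
    (v : (Fin r → Prop) → ℝ) :
    aboveSet (fun y => v (cell U r y)) =
      ⋂ j, ⋂ a, {f : LSCFun X | (v a : EReal) < infOn f.1 (C a j)} := by
  ext f
  simp only [aboveSet, Set.mem_ofPred_eq, Set.mem_iInter, lt_infOn_iff f.2.1 (hC _ _)]
  constructor
  · intro h j a y hy
    have : cell U r y = a := (hCU a).subset (Set.mem_iUnion.2 ⟨j, hy⟩)
    exact this ▸ h y
  · intro h y
    obtain ⟨j, hj⟩ := Set.mem_iUnion.1 ((hCU (cell U r y)).symm.subset rfl)
    exact h j _ y hj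

namespace IsFineBasis

theorem measurableSet_aboveSet (hU : IsFineBasis U m) {r : ℕ} (v : (Fin r → Prop) → ℝ) :
    MeasurableSet (aboveSet fun y => v (cell U r y)) := by
  choose C hC hmono hCU using hU.exists_isClosed_exhaustion r
  rw [aboveSet_cell_eq_iInter hC hCU]
  exact MeasurableSet.iInter fun j => MeasurableSet.iInter fun a =>
    measurableSet_lt_infOn (hC a j) _

/-- Closed subsets of distinct cells are disjoint, so independence and the exponential law give the
product formula on them. Exhausting each cell by closed sets passes the formula to the limit. -/
theorem measure_aboveSet_of_nonneg (hU : IsFineBasis U m) (hlam : Integrable lam m)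
    (hν : IsExtremeLaw lam m ν) [IsProbabilityMeasure ν] {r : ℕ} (v : (Fin r → Prop) → ℝ)
    (hv : ∀ a, 0 ≤ v a) :
    ν.real (aboveSet fun y => v (cell U r y)) =
      Real.exp (-∑ a, v a * ∫ y in {y | cell U r y = a}, lam y ∂m) := by
  choose C hC hmono hCU using hU.exists_isClosed_exhaustion r
  have hsub : ∀ a j, C a j ⊆ {y | cell U r y = a} := fun a j =>
    (Set.subset_iUnion (C a) j).trans (hCU a).subset
  have hfin : ∀ j, ν.real (⋂ a, {f : LSCFun X | (v a : EReal) < infOn f.1 (C a j)}) =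
      Real.exp (-∑ a, v a * ∫ y in C a j, lam y ∂m) := by
    intro j
    let e := (Fintype.equivFin (Fin r → Prop))
    have hind := hν.indep _ (fun i => C (e.symm i) j) (fun i => hC _ _) (fun i i' hii => by
      refine Set.disjoint_left.2 fun y hy hy' => hii ?_
      exact e.symm.injective ((hsub _ _ hy).symm.trans (hsub _ _ hy')))
    have h1 := hind.measure_inter_preimage_eq_mul Finset.univ
      (sets := fun i => Set.Ioi (v (e.symm i) : EReal)) (fun i _ => measurableSet_Ioi)
    have h2 : (⋂ a, {f : LSCFun X | (v a : EReal) < infOn f.1 (C a j)}) =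
        ⋂ i ∈ Finset.univ, (fun f : LSCFun X => infOn f.1 (C (e.symm i) j)) ⁻¹'
          Set.Ioi (v (e.symm i) : EReal) := by
      simp only [Finset.mem_univ, Set.iInter_true]
      exact (e.symm.surjective.iInter_comp
        (fun a => {f : LSCFun X | (v a : EReal) < infOn f.1 (C a j)})).symm
    rw [measureReal_def, h2, h1, ENNReal.toReal_prod]
    have h3 : ∀ i, (ν ((fun f : LSCFun X => infOn f.1 (C (e.symm i) j)) ⁻¹'
          Set.Ioi (v (e.symm i) : EReal))).toReal =
        Real.exp (-(v (e.symm i) * ∫ y in C (e.symm i) j, lam y ∂m)) := by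
      intro i
      have := hν.exponential (C (e.symm i) j) (hC _ _) (v (e.symm i)) (hv _)
      rw [mul_comm] at this
      rw [← ENNReal.toReal_ofReal (Real.exp_pos _).le, ← this]
      rfl
    simp only [h3]
    rw [← Real.exp_sum, Finset.sum_neg_distrib]
    congr 2
    exact e.symm.sum_comp (fun a => v a * ∫ y in C a j, lam y ∂m)
  rw [aboveSet_cell_eq_iInter hC hCU]
  have hlim1 : Tendsto (fun j => ν.real (⋂ a, {f : LSCFun X | (v a : EReal) < infOn f.1 (C a j)}))
      atTop (𝓝 (ν.real (⋂ j, ⋂ a, {f : LSCFun X | (v a : EReal) < infOn f.1 (C a j)}))) := by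
    refine (ENNReal.tendsto_toReal (measure_ne_top _ _)).comp
      (tendsto_measure_iInter_atTop (fun j => ?_) (fun j j' hjj => ?_)
        ⟨0, measure_ne_top _ _⟩)
    · exact (MeasurableSet.iInter fun a => measurableSet_lt_infOn (hC a j) _).nullMeasurableSet
    · refine Set.iInter_mono fun a f hf => ?_
      exact lt_of_lt_of_le (show (v a : EReal) < infOn f.1 (C a j') from hf)
        (biInf_mono fun y hy => hmono a hjj hy)
  have hlim2 : Tendsto (fun j => Real.exp (-∑ a, v a * ∫ y in C a j, lam y ∂m)) atTop
      (𝓝 (Real.exp (-∑ a, v a * ∫ y in {y | cell U r y = a}, lam y ∂m))) := by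
    refine (Real.continuous_exp.tendsto _).comp (Tendsto.neg (tendsto_finsetSum _ fun a _ => ?_))
    refine Tendsto.const_mul _ ?_
    rw [← hCU a]
    exact tendsto_setIntegral_of_monotone (fun j => (hC a j).measurableSet) (hmono a)
      hlam.integrableOn
  simp only [hfin] at hlim1
  exact tendsto_nhds_unique hlim1 hlim2

end IsFineBasis

/-- The exponential law over the whole space at `t = 0` has probability `exp 0 = 1`. -/
theorem IsExtremeLaw.ae_pos (hν : IsExtremeLaw lam m ν) [IsProbabilityMeasure ν] :
    ∀ᵐ f ∂ν, ∀ y, 0 < f.1 y := by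
  have h := hν.exponential Set.univ isClosed_univ 0 le_rfl
  rw [mul_zero, neg_zero, Real.exp_zero, ENNReal.ofReal_one,
    ← mem_ae_iff_prob_eq_one (measurableSet_lt_infOn isClosed_univ 0)] at h
  filter_upwards [h] with f hf y
  exact (lt_infOn_iff f.2.1 isClosed_univ 0).1 hf y (Set.mem_univ y)

theorem abs_voidExponent_sub_le (hU : IsFineBasis U m) (hlam : CellUniform U lam)
    (hlam0 : ∀ y, 0 ≤ lam y) {t u : X → ℝ} (ht : CellUniform U t) (hu : CellUniform U u)
    {ε : ℝ} (h : ∀ y, |t y - u y| ≤ ε) :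
    |voidExponent lam m t - voidExponent lam m u| ≤ ε * ∫ y, lam y ∂m := by
  rw [voidExponent, voidExponent, ← integral_sub
    (hU.integrable_of_cellUniform (hlam.mul ht.max_zero))
    (hU.integrable_of_cellUniform (hlam.mul hu.max_zero)), ← integral_const_mul]
  refine (abs_integral_le_integral_abs).trans (integral_mono_of_nonneg
    (Eventually.of_forall fun _ => abs_nonneg _)
    ((hU.integrable_of_cellUniform hlam).const_mul ε) (Eventually.of_forall fun y => ?_))
  simp only
  rw [← mul_sub, abs_mul, abs_of_nonneg (hlam0 y), mul_comm]
  exact mul_le_mul_of_nonneg_right ((abs_max_sub_max_le_abs _ _ _).trans (h y)) (hlam0 y)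

theorem voidExponent_nonneg (hlam0 : ∀ y, 0 ≤ lam y) (t : X → ℝ) : 0 ≤ voidExponent lam m t :=
  integral_nonneg fun y => mul_nonneg (hlam0 y) (le_max_right _ _)

/-- Since the process is almost surely positive, negative thresholds impose nothing and may be
replaced by their positive parts. -/
theorem IsExtremeLaw.measure_aboveSet_cell (hν : IsExtremeLaw lam m ν) [IsProbabilityMeasure ν]
    (hU : IsFineBasis U m) (hlam : CellUniform U lam) {r : ℕ} (v : (Fin r → Prop) → ℝ) :
    ν.real (aboveSet fun y => v (cell U r y)) =
      Real.exp (-voidExponent lam m fun y => v (cell U r y)) := by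
  have h1 : aboveSet (fun y => v (cell U r y)) =ᵐ[ν]
      aboveSet (fun y => (fun a => max (v a) 0) (cell U r y)) := by
    filter_upwards [hν.ae_pos] with f hf
    refine propext ⟨fun h y => ?_, fun h => aboveSet_anti (fun y => le_max_left _ _) h⟩
    rcases max_choice (v (cell U r y)) 0 with h' | h'
    · simpa only [h'] using h y
    · simpa only [h', EReal.coe_zero] using hf y
  have hint := hU.integrable_of_cellUniform hlam
  rw [measureReal_congr h1, hU.measure_aboveSet_of_nonneg hint hν _ fun a => le_max_right _ _,
    voidExponent, hU.integral_comp_cell (fun a => max (v a) 0) hint]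

/-- The void probabilities of an extreme value process below the threshold `t`. -/
theorem IsExtremeLaw.measure_aboveSet (hν : IsExtremeLaw lam m ν) [IsProbabilityMeasure ν]
    (hU : IsFineBasis U m) (hlam : CellUniform U lam) (hlam0 : ∀ y, 0 ≤ lam y) {t : X → ℝ}
    (ht : CellUniform U t) :
    NullMeasurableSet (aboveSet t) ν ∧
      ν.real (aboveSet t) = Real.exp (-voidExponent lam m t) := by
  have hK : 0 ≤ ∫ y, lam y ∂m := integral_nonneg hlam0
  have key : ∀ ε > 0, ∃ A B, MeasurableSet A ∧ MeasurableSet B ∧ A ⊆ aboveSet t ∧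
      aboveSet t ⊆ B ∧ |ν.real A - Real.exp (-voidExponent lam m t)| ≤ ε ∧
      |ν.real B - Real.exp (-voidExponent lam m t)| ≤ ε := by
    intro ε hε
    -- The threshold error is at most `2δ`: one `δ` from the step approximation and one from the
    -- shift by `±δ`. The added `1` keeps the denominator positive.
    set δ := ε / (2 * ((∫ y, lam y ∂m) + 1)) with hδdef
    have hδ : 0 < δ := by positivity
    obtain ⟨r, v, hv⟩ := ht.exists_approx hδ
    have hbound : ∀ c : ℝ, |c| ≤ δ →
        |ν.real (aboveSet fun y => (fun a => v a + c) (cell U r y)) -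
          Real.exp (-voidExponent lam m t)| ≤ ε := by
      intro c hc
      rw [hν.measure_aboveSet_cell hU hlam (fun a => v a + c)]
      refine (abs_exp_neg_sub_exp_neg_le (voidExponent_nonneg hlam0 _)
        (voidExponent_nonneg hlam0 _)).trans ((abs_voidExponent_sub_le hU hlam hlam0
          (cellUniform_comp_cell U fun a => v a + c) ht (ε := 2 * δ) fun y => ?_).trans ?_)
      · have h1 := abs_lt.1 (hv y)
        have h2 := abs_le.1 hc
        rw [abs_le]; constructor <;> linarith
      · rw [hδdef]
        calc 2 * (ε / (2 * ((∫ y, lam y ∂m) + 1))) * ∫ y, lam y ∂m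
            = ε * ((∫ y, lam y ∂m) / ((∫ y, lam y ∂m) + 1)) := by
              field_simp
          _ ≤ ε * 1 := by
              gcongr
              rw [div_le_one (by positivity)]; linarith
          _ = ε := mul_one _
    -- Raising the step function by `δ` puts it above `t` and gives the inner set; lowering it by
    -- `δ` gives the outer set.
    refine ⟨_, _, hU.measurableSet_aboveSet (fun a => v a + δ),
      hU.measurableSet_aboveSet (fun a => v a + -δ), aboveSet_anti fun y => ?_,
      aboveSet_anti fun y => ?_, hbound δ (abs_of_pos hδ).le,
      hbound (-δ) (by rw [abs_neg, abs_of_pos hδ])⟩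
    · linarith [(abs_lt.1 (hv y)).2]
    · linarith [(abs_lt.1 (hv y)).1]
  refine ⟨nullMeasurableSet_of_sandwich fun ε hε => ?_, ?_⟩
  · obtain ⟨A, B, hA, hB, hAt, htB, h1, h2⟩ := key (ε / 2) (half_pos hε)
    refine ⟨A, B, hA, hB, hAt, htB, ?_⟩
    linarith [(abs_le.1 h1).1, (abs_le.1 h2).2]
  · refine eq_of_abs_sub_le_all fun ε hε => ?_
    obtain ⟨A, B, hA, hB, hAt, htB, h1, h2⟩ := key ε hε
    have h3 : ν.real A ≤ ν.real (aboveSet t) := measureReal_mono hAt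
    have h4 : ν.real (aboveSet t) ≤ ν.real B := measureReal_mono htB
    rw [abs_le]
    constructor <;> linarith [(abs_le.1 h1).1, (abs_le.1 h2).2]

end ExtremeLaw

/-- Each factor satisfies `exp(-p/(1-p)) ≤ 1 - p ≤ exp(-p)`. The bound `p ≤ K/n` makes the
denominators tend to one uniformly, so both products have the same limit. -/
theorem tendsto_prod_one_sub {p : ℕ → ℕ → ℝ} {K c : ℝ} (hp0 : ∀ n i, 0 ≤ p n i)
    (hpK : ∀ᶠ n : ℕ in atTop, ∀ i < n, p n i ≤ K / n)
    (hc : Tendsto (fun n => ∑ i ∈ Finset.range n, p n i) atTop (𝓝 c)) :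
    Tendsto (fun n => ∏ i ∈ Finset.range n, (1 - p n i)) atTop (𝓝 (Real.exp (-c))) := by
  have hK : Tendsto (fun n : ℕ => 1 - K / (n : ℝ)) atTop (𝓝 1) := by
    simpa using (tendsto_const_div_atTop_nhds_zero_nat K).const_sub 1
  have hlow : Tendsto (fun n : ℕ => Real.exp (-((∑ i ∈ Finset.range n, p n i) / (1 - K / n))))
      atTop (𝓝 (Real.exp (-c))) := by
    have := (hc.div hK one_ne_zero).neg
    rw [div_one] at this
    exact (Real.continuous_exp.tendsto _).comp this
  have hup : Tendsto (fun n : ℕ => Real.exp (-(∑ i ∈ Finset.range n, p n i)))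
      atTop (𝓝 (Real.exp (-c))) := (Real.continuous_exp.tendsto _).comp hc.neg
  have hpos : ∀ᶠ n : ℕ in atTop, 0 < 1 - K / (n : ℝ) := hK.eventually (lt_mem_nhds one_pos)
  refine tendsto_of_tendsto_of_tendsto_of_le_of_le' hlow hup ?_ ?_
  · filter_upwards [hpK, hpos] with n hn hn0
    rw [Finset.sum_div, ← Finset.sum_neg_distrib, Real.exp_sum]
    refine Finset.prod_le_prod (fun i _ => (Real.exp_pos _).le) fun i hi => ?_
    have h1 := hn i (Finset.mem_range.1 hi)
    have h2 : 0 < 1 - p n i := by linarith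
    have h3 : p n i / (1 - p n i) ≤ p n i / (1 - K / n) := by
      gcongr
      exact hp0 n i
    refine (Real.exp_le_exp.2 (neg_le_neg h3)).trans ?_
    rw [Real.exp_neg, inv_le_comm₀ (Real.exp_pos _) h2]
    have h4 := Real.add_one_le_exp (p n i / (1 - p n i))
    have h5 : (1 - p n i)⁻¹ = p n i / (1 - p n i) + 1 := by field_simp; ring
    rw [h5]; exact h4
  · filter_upwards [hpK, hpos] with n hn hn0
    rw [← Finset.sum_neg_distrib, Real.exp_sum]
    refine Finset.prod_le_prod (fun i hi => ?_) fun i _ => ?_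
    · have h1 := hn i (Finset.mem_range.1 hi)
      linarith
    · have := Real.add_one_le_exp (-p n i)
      linarith

/-! ### Functions supported on finitely many points -/

section PointFun

variable {X : Type*}

/-- The function with value `v i` at the point `x i`, `i < n`, and `+∞` elsewhere. -/
noncomputable def pointFun (x : ℕ → X) (n : ℕ) (v : ℕ → ℝ) : X → EReal :=
  fun y => ⨅ (i : ℕ) (_ : i < n ∧ x i = y), (v i : EReal)

theorem pointFun_apply {x : ℕ → X} (hx : Function.Injective x) {n i : ℕ} (hi : i < n)
    (v : ℕ → ℝ) : pointFun x n v (x i) = v i :=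
  le_antisymm (iInf₂_le i ⟨hi, rfl⟩) (le_iInf₂ fun j hj => by rw [hx hj.2])

theorem pointFun_eq_top {x : ℕ → X} {n : ℕ} (v : ℕ → ℝ) {y : X} (hy : ∀ i < n, x i ≠ y) :
    pointFun x n v y = ⊤ := by
  simp only [pointFun, iInf_eq_top]
  exact fun i hi => absurd hi.2 (hy i hi.1)

theorem lt_pointFun_iff {x : ℕ → X} (hx : Function.Injective x) {n : ℕ} {v : ℕ → ℝ}
    {t : X → ℝ} : (∀ y, (t y : EReal) < pointFun x n v y) ↔ ∀ i < n, t (x i) < v i := by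
  constructor
  · intro h i hi
    have := h (x i)
    rwa [pointFun_apply hx hi, EReal.coe_lt_coe_iff] at this
  · intro h y
    by_cases hy : ∃ i < n, x i = y
    · obtain ⟨i, hi, rfl⟩ := hy
      rw [pointFun_apply hx hi, EReal.coe_lt_coe_iff]
      exact h i hi
    · push Not at hy
      rw [pointFun_eq_top v hy]
      exact EReal.coe_lt_top _

theorem pointFun_le_iff {x : ℕ → X} (hx : Function.Injective x) {n : ℕ} {v : ℕ → ℝ}
    {T : ℝ} {y : X} : pointFun x n v y ≤ T ↔ ∃ i < n, x i = y ∧ v i ≤ T := by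
  constructor
  · intro h
    by_contra! hcon
    by_cases hy : ∃ i < n, x i = y
    · obtain ⟨i, hi, rfl⟩ := hy
      rw [pointFun_apply hx hi, EReal.coe_le_coe_iff] at h
      exact (hcon i hi rfl).not_ge h
    · push Not at hy
      rw [pointFun_eq_top v hy] at h
      exact (EReal.coe_lt_top T).not_ge h
  · rintro ⟨i, hi, rfl, h⟩
    rw [pointFun_apply hx hi, EReal.coe_le_coe_iff]
    exact h

/-- The value of the response function at the point `x i`. -/
noncomputable def responseVal (lam g : X → ℝ) (x : ℕ → X) (n : ℕ) (ξ : ℕ → ℝ) (i : ℕ) : ℝ :=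
  n / lam (x i) * ξ i + g (x i)

end PointFun

/-- Independent non-negative variables with distribution functions `t + O(t ^ 2)`, uniformly. -/
structure IsUnitRateNoise {Ω : Type*} [MeasurableSpace Ω] (P : Measure Ω) (ξ : ℕ → Ω → ℝ) :
    Prop where
  meas : ∀ i, Measurable (ξ i)
  nonneg : ∀ i, ∀ᵐ ω ∂P, 0 ≤ ξ i ω
  indep : iIndepFun ξ P
  cdf : ∃ A δ : ℝ, 0 < δ ∧ ∀ i, ∀ t : ℝ, 0 ≤ t → t ≤ δ →
    |P.real {ω | ξ i ω ≤ t} - t| ≤ A * t ^ 2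

/-- Distinct points whose empirical measures converge weakly to `m`. -/
structure IsEquidistributed {X : Type*} [TopologicalSpace X] [MeasurableSpace X] (x : ℕ → X)
    (m : Measure X) : Prop where
  inj : Function.Injective x
  conv : ∀ φ : X → ℝ, Continuous φ →
    Tendsto (fun n : ℕ => (1 / (n : ℝ)) * ∑ i ∈ Finset.range n, φ (x i)) atTop
      (𝓝 (∫ y, φ y ∂m))

/-! ### Equidistribution tested on cells -/

section Equidistribution

variable {X : Type*} [MetricSpace X] [CompactSpace X] [MeasurableSpace X] [BorelSpace X]
  {U : ℕ → Set X} {m : Measure X} [IsProbabilityMeasure m] {x : ℕ → X}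

/-- This is the portmanteau theorem for sets with null frontier, applied to the empirical measures.
-/
theorem IsEquidistributed.tendsto_frequency (hx : IsEquidistributed x m) {A : Set X}
    (hA : MeasurableSet A) (hAm : m (frontier A) = 0) :
    Tendsto (fun n : ℕ => (1 / (n : ℝ)) * ∑ i ∈ Finset.range n, A.indicator (fun _ => (1 : ℝ)) (x i))
      atTop (𝓝 (m.real A)) := by
  -- The index is shifted because the empirical measure of zero points is not a probability measure.
  rw [← tendsto_add_atTop_iff_nat 1]
  have hprob : ∀ n : ℕ, IsProbabilityMeasure
      (((n + 1 : ℕ) : ENNReal)⁻¹ • ∑ i ∈ Finset.range (n + 1), Measure.dirac (x i)) := fun n => ⟨by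
    simp only [Measure.smul_apply, Measure.finsetSum_apply, measure_univ, smul_eq_mul,
      Finset.sum_const, Finset.card_range, nsmul_eq_mul, mul_one]
    exact ENNReal.inv_mul_cancel (by simp) (ENNReal.natCast_ne_top _)⟩
  obtain ⟨emp, hemp⟩ : ∃ emp : ℕ → ProbabilityMeasure X, ∀ n, (emp n : Measure X) =
      ((n + 1 : ℕ) : ENNReal)⁻¹ • ∑ i ∈ Finset.range (n + 1), Measure.dirac (x i) :=
    ⟨fun n => ⟨_, hprob n⟩, fun n => rfl⟩
  obtain ⟨mp, hmp⟩ : ∃ mp : ProbabilityMeasure X, (mp : Measure X) = m := ⟨⟨m, inferInstance⟩, rfl⟩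
  have hconv : Tendsto emp atTop (𝓝 mp) := by
    rw [ProbabilityMeasure.tendsto_iff_forall_integral_tendsto]
    intro φ
    have h1 := (tendsto_add_atTop_iff_nat 1).2 (hx.conv φ φ.continuous)
    rw [hmp]
    refine h1.congr fun n => ?_
    rw [hemp, integral_smul_measure, integral_finsetSum_measure]
    · simp only [integral_dirac, ENNReal.toReal_inv, ENNReal.toReal_natCast, smul_eq_mul, one_div]
    · exact fun i _ => φ.integrable _
  have h2 := ProbabilityMeasure.tendsto_measure_of_null_frontier_of_tendsto' hconv (E := A)
    (by rw [hmp]; exact hAm)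
  rw [hmp] at h2
  refine ((ENNReal.tendsto_toReal (measure_ne_top _ _)).comp h2).congr fun n => ?_
  simp only [Function.comp, hemp, Measure.smul_apply,
    Measure.finsetSum_apply, smul_eq_mul, ENNReal.toReal_mul, ENNReal.toReal_inv]
  rw [ENNReal.toReal_sum (fun i _ => measure_ne_top _ _)]
  simp only [one_div]
  congr 1
  refine Finset.sum_congr rfl fun i _ => ?_
  rw [Measure.dirac_apply' _ hA]
  by_cases h : x i ∈ A <;> simp [h]

/-- Step thresholds are not continuous, so weak convergence does not apply directly. Frequencies of
cells give the result for step functions, and uniform approximation gives the rest. -/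
theorem IsEquidistributed.tendsto_mean (hx : IsEquidistributed x m) (hU : IsFineBasis U m)
    {u : X → ℝ} (hu : CellUniform U u) :
    Tendsto (fun n : ℕ => (1 / (n : ℝ)) * ∑ i ∈ Finset.range n, u (x i)) atTop
      (𝓝 (∫ y, u y ∂m)) := by
  have hstep : ∀ (r : ℕ) (v : (Fin r → Prop) → ℝ), Tendsto (fun n : ℕ => (1 / (n : ℝ)) *
      ∑ i ∈ Finset.range n, v (cell U r (x i))) atTop (𝓝 (∫ y, v (cell U r y) ∂m)) := by
    intro r v
    have h1 : ∫ y, v (cell U r y) ∂m = ∑ a, v a * m.real {y | cell U r y = a} := by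
      have := hU.integral_comp_cell v (w := fun _ => (1 : ℝ)) (integrable_const _)
      simpa using this
    rw [h1]
    have h2 : Tendsto (fun n : ℕ => ∑ a, v a * ((1 / (n : ℝ)) *
        ∑ i ∈ Finset.range n, {y | cell U r y = a}.indicator (fun _ => (1 : ℝ)) (x i))) atTop
        (𝓝 (∑ a, v a * m.real {y | cell U r y = a})) :=
      tendsto_finsetSum _ fun a _ => (hx.tendsto_frequency (hU.measurableSet_cell r a)
        (hU.null_frontier_cell r a)).const_mul _
    refine h2.congr fun n => ?_
    simp only [Finset.mul_sum]
    rw [Finset.sum_comm]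
    refine Finset.sum_congr rfl fun i _ => ?_
    rw [Finset.sum_eq_single (cell U r (x i))]
    · rw [Set.indicator_of_mem (by rfl)]; ring
    · intro b _ hb
      rw [Set.indicator_of_notMem (fun h => hb h.symm)]; ring
    · simp
  rw [Metric.tendsto_nhds]
  intro ε hε
  obtain ⟨r, v, hv⟩ := hu.exists_approx (show 0 < ε / 4 by positivity)
  filter_upwards [Metric.tendsto_nhds.1 (hstep r v) (ε / 4) (by positivity),
    eventually_gt_atTop 0] with n hn hn0
  rw [Real.dist_eq] at hn ⊢
  have hnpos : (0 : ℝ) < n := Nat.cast_pos.2 hn0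
  have h1 : |(1 / (n : ℝ)) * ∑ i ∈ Finset.range n, u (x i) -
      (1 / (n : ℝ)) * ∑ i ∈ Finset.range n, v (cell U r (x i))| ≤ ε / 4 := by
    rw [← mul_sub, ← Finset.sum_sub_distrib, abs_mul, abs_of_pos (by positivity)]
    have : |∑ i ∈ Finset.range n, (u (x i) - v (cell U r (x i)))| ≤ n * (ε / 4) := by
      refine (Finset.abs_sum_le_sum_abs _ _).trans ?_
      refine (Finset.sum_le_sum fun i _ => (hv (x i)).le).trans ?_
      simp
    calc 1 / (n : ℝ) * |∑ i ∈ Finset.range n, (u (x i) - v (cell U r (x i)))|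
        ≤ 1 / (n : ℝ) * (n * (ε / 4)) := by gcongr
      _ = ε / 4 := by field_simp
  have h2 : |∫ y, v (cell U r y) ∂m - ∫ y, u y ∂m| ≤ ε / 4 := by
    have hi := hU.integrable_of_cellUniform (cellUniform_comp_cell U v)
    rw [← integral_sub hi (hU.integrable_of_cellUniform hu)]
    have := norm_integral_le_of_norm_le_const (μ := m) (C := ε / 4)
      (f := fun y => v (cell U r y) - u y) (Eventually.of_forall fun y => by
        rw [Real.norm_eq_abs, abs_sub_comm]; exact (hv y).le)
    simpa using this
  have := abs_sub_le ((1 / (n : ℝ)) * ∑ i ∈ Finset.range n, u (x i))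
    ((1 / (n : ℝ)) * ∑ i ∈ Finset.range n, v (cell U r (x i))) (∫ y, u y ∂m)
  have h3 := abs_sub_le ((1 / (n : ℝ)) * ∑ i ∈ Finset.range n, v (cell U r (x i)))
    (∫ y, v (cell U r y) ∂m) (∫ y, u y ∂m)
  linarith

end Equidistribution

/-! ### Void probabilities and close pairs for the response functions -/

section Noise

variable {Ω : Type*} [MeasurableSpace Ω] {P : Measure Ω} [IsProbabilityMeasure P]
  {ξ : ℕ → Ω → ℝ}

/-- The quadratic bound at zero forces the distribution functions to vanish there. -/
theorem IsUnitRateNoise.cdf_of_nonpos (hξ : IsUnitRateNoise P ξ) (i : ℕ) {t : ℝ} (ht : t ≤ 0) :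
    P.real {ω | ξ i ω ≤ t} = 0 := by
  obtain ⟨A, δ, hδ, h⟩ := hξ.cdf
  have h0 := h i 0 le_rfl hδ.le
  simp only [sub_zero, ne_eq, OfNat.ofNat_ne_zero, not_false_eq_true, zero_pow, mul_zero,
    abs_nonpos_iff] at h0
  exact le_antisymm (h0 ▸ measureReal_mono fun ω (hω : ξ i ω ≤ t) => hω.trans ht)
    measureReal_nonneg

/-- The distribution functions near zero, with a linear upper bound. -/
theorem IsUnitRateNoise.exists_cdf_bounds (hξ : IsUnitRateNoise P ξ) :
    ∃ A δ : ℝ, 0 ≤ A ∧ 0 < δ ∧ ∀ i, ∀ t : ℝ, t ≤ δ →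
      |P.real {ω | ξ i ω ≤ t} - max t 0| ≤ A * t ^ 2 ∧
      P.real {ω | ξ i ω ≤ t} ≤ (1 + A) * max t 0 := by
  obtain ⟨A, δ, hδ, h⟩ := hξ.cdf
  -- The cap at `1` gives `t² ≤ t`, which turns the quadratic error into a linear one.
  refine ⟨|A|, min δ 1, abs_nonneg A, lt_min hδ one_pos, fun i t ht => ?_⟩
  rcases le_total t 0 with h0 | h0
  · rw [hξ.cdf_of_nonpos i h0, max_eq_right h0]
    simp only [sub_zero, abs_zero, mul_zero, le_refl, and_true]
    positivity
  · rw [max_eq_left h0]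
    have h1 := h i t h0 (ht.trans (min_le_left _ _))
    have h2 : |P.real {ω | ξ i ω ≤ t} - t| ≤ |A| * t ^ 2 :=
      h1.trans (mul_le_mul_of_nonneg_right (le_abs_self A) (sq_nonneg t))
    refine ⟨h2, ?_⟩
    have h3 := (abs_le.1 h2).2
    have h4 : t ≤ 1 := ht.trans (min_le_right _ _)
    have h5 : |A| * t ^ 2 ≤ |A| * t := by
      have := abs_nonneg A
      gcongr
      nlinarith
    linarith

variable {X : Type*} {x : ℕ → X} {lam g : X → ℝ}

/-- The random response function. -/
noncomputable def responseField (lam g : X → ℝ) (x : ℕ → X) (ξ : ℕ → Ω → ℝ) (n : ℕ) (ω : Ω) :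
    X → EReal :=
  pointFun x n (responseVal lam g x n fun i => ξ i ω)

theorem responseVal_le_iff (hlam : ∀ y, 0 < lam y) {n : ℕ} (hn : 0 < n) (z : ℕ → ℝ) (i : ℕ)
    (t : ℝ) :
    responseVal lam g x n z i ≤ t ↔ z i ≤ lam (x i) * (t - g (x i)) / n := by
  have hnpos : (0 : ℝ) < n := Nat.cast_pos.2 hn
  rw [responseVal, ← le_sub_iff_add_le, le_div_iff₀ hnpos, div_mul_eq_mul_div,
    div_le_iff₀ (hlam _), mul_comm (n : ℝ), mul_comm (lam _)]

theorem IsUnitRateNoise.measurable_responseVal (hξ : IsUnitRateNoise P ξ) (n i : ℕ) :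
    Measurable fun ω => responseVal lam g x n (fun i => ξ i ω) i :=
  ((hξ.meas i).const_mul _).add_const _

theorem IsUnitRateNoise.measurableSet_lt_responseField (hξ : IsUnitRateNoise P ξ)
    (hx : Function.Injective x) (n : ℕ) (t : X → ℝ) :
    MeasurableSet {ω | ∀ y, (t y : EReal) < responseField lam g x ξ n ω y} := by
  simp only [responseField, lt_pointFun_iff hx]
  have : {ω | ∀ i < n, t (x i) < responseVal lam g x n (fun i => ξ i ω) i} =
      ⋂ i, ⋂ (_ : i < n), {ω | t (x i) < responseVal lam g x n (fun i => ξ i ω) i} := by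
    ext ω; simp
  rw [this]
  exact MeasurableSet.iInter fun i => MeasurableSet.iInter fun _ =>
    measurableSet_lt measurable_const (hξ.measurable_responseVal n i)

theorem IsUnitRateNoise.measure_lt_responseField (hξ : IsUnitRateNoise P ξ)
    (hx : Function.Injective x) (hlam : ∀ y, 0 < lam y) {n : ℕ} (hn : 0 < n) (t : X → ℝ) :
    P.real {ω | ∀ y, (t y : EReal) < responseField lam g x ξ n ω y} =
      ∏ i ∈ Finset.range n,
        (1 - P.real {ω | ξ i ω ≤ lam (x i) * (t (x i) - g (x i)) / n}) := by
  have h1 : {ω | ∀ y, (t y : EReal) < responseField lam g x ξ n ω y} =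
      ⋂ i ∈ Finset.range n, ξ i ⁻¹' Set.Ioi (lam (x i) * (t (x i) - g (x i)) / n) := by
    ext ω
    simp only [responseField, lt_pointFun_iff hx, Set.mem_iInter, Finset.mem_range,
      Set.mem_ofPred_eq, Set.mem_preimage, Set.mem_Ioi]
    refine forall₂_congr fun i _ => ?_
    rw [← not_le, responseVal_le_iff hlam hn, not_le]
  rw [h1, measureReal_def, hξ.indep.measure_inter_preimage_eq_mul _
    fun i _ => measurableSet_Ioi, ENNReal.toReal_prod]
  refine Finset.prod_congr rfl fun i _ => ?_
  have h2 : ξ i ⁻¹' Set.Ioi (lam (x i) * (t (x i) - g (x i)) / n) =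
      {ω | ξ i ω ≤ lam (x i) * (t (x i) - g (x i)) / n}ᶜ := by
    ext ω; simp
  rw [← measureReal_def, h2, probReal_compl_eq_one_sub]
  exact measurableSet_le (hξ.meas i) measurable_const

variable [MetricSpace X] [CompactSpace X] [MeasurableSpace X] [BorelSpace X]
  {U : ℕ → Set X} {m : Measure X} [IsProbabilityMeasure m]

/-- The void probabilities of the response functions converge. -/
theorem IsUnitRateNoise.tendsto_measure_lt_responseField (hξ : IsUnitRateNoise P ξ)
    (hx : IsEquidistributed x m) (hU : IsFineBasis U m) (hlam : Continuous lam)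
    (hlam0 : ∀ y, 0 < lam y) (hg : Continuous g) {t : X → ℝ} (ht : CellUniform U t) :
    Tendsto (fun n => P.real {ω | ∀ y, (t y : EReal) < responseField lam g x ξ n ω y}) atTop
      (𝓝 (Real.exp (-voidExponent lam m fun y => t y - g y))) := by
  obtain ⟨A, δ, hA, hδ, hcdf⟩ := hξ.exists_cdf_bounds
  have hlamU := hU.cellUniform_of_continuous hlam
  have hu : CellUniform U fun y => lam y * (t y - g y) :=
    hlamU.mul (ht.sub (hU.cellUniform_of_continuous hg))
  have hu' : CellUniform U fun y => lam y * max (t y - g y) 0 :=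
    hlamU.mul (ht.sub (hU.cellUniform_of_continuous hg)).max_zero
  obtain ⟨B, hB0, hB⟩ := hu.exists_bound
  have hmax : ∀ (n : ℕ) (y : X), max (lam y * (t y - g y) / n) 0 =
      (1 / n) * (lam y * max (t y - g y) 0) := by
    intro n y
    have h1 : lam y * max (t y - g y) 0 = max (lam y * (t y - g y)) 0 := by
      rw [mul_max_of_nonneg _ _ (hlam0 y).le, mul_zero]
    rw [h1, mul_max_of_nonneg _ _ (by positivity), mul_zero]
    congr 1; ring
  have hsmall : ∀ᶠ n : ℕ in atTop, 0 < n ∧ B / n ≤ δ :=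
    (eventually_gt_atTop 0).and
      ((tendsto_const_div_atTop_nhds_zero_nat B).eventually (ge_mem_nhds hδ))
  have hle : ∀ (n : ℕ) (y : X), |lam y * (t y - g y) / n| ≤ B / n := by
    intro n y
    rw [abs_div, Nat.abs_cast]
    exact div_le_div_of_nonneg_right (hB y) (Nat.cast_nonneg n)
  have hsum : Tendsto (fun n : ℕ => ∑ i ∈ Finset.range n,
      P.real {ω | ξ i ω ≤ lam (x i) * (t (x i) - g (x i)) / n}) atTop
      (𝓝 (voidExponent lam m fun y => t y - g y)) := by
    have h1 := hx.tendsto_mean hU hu'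
    have h2 : Tendsto (fun n : ℕ => ∑ i ∈ Finset.range n,
        P.real {ω | ξ i ω ≤ lam (x i) * (t (x i) - g (x i)) / n} - (1 / (n : ℝ)) *
          ∑ i ∈ Finset.range n, lam (x i) * max (t (x i) - g (x i)) 0) atTop (𝓝 0) := by
      -- There are `n` terms, each with error at most `A (B/n)²`.
      refine squeeze_zero_norm' (a := fun n : ℕ => A * B ^ 2 / n) ?_
        (tendsto_const_div_atTop_nhds_zero_nat _)
      filter_upwards [hsmall] with n hn
      have hnpos : (0 : ℝ) < n := Nat.cast_pos.2 hn.1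
      rw [Finset.mul_sum, ← Finset.sum_sub_distrib, Real.norm_eq_abs]
      have h3 : ∀ i ∈ Finset.range n,
          |P.real {ω | ξ i ω ≤ lam (x i) * (t (x i) - g (x i)) / n} -
            1 / (n : ℝ) * (lam (x i) * max (t (x i) - g (x i)) 0)| ≤ A * (B / n) ^ 2 := by
        intro i _
        rw [← hmax]
        refine (hcdf i _ ((le_abs_self _).trans ((hle n (x i)).trans hn.2))).1.trans ?_
        exact mul_le_mul_of_nonneg_left (sq_le_sq' (abs_le.1 (hle n (x i))).1
          (abs_le.1 (hle n (x i))).2) hA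
      calc _ ≤ _ := Finset.abs_sum_le_sum_abs _ _
        _ ≤ ∑ i ∈ Finset.range n, A * (B / n) ^ 2 := Finset.sum_le_sum h3
        _ = A * B ^ 2 / n := by
          rw [Finset.sum_const, Finset.card_range, nsmul_eq_mul]; field_simp
    have := h2.add h1
    simpa [voidExponent] using this
  refine (tendsto_prod_one_sub (K := (1 + A) * B) (fun n i => measureReal_nonneg) ?_ hsum).congr' ?_
  · filter_upwards [hsmall] with n hn i _
    refine (hcdf i _ ((le_abs_self _).trans ((hle n (x i)).trans hn.2))).2.trans ?_
    rw [mul_div_assoc (1 + A)]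
    exact mul_le_mul_of_nonneg_left (max_le ((le_abs_self _).trans (hle n (x i)))
      (by positivity)) (by positivity)
  · filter_upwards [hsmall] with n hn
    exact (hξ.measure_lt_responseField hx.inj hlam0 hn.1 t).symm

/-- Two distinct points with values at most `T` lie in the same cell. -/
def HasClosePair (U : ℕ → Set X) (r : ℕ) (T : ℝ) (F : X → EReal) : Prop :=
  ∃ y z, y ≠ z ∧ F y ≤ T ∧ F z ≤ T ∧ cell U r y = cell U r z

/-- A union bound over pairs of indices with points in one cell: asymptotically there are at most
`n²` times the collision probability of them, and each pair is low with probability at most `((1 +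
A)B/n)²`. The constant `K` does not depend on `r`, which allows `r` to be chosen after it. -/
theorem IsUnitRateNoise.eventually_measure_hasClosePair_le (hξ : IsUnitRateNoise P ξ)
    (hx : IsEquidistributed x m) (hU : IsFineBasis U m) (hlam : Continuous lam)
    (hlam0 : ∀ y, 0 < lam y) (hg : Continuous g) (T : ℝ) :
    ∃ K, 0 ≤ K ∧ ∀ r, ∀ ε > 0, ∀ᶠ n in atTop,
      P.real {ω | HasClosePair U r T (responseField lam g x ξ n ω)} ≤
        K * cellCollision U m r + ε := by
  classical
  obtain ⟨A, δ, hA, hδ, hcdf⟩ := hξ.exists_cdf_bounds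
  have hu : CellUniform U fun y => lam y * (T - g y) :=
    hU.cellUniform_of_continuous (hlam.mul (continuous_const.sub hg))
  obtain ⟨B, hB0, hB⟩ := hu.exists_bound
  refine ⟨((1 + A) * B) ^ 2, by positivity, fun r ε hε => ?_⟩
  have hsmall : ∀ᶠ n : ℕ in atTop, 0 < n ∧ B / n ≤ δ :=
    (eventually_gt_atTop 0).and
      ((tendsto_const_div_atTop_nhds_zero_nat B).eventually (ge_mem_nhds hδ))
  have hfreq : Tendsto (fun n : ℕ => ((1 + A) * B) ^ 2 * ∑ a : Fin r → Prop, ((1 / (n : ℝ)) *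
      ∑ i ∈ Finset.range n, {y | cell U r y = a}.indicator (fun _ => (1 : ℝ)) (x i)) ^ 2) atTop
      (𝓝 (((1 + A) * B) ^ 2 * ∑ a, m.real {y | cell U r y = a} ^ 2)) :=
    (tendsto_finsetSum _ fun a _ => (hx.tendsto_frequency (hU.measurableSet_cell r a)
      (hU.null_frontier_cell r a)).pow 2).const_mul _
  have hlim : ∑ a, m.real {y | cell U r y = a} ^ 2 ≤ cellCollision U m r := by
    have h := hU.sum_mul_le_cellCollision (r := r) (r' := r)
      (Finset.univ.image fun a : Fin r → Prop => (a, a)) (by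
        intro p hp y z hy hz
        obtain ⟨a, -, rfl⟩ := Finset.mem_image.1 hp
        exact hy.trans hz.symm)
    rw [Finset.sum_image (fun a _ b _ h => (Prod.mk.inj h).1)] at h
    simpa only [sq] using h
  filter_upwards [hsmall, hfreq.eventually_le_const
    (lt_add_of_pos_right (((1 + A) * B) ^ 2 * ∑ a, m.real {y | cell U r y = a} ^ 2) hε)]
    with n hn hnf
  refine le_trans ?_ (hnf.trans (by gcongr))
  have hnpos : (0 : ℝ) < n := Nat.cast_pos.2 hn.1
  set S : Finset (ℕ × ℕ) := (Finset.range n ×ˢ Finset.range n).filter fun p =>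
    p.1 ≠ p.2 ∧ cell U r (x p.1) = cell U r (x p.2) with hS
  let E : ℕ → Set Ω := fun i => ξ i ⁻¹' Set.Iic (lam (x i) * (T - g (x i)) / n)
  have hsub : {ω | HasClosePair U r T (responseField lam g x ξ n ω)} ⊆
      ⋃ p ∈ S, E p.1 ∩ E p.2 := by
    rintro ω ⟨y, z, hyz, hy, hz, hc⟩
    rw [responseField, pointFun_le_iff hx.inj] at hy hz
    obtain ⟨i, hi, rfl, hvi⟩ := hy
    obtain ⟨j, hj, rfl, hvj⟩ := hz
    rw [responseVal_le_iff hlam0 hn.1] at hvi hvj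
    simp only [Set.mem_iUnion]
    have hij : i ≠ j := fun h => hyz (congrArg x h)
    exact ⟨(i, j), by simp [hS, hi, hj, hc, hij], hvi, hvj⟩
  have hE : ∀ i, P.real (E i) ≤ (1 + A) * B / n := by
    intro i
    have hle : |lam (x i) * (T - g (x i)) / n| ≤ B / n := by
      rw [abs_div, Nat.abs_cast]
      exact div_le_div_of_nonneg_right (hB _) (Nat.cast_nonneg n)
    refine (hcdf i _ ((le_abs_self _).trans (hle.trans hn.2))).2.trans ?_
    rw [mul_div_assoc (1 + A)]
    exact mul_le_mul_of_nonneg_left (max_le ((le_abs_self _).trans hle)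
      (by positivity)) (by positivity)
  have hpair : ∀ p ∈ S, P.real (E p.1 ∩ E p.2) ≤ ((1 + A) * B / n) ^ 2 := by
    intro p hp
    have hne : p.1 ≠ p.2 := (Finset.mem_filter.1 hp).2.1
    have := (hξ.indep.indepFun hne).measure_inter_preimage_eq_mul
      (Set.Iic (lam (x p.1) * (T - g (x p.1)) / n)) (Set.Iic (lam (x p.2) * (T - g (x p.2)) / n))
      measurableSet_Iic measurableSet_Iic
    rw [measureReal_def, this, ENNReal.toReal_mul, sq]
    exact mul_le_mul (hE _) (hE _) measureReal_nonneg (by positivity)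
  -- The ordered pairs in a common cell, including the diagonal, are counted by the sum of the
  -- squared cell counts.
  have hcard : (S.card : ℝ) ≤ ∑ a : Fin r → Prop,
      (∑ i ∈ Finset.range n, {y | cell U r y = a}.indicator (fun _ => (1 : ℝ)) (x i)) ^ 2 := by
    have h1 : ∀ a : Fin r → Prop,
        (∑ i ∈ Finset.range n, {y | cell U r y = a}.indicator (fun _ => (1 : ℝ)) (x i)) ^ 2 =
        ∑ p ∈ Finset.range n ×ˢ Finset.range n,
          {y | cell U r y = a}.indicator (fun _ => (1 : ℝ)) (x p.1) *
          {y | cell U r y = a}.indicator (fun _ => (1 : ℝ)) (x p.2) := by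
      intro a
      rw [sq, Finset.sum_mul_sum, Finset.sum_product]
    simp only [h1]
    rw [Finset.sum_comm, Finset.card_eq_sum_ones, Nat.cast_sum, hS, Finset.sum_filter]
    refine Finset.sum_le_sum fun p _ => ?_
    have hnn : ∀ a : Fin r → Prop, 0 ≤
        {y | cell U r y = a}.indicator (fun _ => (1 : ℝ)) (x p.1) *
          {y | cell U r y = a}.indicator (fun _ => (1 : ℝ)) (x p.2) := fun a =>
      mul_nonneg (Set.indicator_nonneg (fun _ _ => zero_le_one) _)
        (Set.indicator_nonneg (fun _ _ => zero_le_one) _)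
    split_ifs with h
    · refine le_trans ?_ (Finset.single_le_sum (fun a _ => hnn a)
        (Finset.mem_univ (cell U r (x p.1))))
      rw [Set.indicator_of_mem (by rfl), Set.indicator_of_mem (by exact h.2.symm)]
      simp
    · exact Finset.sum_nonneg fun a _ => hnn a
  calc P.real {ω | HasClosePair U r T (responseField lam g x ξ n ω)}
      ≤ P.real (⋃ p ∈ S, E p.1 ∩ E p.2) := measureReal_mono hsub (measure_ne_top _ _)
    _ ≤ ∑ p ∈ S, P.real (E p.1 ∩ E p.2) := measureReal_biUnion_finset_le _ _
    _ ≤ ∑ p ∈ S, ((1 + A) * B / n) ^ 2 := Finset.sum_le_sum hpair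
    _ = S.card * ((1 + A) * B / n) ^ 2 := by rw [Finset.sum_const, nsmul_eq_mul]
    _ ≤ (∑ a : Fin r → Prop, (∑ i ∈ Finset.range n,
          {y | cell U r y = a}.indicator (fun _ => (1 : ℝ)) (x i)) ^ 2) *
          ((1 + A) * B / n) ^ 2 := by gcongr
    _ = _ := by
      simp only [mul_pow, ← Finset.mul_sum, div_pow]
      ring

end Noise

/-- Inclusion-exclusion over the four corner events. It is needed for the event that two minima both
lie between two levels, when only joint exceedance probabilities are known. -/
theorem measureReal_sdiff_inter_sdiff {α : Type*} [MeasurableSpace α] {μ : Measure α}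
    [IsProbabilityMeasure μ] {A A' B B' : Set α} (hA' : NullMeasurableSet A' μ)
    (hB' : NullMeasurableSet B' μ) (hB : NullMeasurableSet B μ)
    (hAA : A' ⊆ A) (hBB : B' ⊆ B) {a a' b b' : ℝ}
    (h1 : μ.real (A ∩ B) = a * b) (h2 : μ.real (A' ∩ B) = a' * b)
    (h3 : μ.real (A ∩ B') = a * b') (h4 : μ.real (A' ∩ B') = a' * b') :
    μ.real ((A \ A') ∩ (B \ B')) = (a - a') * (b - b') := by
  have e1 : (A \ A') ∩ (B \ B') = ((A ∩ B) \ (A' ∩ B)) \ ((A ∩ B') \ (A' ∩ B')) := by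
    ext x
    have := @hAA x
    have := @hBB x
    simp only [Set.mem_inter_iff, Set.mem_sdiff]
    tauto
  have d1 : μ.real ((A ∩ B) \ (A' ∩ B)) + μ.real (A' ∩ B) = μ.real (A ∩ B) := by
    have := measureReal_inter_add_sdiff₀ (μ := μ) (s := A ∩ B) (hA'.inter hB)
    rw [Set.inter_eq_self_of_subset_right (Set.inter_subset_inter_left B hAA)] at this
    linarith
  have d2 : μ.real ((A ∩ B') \ (A' ∩ B')) + μ.real (A' ∩ B') = μ.real (A ∩ B') := by
    have := measureReal_inter_add_sdiff₀ (μ := μ) (s := A ∩ B') (hA'.inter hB')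
    rw [Set.inter_eq_self_of_subset_right (Set.inter_subset_inter_left B' hAA)] at this
    linarith
  have d3 : μ.real ((A \ A') ∩ (B \ B')) + μ.real ((A ∩ B') \ (A' ∩ B')) =
      μ.real ((A ∩ B) \ (A' ∩ B)) := by
    have := measureReal_inter_add_sdiff₀ (μ := μ) (s := (A ∩ B) \ (A' ∩ B)) hB'
    have e2 : ((A ∩ B) \ (A' ∩ B)) ∩ B' = (A ∩ B') \ (A' ∩ B') := by
      ext x
      have := @hBB x
      simp only [Set.mem_inter_iff, Set.mem_sdiff]
      tauto
    have e3 : ((A ∩ B) \ (A' ∩ B)) \ B' = (A \ A') ∩ (B \ B') := by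
      ext x
      have := @hBB x
      simp only [Set.mem_inter_iff, Set.mem_sdiff]
      tauto
    rw [e2, e3] at this
    linarith
  rw [h1, h2] at d1
  rw [h3, h4] at d2
  linear_combination d3 + d1 - d2

theorem EReal.coe_lt_add_coe_iff {a b : ℝ} {x : EReal} :
    (a : EReal) < x + b ↔ ((a - b : ℝ) : EReal) < x := by
  induction x with
  | bot => simp
  | top => simp [-EReal.coe_sub]
  | coe x =>
    rw [← EReal.coe_add, EReal.coe_lt_coe_iff, EReal.coe_lt_coe_iff]
    exact sub_lt_iff_lt_add.symm

/-! ### Close pairs, slot collisions and many low points in the limit -/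

section LimitField

variable {X : Type*} [MetricSpace X] [CompactSpace X] [MeasurableSpace X] [BorelSpace X]
  {U : ℕ → Set X} {m : Measure X} [IsProbabilityMeasure m] {lam g : X → ℝ}
  {ν : Measure (LSCFun X)} [IsProbabilityMeasure ν]

/-- The function `f + g`. -/
noncomputable def shiftField (g : X → ℝ) (f : LSCFun X) : X → EReal := fun y => f.1 y + g y

/-- The event that the random field `F` exceeds `s` on the cell `a`. -/
def aboveCell {Ω : Type*} (U : ℕ → Set X) (F : Ω → X → EReal) (r : ℕ) (a : Fin r → Prop) (s : ℝ) :
    Set Ω := {ω | ∀ y, cell U r y = a → (s : EReal) < F ω y}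

theorem aboveCell_anti {Ω : Type*} {F : Ω → X → EReal} {r : ℕ} {a : Fin r → Prop} {s s' : ℝ}
    (h : s ≤ s') : aboveCell U F r a s' ⊆ aboveCell U F r a s := fun _ hω y hy =>
  (EReal.coe_le_coe_iff.2 h).trans_lt (hω y hy)

/-- The exponent of the probability that the field exceeds `s` on the cell `a`. -/
noncomputable def cellExponent (lam g : X → ℝ) (m : Measure X) (U : ℕ → Set X) (r : ℕ)
    (a : Fin r → Prop) (s : ℝ) : ℝ :=
  ∫ y in {y | cell U r y = a}, lam y * max (s - g y) 0 ∂m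

theorem cellExponent_nonneg (hlam0 : ∀ y, 0 < lam y) (r : ℕ) (a : Fin r → Prop) (s : ℝ) :
    0 ≤ cellExponent lam g m U r a s :=
  integral_nonneg fun y => mul_nonneg (hlam0 y).le (le_max_right _ _)

/-- A level below `g` is neutral and serves as threshold on the cells that are not being examined.
-/
theorem cellExponent_eq_zero {c : ℝ} (hc : ∀ y, c < g y) (r : ℕ)
    (a : Fin r → Prop) : cellExponent lam g m U r a c = 0 := by
  have : ∀ y, max (c - g y) 0 = 0 := fun y => max_eq_right (by linarith [hc y])
  simp [cellExponent, this]

theorem IsFineBasis.integrable_cellExponent (hU : IsFineBasis U m) (hlam : Continuous lam)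
    (hg : Continuous g) (s : ℝ) : Integrable (fun y => lam y * max (s - g y) 0) m :=
  hU.integrable_of_cellUniform (hU.cellUniform_of_continuous (by fun_prop))

theorem IsFineBasis.abs_cellExponent_sub_le (hU : IsFineBasis U m) (hlam : Continuous lam)
    (hlam0 : ∀ y, 0 < lam y) (hg : Continuous g) {B : ℝ} (hB : ∀ y, lam y ≤ B) (r : ℕ)
    (a : Fin r → Prop) {s s' : ℝ} (hs : s ≤ s') :
    |cellExponent lam g m U r a s - cellExponent lam g m U r a s'| ≤
      B * (s' - s) * m.real {y | cell U r y = a} := by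
  rw [cellExponent, cellExponent, ← integral_sub
    (hU.integrable_cellExponent hlam hg s).integrableOn
    (hU.integrable_cellExponent hlam hg s').integrableOn]
  rw [← Real.norm_eq_abs]
  refine norm_setIntegral_le_of_norm_le_const (measure_lt_top m _) fun y _ => ?_
  rw [← mul_sub, Real.norm_eq_abs, abs_mul, abs_of_pos (hlam0 y)]
  refine mul_le_mul (hB y) ((abs_max_sub_max_le_abs _ _ _).trans ?_) (abs_nonneg _)
    ((hlam0 y).le.trans (hB y))
  rw [sub_sub_sub_cancel_right, abs_sub_comm, abs_of_nonneg (by linarith)]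

theorem IsFineBasis.voidExponent_eq_sum (hU : IsFineBasis U m) (hlam : Continuous lam)
    (hg : Continuous g) {r : ℕ} (v : (Fin r → Prop) → ℝ) :
    voidExponent lam m (fun y => v (cell U r y) - g y) =
      ∑ a, cellExponent lam g m U r a (v a) := by
  have h1 : ∀ a, cellExponent lam g m U r a (v a) = ∫ y, {y | cell U r y = a}.indicator
      (fun y => lam y * max (v a - g y) 0) y ∂m := fun a => by
    rw [integral_indicator (hU.measurableSet_cell _ _)]; rfl
  simp only [h1]
  rw [← integral_finsetSum _ fun a _ =>
    ((hU.integrable_cellExponent hlam hg (v a)).indicator (hU.measurableSet_cell r a))]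
  refine integral_congr_ae (Eventually.of_forall fun y => ?_)
  simp only
  rw [Finset.sum_eq_single (cell U r y)]
  · simp
  · intro b _ hb
    exact Set.indicator_of_notMem (fun h => hb h.symm) _
  · simp

theorem setOf_lt_shiftField (t : X → ℝ) :
    {f : LSCFun X | ∀ y, (t y : EReal) < shiftField g f y} = aboveSet fun y => t y - g y := by
  ext f
  simp only [shiftField, aboveSet, Set.mem_ofPred_eq, EReal.coe_lt_add_coe_iff]

theorem IsExtremeLaw.measure_lt_shiftField (hν : IsExtremeLaw lam m ν) (hU : IsFineBasis U m)
    (hlam : Continuous lam) (hlam0 : ∀ y, 0 < lam y) (hg : Continuous g) {t : X → ℝ}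
    (ht : CellUniform U t) :
    NullMeasurableSet {f : LSCFun X | ∀ y, (t y : EReal) < shiftField g f y} ν ∧
    ν.real {f | ∀ y, (t y : EReal) < shiftField g f y} =
      Real.exp (-voidExponent lam m fun y => t y - g y) := by
  rw [setOf_lt_shiftField]
  exact hν.measure_aboveSet hU (hU.cellUniform_of_continuous hlam) (fun y => (hlam0 y).le)
    (ht.sub (hU.cellUniform_of_continuous hg))

theorem IsExtremeLaw.ae_lt_shiftField (hν : IsExtremeLaw lam m ν) {c : ℝ} (hc : ∀ y, c < g y) :
    ∀ᵐ f ∂ν, ∀ y, (c : EReal) < shiftField g f y := by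
  filter_upwards [hν.ae_pos] with f hf y
  rw [shiftField, EReal.coe_lt_add_coe_iff]
  refine lt_trans ?_ (hf y)
  rw [← EReal.coe_zero, EReal.coe_lt_coe_iff]
  linarith [hc y]

variable {c : ℝ}

/-- Independence of the minima over two cells. -/
theorem IsExtremeLaw.measure_aboveCell_inter (hν : IsExtremeLaw lam m ν) (hU : IsFineBasis U m)
    (hlam : Continuous lam) (hlam0 : ∀ y, 0 < lam y) (hg : Continuous g) (hc : ∀ y, c < g y)
    {r : ℕ} {a b : Fin r → Prop} (hab : a ≠ b) {s s' : ℝ} :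
    ν.real (aboveCell U (shiftField g) r a s ∩ aboveCell U (shiftField g) r b s') =
      Real.exp (-cellExponent lam g m U r a s) * Real.exp (-cellExponent lam g m U r b s') := by
  classical
  -- The level `c` on all other cells is exceeded almost surely, so the joint event on two cells
  -- becomes the void event of one step threshold.
  set v : (Fin r → Prop) → ℝ := Function.update (Function.update (fun _ => c) a s) b s' with hv
  have hva : v a = s := by simp [hv, hab]
  have hvb : v b = s' := by simp [hv]
  have hvo : ∀ e, e ≠ a → e ≠ b → v e = c := fun e h1 h2 => by simp [hv, h1, h2]
  have h1 : (aboveCell U (shiftField g) r a s ∩ aboveCell U (shiftField g) r b s' :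
      Set (LSCFun X)) =ᵐ[ν]
      {f : LSCFun X | ∀ y, (v (cell U r y) : EReal) < shiftField g f y} := by
    filter_upwards [hν.ae_lt_shiftField hc] with f hf
    refine propext ⟨fun h y => ?_, fun h => ⟨fun y hy => ?_, fun y hy => ?_⟩⟩
    · by_cases hya : cell U r y = a
      · rw [hya, hva]; exact h.1 y hya
      · by_cases hyb : cell U r y = b
        · rw [hyb, hvb]; exact h.2 y hyb
        · rw [hvo _ hya hyb]; exact hf y
    · have := h y
      rwa [hy, hva] at this
    · have := h y
      rwa [hy, hvb] at this
  rw [measureReal_congr h1, (hν.measure_lt_shiftField hU hlam hlam0 hg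
    (cellUniform_comp_cell U v)).2, hU.voidExponent_eq_sum hlam hg,
    ← Finset.sum_neg_distrib, Real.exp_sum,
    Finset.prod_eq_mul a b hab ?_ (by simp) (by simp), hva, hvb]
  intro e _ he
  rw [hvo e he.1 he.2, cellExponent_eq_zero hc, neg_zero, Real.exp_zero]

open Classical in
theorem lt_update_cell_iff {F : X → EReal} {r : ℕ} {a : Fin r → Prop} {s : ℝ}
    (hF : ∀ y, (c : EReal) < F y) :
    (∀ y, (Function.update (fun _ => c) a s (cell U r y) : EReal) < F y) ↔
      ∀ y, cell U r y = a → (s : EReal) < F y := by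
  refine forall_congr' fun y => ?_
  by_cases hy : cell U r y = a
  · simp [hy]
  · simp [hy, hF y]

open Classical in
theorem IsFineBasis.voidExponent_update (hU : IsFineBasis U m) (hlam : Continuous lam)
    (hg : Continuous g) (hc : ∀ y, c < g y) {r : ℕ} (a : Fin r → Prop) (s : ℝ) :
    voidExponent lam m (fun y => Function.update (fun _ => c) a s (cell U r y) - g y) =
      cellExponent lam g m U r a s := by
  rw [hU.voidExponent_eq_sum hlam hg, Finset.sum_eq_single a ?_ (by simp), Function.update_self]
  intro e _ he
  rw [Function.update_of_ne he, cellExponent_eq_zero hc]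

theorem IsExtremeLaw.measure_aboveCell (hν : IsExtremeLaw lam m ν) (hU : IsFineBasis U m)
    (hlam : Continuous lam) (hlam0 : ∀ y, 0 < lam y) (hg : Continuous g) (hc : ∀ y, c < g y)
    {r : ℕ} (a : Fin r → Prop) (s : ℝ) :
    NullMeasurableSet (aboveCell U (shiftField g) r a s) ν ∧
    ν.real (aboveCell U (shiftField g) r a s) = Real.exp (-cellExponent lam g m U r a s) := by
  classical
  have h1 : {f : LSCFun X | ∀ y, (Function.update (fun _ => c) a s (cell U r y) : EReal) <
      shiftField g f y} =ᵐ[ν] (aboveCell U (shiftField g) r a s : Set (LSCFun X)) := by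
    filter_upwards [hν.ae_lt_shiftField hc] with f hf
    exact propext (lt_update_cell_iff hf)
  have h2 := hν.measure_lt_shiftField hU hlam hlam0 hg
    (cellUniform_comp_cell U (Function.update (fun _ => c) a s))
  refine ⟨h2.1.congr h1, ?_⟩
  rw [← measureReal_congr h1, h2.2, hU.voidExponent_update hlam hg hc]

/-- The probability that the minima over two cells lie in the same time slot. -/
theorem IsExtremeLaw.measure_slot_inter_le (hν : IsExtremeLaw lam m ν) (hU : IsFineBasis U m)
    (hlam : Continuous lam) (hlam0 : ∀ y, 0 < lam y) (hg : Continuous g) (hc : ∀ y, c < g y)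
    {B : ℝ} (hB : ∀ y, lam y ≤ B) {r : ℕ} {a b : Fin r → Prop} (hab : a ≠ b) {s s' : ℝ}
    (hs : s ≤ s') :
    ν.real ((aboveCell U (shiftField g) r a s \ aboveCell U (shiftField g) r a s') ∩
      (aboveCell U (shiftField g) r b s \ aboveCell U (shiftField g) r b s')) ≤
      (B * (s' - s)) ^ 2 * (m.real {y | cell U r y = a} * m.real {y | cell U r y = b}) := by
  have hmeas := fun a s => (hν.measure_aboveCell hU hlam hlam0 hg hc (r := r) a s).1
  have hpair := fun s s' => hν.measure_aboveCell_inter hU hlam hlam0 hg hc hab (s := s) (s' := s')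
  rw [measureReal_sdiff_inter_sdiff (hmeas a s') (hmeas b s') (hmeas b s)
    (aboveCell_anti hs) (aboveCell_anti hs) (hpair _ _) (hpair _ _) (hpair _ _) (hpair _ _)]
  have hone : ∀ a : Fin r → Prop, |Real.exp (-cellExponent lam g m U r a s) -
      Real.exp (-cellExponent lam g m U r a s')| ≤
      B * (s' - s) * m.real {y | cell U r y = a} := fun a =>
    (abs_exp_neg_sub_exp_neg_le (cellExponent_nonneg hlam0 r a s)
      (cellExponent_nonneg hlam0 r a s')).trans
      (hU.abs_cellExponent_sub_le hlam hlam0 hg hB r a hs)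
  refine (le_abs_self _).trans ?_
  rw [abs_mul]
  refine (mul_le_mul (hone a) (hone b) (abs_nonneg _) ((abs_nonneg _).trans (hone a))).trans
    (le_of_eq ?_)
  ring

/-- Two points with small values are unlikely to share a cell. -/
theorem IsExtremeLaw.measure_hasClosePair_le (hν : IsExtremeLaw lam m ν) (hU : IsFineBasis U m)
    (hlam : Continuous lam) (hlam0 : ∀ y, 0 < lam y) (hg : Continuous g) (hc : ∀ y, c < g y)
    {B : ℝ} (hB : ∀ y, lam y ≤ B) {T : ℝ} (hT : c ≤ T) (r : ℕ) :
    ν.real {f | HasClosePair U r T (shiftField g f)} ≤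
      (B * (T - c)) ^ 2 * cellCollision U m r := by
  classical
  -- Independence is available only between different cells. The pair is therefore separated at a
  -- finer depth `r + k`; the events increase with `k` to cover all close pairs, and the bound below
  -- is uniform in `k`.
  let E : ℕ → Set (LSCFun X) := fun k => {f | ∃ y z, cell U (r + k) y ≠ cell U (r + k) z ∧
    cell U r y = cell U r z ∧ shiftField g f y ≤ T ∧ shiftField g f z ≤ T}
  have hmono : Monotone E := by
    rintro k k' hkk f ⟨y, z, h1, h2⟩
    exact ⟨y, z, fun h => h1 (cell_eq_of_le (by omega) h), h2⟩
  have hsub : {f | HasClosePair U r T (shiftField g f)} ⊆ ⋃ k, E k := by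
    rintro f ⟨y, z, hyz, hy, hz, hcell⟩
    obtain ⟨i, hi, hd⟩ := hU.fine y (dist y z) (dist_pos.2 hyz)
    refine Set.mem_iUnion.2 ⟨i + 1, y, z, fun h => ?_, hcell, hy, hz⟩
    exact lt_irrefl _ (hd y hi z ((cell_eq_iff.1 h i (by omega)).1 hi))
  have hbound : ∀ k, ν.real (E k) ≤ (B * (T - c)) ^ 2 * cellCollision U m r := by
    intro k
    -- Pairs of different fine cells inside one coarse cell: the sum of their mass products is at
    -- most the coarse collision probability.
    let J : Finset ((Fin (r + k) → Prop) × (Fin (r + k) → Prop)) := Finset.univ.filter fun p =>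
      p.1 ≠ p.2 ∧ ∀ y z, cell U (r + k) y = p.1 → cell U (r + k) z = p.2 → cell U r y = cell U r z
    let G : (Fin (r + k) → Prop) → ℝ → Set (LSCFun X) := aboveCell U (shiftField g) (r + k)
    have hEJ : E k ≤ᵐ[ν] ⋃ p ∈ J, (G p.1 c \ G p.1 T) ∩ (G p.2 c \ G p.2 T) := by
      filter_upwards [hν.ae_lt_shiftField hc] with f hf
      rintro ⟨y, z, hne, hyz, hy, hz⟩
      refine Set.mem_iUnion₂.2 ⟨(cell U (r + k) y, cell U (r + k) z), ?_,
        ⟨fun w _ => hf w, fun h => (h y rfl).not_ge hy⟩,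
        ⟨fun w _ => hf w, fun h => (h z rfl).not_ge hz⟩⟩
      refine Finset.mem_filter.2 ⟨Finset.mem_univ _, hne, fun y' z' hy' hz' => ?_⟩
      exact (cell_eq_of_le (by omega) hy').trans (hyz.trans
        (cell_eq_of_le (by omega) hz').symm)
    have h1 : ν.real (E k) ≤ ν.real (⋃ p ∈ J, (G p.1 c \ G p.1 T) ∩ (G p.2 c \ G p.2 T)) :=
      ENNReal.toReal_mono (measure_ne_top _ _) (measure_mono_ae hEJ)
    refine h1.trans ((measureReal_biUnion_finset_le _ _).trans ?_)
    refine (Finset.sum_le_sum fun p hp => hν.measure_slot_inter_le hU hlam hlam0 hg hc hB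
      (Finset.mem_filter.1 hp).2.1 hT).trans ?_
    rw [← Finset.mul_sum]
    exact mul_le_mul_of_nonneg_left (hU.sum_mul_le_cellCollision J fun p hp =>
      (Finset.mem_filter.1 hp).2.2) (sq_nonneg _)
  have hlim : Tendsto (fun k => ν.real (E k)) atTop (𝓝 (ν.real (⋃ k, E k))) :=
    (ENNReal.tendsto_toReal (measure_ne_top _ _)).comp (tendsto_measure_iUnion_atTop hmono)
  exact (measureReal_mono hsub (measure_ne_top _ _)).trans (le_of_tendsto' hlim hbound)

/-- Two cells are unlikely to have their minima in the same short time slot. -/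
theorem IsExtremeLaw.measure_not_distinctSlots_le (hν : IsExtremeLaw lam m ν)
    (hU : IsFineBasis U m) (hlam : Continuous lam) (hlam0 : ∀ y, 0 < lam y) (hg : Continuous g)
    (hc : ∀ y, c < g y) {B : ℝ} (hB : ∀ y, lam y ≤ B) (r L : ℕ) {h : ℝ} (hh : 0 ≤ h)
    {s : ℕ → ℝ} (hs : ∀ l, s (l + 1) = s l + h) :
    ν.real {f | ¬DistinctSlots L (voidPattern (cell U r) s L (shiftField g f))} ≤
      L * (B * h) ^ 2 := by
  classical
  let J : Finset ((Fin r → Prop) × (Fin r → Prop)) := Finset.univ.filter fun p => p.1 ≠ p.2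
  let G : (Fin r → Prop) → ℝ → Set (LSCFun X) := aboveCell U (shiftField g) r
  have hsub : {f | ¬DistinctSlots L (voidPattern (cell U r) s L (shiftField g f))} ⊆
      ⋃ l ∈ Finset.range L, ⋃ p ∈ J, (G p.1 (s l) \ G p.1 (s (l + 1))) ∩
        (G p.2 (s l) \ G p.2 (s (l + 1))) := by
    intro f hf
    simp only [DistinctSlots, Set.mem_ofPred_eq, not_forall, not_not] at hf
    obtain ⟨a, b, hab, l, hl, h1, h2⟩ := hf
    refine Set.mem_iUnion₂.2 ⟨l, Finset.mem_range.2 hl, Set.mem_iUnion₂.2 ⟨(a, b),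
      Finset.mem_filter.2 ⟨Finset.mem_univ _, hab⟩, ⟨?_, ?_⟩, ⟨?_, ?_⟩⟩⟩
    · exact (mem_voidPattern hl.le).1 h1.1
    · exact fun h => h1.2 ((mem_voidPattern hl).2 h)
    · exact (mem_voidPattern hl.le).1 h2.1
    · exact fun h => h2.2 ((mem_voidPattern hl).2 h)
  -- The cell masses add up to one, so the bound for each slot does not depend on the number of
  -- cells.
  have hJ : ∑ p ∈ J, m.real {y | cell U r y = p.1} * m.real {y | cell U r y = p.2} ≤ 1 := by
    calc _ ≤ ∑ p : (Fin r → Prop) × (Fin r → Prop),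
          m.real {y | cell U r y = p.1} * m.real {y | cell U r y = p.2} :=
          Finset.sum_le_univ_sum_of_nonneg fun p => mul_nonneg measureReal_nonneg measureReal_nonneg
      _ = 1 := by
        simp only [Fintype.sum_prod_type, ← Finset.mul_sum, hU.sum_cell_eq_one, mul_one]
  refine (measureReal_mono hsub (measure_ne_top _ _)).trans
    ((measureReal_biUnion_finset_le _ _).trans ?_)
  have hl : ∀ l ∈ Finset.range L, ν.real (⋃ p ∈ J, (G p.1 (s l) \ G p.1 (s (l + 1))) ∩
        (G p.2 (s l) \ G p.2 (s (l + 1)))) ≤ (B * h) ^ 2 := by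
    intro l _
    refine (measureReal_biUnion_finset_le _ _).trans ((Finset.sum_le_sum fun p hp =>
      hν.measure_slot_inter_le hU hlam hlam0 hg hc hB (Finset.mem_filter.1 hp).2
        (by rw [hs]; linarith)).trans ?_)
    rw [← Finset.mul_sum, hs, add_sub_cancel_left]
    exact (mul_le_mul_of_nonneg_left hJ (sq_nonneg _)).trans (mul_one _).le
  refine (Finset.sum_le_sum hl).trans ?_
  simp

/-- At least `k` points have values at most `T`. -/
def HasManyPoints (k : ℕ) (T : ℝ) (F : X → EReal) : Prop :=
  ∃ t : Finset X, k ≤ t.card ∧ ∀ y ∈ t, F y ≤ T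

/-- If every cell in `S` contained a point with value at most `T`, these points would be distinct
because cells are disjoint, and there would be at least `k` of them. -/
theorem not_hasManyPoints_subset {Ω : Type*} {F : Ω → X → EReal} {r k : ℕ}
    {S : Finset (Fin r → Prop)} (hS : k ≤ S.card) (T : ℝ) :
    {ω | ¬HasManyPoints k T (F ω)} ⊆ ⋃ a ∈ S, aboveCell U F r a T := by
  classical
  intro ω hω
  by_contra hcon
  simp only [Set.mem_iUnion, not_exists, aboveCell, Set.mem_ofPred_eq] at hcon
  push Not at hcon
  choose y hy hle using hcon
  have hinj : Function.Injective fun a : S => y a a.2 := fun a b h => by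
    have h1 := hy a a.2
    rw [show y a a.2 = y b b.2 from h, hy b b.2] at h1
    exact Subtype.ext h1.symm
  refine hω ⟨Finset.univ.image fun a : S => y a a.2, ?_, ?_⟩
  · rwa [Finset.card_image_of_injective _ hinj, Finset.card_univ, Fintype.card_coe]
  · intro z hz
    obtain ⟨a, -, rfl⟩ := Finset.mem_image.1 hz
    exact hle a a.2

/-- A collision probability below `(1/(k+1))²` bounds each cell mass by `1/(k+1)`. As the masses sum
to one, enough of them must be positive. -/
theorem IsFineBasis.exists_cells [NullSingletonClass m] (hU : IsFineBasis U m) (k : ℕ) :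
    ∃ r, ∃ S : Finset (Fin r → Prop), k ≤ S.card ∧ ∀ a ∈ S, 0 < m.real {y | cell U r y = a} := by
  classical
  obtain ⟨r, hr⟩ := (hU.tendsto_cellCollision.eventually
    (gt_mem_nhds (show (0 : ℝ) < (1 / (k + 1)) ^ 2 by positivity))).exists
  refine ⟨r, Finset.univ.filter fun a => 0 < m.real {y | cell U r y = a}, ?_,
    fun a ha => (Finset.mem_filter.1 ha).2⟩
  set S := Finset.univ.filter fun a : Fin r → Prop => 0 < m.real {y | cell U r y = a} with hS
  have h1 : ∀ a, m.real {y | cell U r y = a} ≤ 1 / ((k : ℝ) + 1) := by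
    intro a
    have h := hU.sum_mul_le_cellCollision (r := r) (r' := r) {(a, a)} (by
        intro p hp y z hy hz
        rw [Finset.mem_singleton] at hp
        subst hp
        exact hy.trans hz.symm)
    rw [Finset.sum_singleton, ← sq] at h
    exact (lt_of_pow_lt_pow_left₀ 2 (by positivity) (h.trans_lt hr)).le
  have h2 : (1 : ℝ) ≤ S.card * (1 / (k + 1)) := by
    calc (1 : ℝ) = ∑ a, m.real {y | cell U r y = a} := (hU.sum_cell_eq_one r).symm
      _ = ∑ a ∈ S, m.real {y | cell U r y = a} := by
        rw [hS, Finset.sum_filter]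
        refine Finset.sum_congr rfl fun a _ => ?_
        split_ifs with h
        · rfl
        · exact le_antisymm (not_lt.1 h) measureReal_nonneg
      _ ≤ ∑ a ∈ S, 1 / ((k : ℝ) + 1) := Finset.sum_le_sum fun a _ => h1 a
      _ = _ := by rw [Finset.sum_const, nsmul_eq_mul]
  rw [mul_one_div, le_div_iff₀ (by positivity), one_mul] at h2
  exact_mod_cast (show (k : ℝ) ≤ S.card by linarith)

/-- The exponent grows at least linearly in `T`, with slope `b` times the mass of the cell. -/
theorem IsFineBasis.tendsto_cellExponent (hU : IsFineBasis U m) (hlam : Continuous lam)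
    (hg : Continuous g) {b G : ℝ} (hb : 0 < b) (hbl : ∀ y, b ≤ lam y) (hG : ∀ y, g y ≤ G) {r : ℕ}
    {a : Fin r → Prop} (ha : 0 < m.real {y | cell U r y = a}) :
    Tendsto (fun T => Real.exp (-cellExponent lam g m U r a T)) atTop (𝓝 0) := by
  refine Real.tendsto_exp_neg_atTop_nhds_zero.comp (tendsto_atTop_mono
    (f := fun T => b * (T - G) * m.real {y | cell U r y = a}) (fun T => ?_) ?_)
  · have h1 : ∫ _ in {y | cell U r y = a}, b * (T - G) ∂m =
        b * (T - G) * m.real {y | cell U r y = a} := by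
      rw [setIntegral_const, smul_eq_mul, mul_comm]
    rw [← h1]
    refine setIntegral_mono (integrable_const _)
      (hU.integrable_cellExponent hlam hg T).integrableOn fun y => ?_
    exact (mul_le_mul_of_nonneg_left ((sub_le_sub_left (hG y) T).trans (le_max_left _ 0)) hb.le).trans
      (mul_le_mul_of_nonneg_right (hbl y) (le_max_right _ _))
  · exact ((tendsto_atTop_add_const_right _ (-G) tendsto_id).const_mul_atTop hb).atTop_mul_const ha

end LimitField

/-! ### Random subsets of a finite set and their inclusion probabilities -/

section RandomFinset

variable {Ω α : Type*} [MeasurableSpace Ω] {P : Measure Ω} [IsFiniteMeasure P] [DecidableEq α]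
  {I : Finset α} {κ : Ω → Finset α}

theorem setOf_subset_eq_biUnion (hκ : ∀ ω, κ ω ⊆ I) (K : Finset α) :
    {ω | K ⊆ κ ω} = ⋃ J ∈ I.powerset.filter (K ⊆ ·), {ω | κ ω = J} := by
  ext ω
  simp [hκ ω]

theorem nullMeasurableSet_finset_eq (hκ : ∀ ω, κ ω ⊆ I)
    (hm : ∀ J ⊆ I, NullMeasurableSet {ω | J ⊆ κ ω} P) {K : Finset α} (hK : K ⊆ I) :
    NullMeasurableSet {ω | κ ω = K} P := by
  have : {ω | κ ω = K} =
      {ω | K ⊆ κ ω} \ ⋃ J ∈ I.powerset.filter (K ⊂ ·), {ω | J ⊆ κ ω} := by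
    ext ω
    simp only [Set.mem_ofPred_eq, Set.mem_sdiff, Set.mem_iUnion, Finset.mem_filter,
      Finset.mem_powerset, exists_prop, not_exists, not_and]
    constructor
    · rintro rfl
      exact ⟨subset_rfl, fun J hJ => hJ.2.2⟩
    · rintro ⟨h1, h2⟩
      by_contra hne
      exact h2 (κ ω) ⟨hκ ω, (Finset.ssubset_iff_subset_ne.2 ⟨h1, fun h => hne h.symm⟩)⟩ subset_rfl
  rw [this]
  refine NullMeasurableSet.diff (hm K hK) ?_
  exact Finset.nullMeasurableSet_biUnion _ fun J hJ =>
    hm J (Finset.mem_powerset.1 (Finset.mem_filter.1 hJ).1)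

theorem measureReal_finset_mem (hκ : ∀ ω, κ ω ⊆ I)
    (hm : ∀ J ⊆ I, NullMeasurableSet {ω | J ⊆ κ ω} P) {𝒦 : Finset (Finset α)}
    (h𝒦 : ∀ K ∈ 𝒦, K ⊆ I) :
    P.real (⋃ K ∈ 𝒦, {ω | κ ω = K}) = ∑ K ∈ 𝒦, P.real {ω | κ ω = K} := by
  refine measureReal_biUnion_finset₀ ?_
    (fun K hK => nullMeasurableSet_finset_eq hκ hm (h𝒦 K hK)) ?_
  · intro K _ K' _ hne
    exact (Set.disjoint_left.2 fun ω h h' => hne (h.symm.trans h')).aedisjoint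
  · exact fun K _ => measure_ne_top _ _

/-- Inclusion of `K` splits into equality with `K` and equality with one of its strict supersets.
This recursion recovers the law from the inclusion probabilities. -/
theorem measureReal_finset_eq (hκ : ∀ ω, κ ω ⊆ I)
    (hm : ∀ J ⊆ I, NullMeasurableSet {ω | J ⊆ κ ω} P) {K : Finset α} (hK : K ⊆ I) :
    P.real {ω | κ ω = K} = P.real {ω | K ⊆ κ ω} -
      ∑ J ∈ I.powerset.filter (K ⊂ ·), P.real {ω | κ ω = J} := by
  have h1 := measureReal_finset_mem hκ hm (𝒦 := I.powerset.filter (K ⊆ ·))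
    fun J hJ => Finset.mem_powerset.1 (Finset.mem_filter.1 hJ).1
  rw [← setOf_subset_eq_biUnion hκ] at h1
  have h2 : I.powerset.filter (K ⊆ ·) = insert K (I.powerset.filter (K ⊂ ·)) := by
    ext J
    simp only [Finset.mem_filter, Finset.mem_powerset, Finset.mem_insert]
    constructor
    · rintro ⟨h, h'⟩
      rcases eq_or_ne J K with rfl | hne
      · exact Or.inl rfl
      · exact Or.inr ⟨h, Finset.ssubset_iff_subset_ne.2 ⟨h', hne.symm⟩⟩
    · rintro (rfl | ⟨h, h'⟩)
      · exact ⟨hK, subset_rfl⟩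
      · exact ⟨h, h'.1⟩
  rw [h1, h2, Finset.sum_insert (by simp)]
  ring

theorem integral_finset (hκ : ∀ ω, κ ω ⊆ I)
    (hm : ∀ J ⊆ I, NullMeasurableSet {ω | J ⊆ κ ω} P) (f : Finset α → ℝ) :
    ∫ ω, f (κ ω) ∂P = ∑ K ∈ I.powerset, P.real {ω | κ ω = K} * f K := by
  have h1 : ∀ ω, f (κ ω) = ∑ K ∈ I.powerset, {ω | κ ω = K}.indicator (fun _ => f K) ω := by
    intro ω
    rw [Finset.sum_eq_single (κ ω)]
    · rw [Set.indicator_of_mem (by rfl)]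
    · intro K _ hne
      exact Set.indicator_of_notMem (fun h => hne h.symm) _
    · exact fun h => absurd (Finset.mem_powerset.2 (hκ ω)) h
  have hnm : ∀ K ∈ I.powerset, NullMeasurableSet {ω | κ ω = K} P := fun K hK =>
    nullMeasurableSet_finset_eq hκ hm (Finset.mem_powerset.1 hK)
  simp only [h1]
  rw [integral_finsetSum _ fun K hK => (integrable_const _).indicator₀ (hnm K hK)]
  refine Finset.sum_congr rfl fun K hK => ?_
  rw [integral_indicator₀ (hnm K hK), setIntegral_const, smul_eq_mul]

theorem aemeasurable_finset {V : Type*} [MeasurableSpace V] [MeasurableSpace.CountablyGenerated V]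
    (hκ : ∀ ω, κ ω ⊆ I)
    (hm : ∀ J ⊆ I, NullMeasurableSet {ω | J ⊆ κ ω} P) (f : Finset α → V) :
    AEMeasurable (fun ω => f (κ ω)) P := by
  classical
  refine NullMeasurable.aemeasurable fun A _ => ?_
  have : (fun ω => f (κ ω)) ⁻¹' A =
      ⋃ K ∈ I.powerset.filter (f · ∈ A), {ω | κ ω = K} := by
    ext ω
    simp [hκ ω]
  rw [this]
  exact Finset.nullMeasurableSet_biUnion _ fun K hK =>
    nullMeasurableSet_finset_eq hκ hm (Finset.mem_powerset.1 (Finset.mem_filter.1 hK).1)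

variable {Ω' : Type*} [MeasurableSpace Ω'] {P' : Measure Ω'} [IsFiniteMeasure P']
  {κs : ℕ → Ω → Finset α} {κ' : Ω' → Finset α}

/-- The law of a random subset of a finite set is determined, in the limit, by the inclusion
probabilities. -/
theorem tendsto_measure_finset_eq (hκs : ∀ n ω, κs n ω ⊆ I) (hκ' : ∀ ω, κ' ω ⊆ I)
    (hms : ∀ n, ∀ J ⊆ I, NullMeasurableSet {ω | J ⊆ κs n ω} P)
    (hm' : ∀ J ⊆ I, NullMeasurableSet {ω | J ⊆ κ' ω} P')
    (h : ∀ J ⊆ I, Tendsto (fun n => P.real {ω | J ⊆ κs n ω}) atTop (𝓝 (P'.real {ω | J ⊆ κ' ω})))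
    (K : Finset α) (hK : K ⊆ I) :
    Tendsto (fun n => P.real {ω | κs n ω = K}) atTop (𝓝 (P'.real {ω | κ' ω = K})) := by
  -- The induction runs downwards from `K = I`, since strict supersets have smaller complements in
  -- `I`.
  induction hc : (I \ K).card using Nat.strong_induction_on generalizing K with
  | _ N ih =>
    simp only [fun n => measureReal_finset_eq (hκs n) (hms n) hK,
      measureReal_finset_eq hκ' hm' hK]
    refine (h K hK).sub (tendsto_finsetSum _ fun J hJ => ?_)
    rw [Finset.mem_filter, Finset.mem_powerset] at hJ
    refine ih _ ?_ J hJ.1 rfl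
    rw [← hc]
    refine Finset.card_lt_card (Finset.ssubset_iff_subset_ne.2
      ⟨Finset.sdiff_subset_sdiff subset_rfl hJ.2.1, fun heq => ?_⟩)
    obtain ⟨i, hiJ, hiK⟩ := Finset.exists_of_ssubset hJ.2
    have : i ∈ I \ K := Finset.mem_sdiff.2 ⟨hJ.1 hiJ, hiK⟩
    rw [← heq] at this
    exact (Finset.mem_sdiff.1 this).2 hiJ

theorem tendsto_integral_finset (hκs : ∀ n ω, κs n ω ⊆ I) (hκ' : ∀ ω, κ' ω ⊆ I)
    (hms : ∀ n, ∀ J ⊆ I, NullMeasurableSet {ω | J ⊆ κs n ω} P)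
    (hm' : ∀ J ⊆ I, NullMeasurableSet {ω | J ⊆ κ' ω} P')
    (h : ∀ J ⊆ I, Tendsto (fun n => P.real {ω | J ⊆ κs n ω}) atTop (𝓝 (P'.real {ω | J ⊆ κ' ω})))
    (f : Finset α → ℝ) :
    Tendsto (fun n => ∫ ω, f (κs n ω) ∂P) atTop (𝓝 (∫ ω, f (κ' ω) ∂P')) := by
  simp only [fun n => integral_finset (hκs n) (hms n) f, integral_finset hκ' hm' f]
  exact tendsto_finsetSum _ fun K hK => (tendsto_measure_finset_eq hκs hκ' hms hm' h K
    (Finset.mem_powerset.1 hK)).mul_const _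

theorem tendsto_measure_finset_pred (hκs : ∀ n ω, κs n ω ⊆ I) (hκ' : ∀ ω, κ' ω ⊆ I)
    (hms : ∀ n, ∀ J ⊆ I, NullMeasurableSet {ω | J ⊆ κs n ω} P)
    (hm' : ∀ J ⊆ I, NullMeasurableSet {ω | J ⊆ κ' ω} P')
    (h : ∀ J ⊆ I, Tendsto (fun n => P.real {ω | J ⊆ κs n ω}) atTop (𝓝 (P'.real {ω | J ⊆ κ' ω})))
    (p : Finset α → Prop) :
    Tendsto (fun n => P.real {ω | p (κs n ω)}) atTop (𝓝 (P'.real {ω | p (κ' ω)})) := by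
  classical
  have hsub : ∀ K ∈ I.powerset.filter p, K ⊆ I := fun K hK =>
    Finset.mem_powerset.1 (Finset.mem_filter.1 hK).1
  have e1 : ∀ n, {ω | p (κs n ω)} = ⋃ K ∈ I.powerset.filter p, {ω | κs n ω = K} := fun n => by
    ext ω; simp [hκs n ω]
  have e2 : {ω | p (κ' ω)} = ⋃ K ∈ I.powerset.filter p, {ω | κ' ω = K} := by
    ext ω; simp [hκ' ω]
  simp only [e1, e2, fun n => measureReal_finset_mem (hκs n) (hms n) hsub,
    measureReal_finset_mem hκ' hm' hsub]
  exact tendsto_finsetSum _ fun K hK => tendsto_measure_finset_eq hκs hκ' hms hm' h K (hsub K hK)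

end RandomFinset

/-! ### Inclusion in the pattern as a void event -/

section PatternThreshold

variable {X ι : Type*} [Fintype ι]

open Classical in
theorem voidPattern_subset (c : X → ι) (s : ℕ → ℝ) (L : ℕ) (F : X → EReal) :
    voidPattern c s L F ⊆ Finset.univ ×ˢ Finset.range (L + 1) := Finset.filter_subset _ _

open Classical in
/-- The latest time that `J` requires on the cell `a`. -/
noncomputable def patternTop (J : Finset (ι × ℕ)) (a : ι) : ℕ :=
  (J.filter fun p => p.1 = a).sup Prod.snd

/-- On each cell only the latest required level matters, so all requirements merge into one step
threshold. On a cell with no requirement the supremum is `0`, and the level `s 0` is exceeded by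
assumption. -/
theorem subset_voidPattern_iff {c : X → ι} {s : ℕ → ℝ} (hs : Monotone s) {L : ℕ} {F : X → EReal}
    (h0 : ∀ y, (s 0 : EReal) < F y) {J : Finset (ι × ℕ)}
    (hJ : J ⊆ Finset.univ ×ˢ Finset.range (L + 1)) :
    J ⊆ voidPattern c s L F ↔ ∀ y, (s (patternTop J (c y)) : EReal) < F y := by
  classical
  have hl : ∀ p ∈ J, p.2 ≤ L := fun p hp =>
    Nat.lt_succ_iff.1 (Finset.mem_range.1 (Finset.mem_product.1 (hJ hp)).2)
  constructor
  · intro h y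
    rcases (J.filter fun p => p.1 = c y).eq_empty_or_nonempty with he | hne
    · simpa [patternTop, he] using h0 y
    · obtain ⟨p, hp, hsup⟩ := Finset.exists_mem_eq_sup _ hne Prod.snd
      rw [patternTop, hsup]
      rw [Finset.mem_filter] at hp
      exact (mem_voidPattern (hl p hp.1)).1 (h hp.1) y hp.2.symm
  · intro h p hp
    refine (mem_voidPattern (hl p hp)).2 fun y hy => ?_
    refine lt_of_le_of_lt (EReal.coe_le_coe_iff.2 (hs ?_)) (h y)
    exact Finset.le_sup (f := Prod.snd) (Finset.mem_filter.2 ⟨hp, hy.symm⟩)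

end PatternThreshold

/-! ### The good event -/

section GoodEvent

variable {X : Type*} [MetricSpace X] {V : Type*} [NormedAddCommGroup V]

open Classical in
/-- The images under `e` of the first `k` argmins. -/
noncomputable def argminTuple (e : X → V) (k : ℕ) (F : X → EReal) : Fin k → V :=
  fun j => if h : (kthArgmin F j).Nonempty then e h.some else 0

open Classical in
/-- The image under `e` of a point of the given cell. -/
noncomputable def cellRep (e : X → V) (U : ℕ → Set X) (r : ℕ) (a : Fin r → Prop) : V :=
  if h : ∃ y, cell U r y = a then e h.choose else 0

/-- The approximation of the first `k` argmins that is read off from the void pattern. -/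
noncomputable def approxTuple (e : X → V) (U : ℕ → Set X) (r L k : ℕ)
    (κ : Finset ((Fin r → Prop) × ℕ)) : Fin k → V :=
  fun j => rankRep (cellRep e U r) L κ j

/-- The event that the void pattern determines the cells of the first `k` argmins. -/
structure IsGood (U : ℕ → Set X) (r L k : ℕ) (s : ℕ → ℝ) (F : X → EReal) : Prop where
  lower : ∀ y, (s 0 : EReal) < F y
  separated : ¬HasClosePair U r (s L) F
  distinct : DistinctSlots L (voidPattern (cell U r) s L F)
  many : HasManyPoints k (s L) F

theorem dist_cellRep_lt {e : X → V} (he : ∀ y z, dist (e y) (e z) ≤ dist y z) {U : ℕ → Set X}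
    {r : ℕ} {ε : ℝ} (hmesh : ∀ y z, cell U r y = cell U r z → dist y z < ε) (y : X) :
    dist (e y) (cellRep e U r (cell U r y)) < ε := by
  have h : ∃ z, cell U r z = cell U r y := ⟨y, rfl⟩
  rw [cellRep, dif_pos h]
  exact (he _ _).trans_lt (hmesh _ _ h.choose_spec.symm)

/-- The pattern yields the exact cells of the argmins, and a representative of a cell is within `ε`
of every point of it. The map `e` does not increase distances. -/
theorem IsGood.spec {U : ℕ → Set X} {r L k : ℕ} {s : ℕ → ℝ} {F : X → EReal}
    (h : IsGood U r L k s F) (hs : Monotone s) {e : X → V}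
    (he : ∀ y z, dist (e y) (e z) ≤ dist y z)
    {ε : ℝ} (hmesh : ∀ y z, cell U r y = cell U r z → dist y z < ε) (hε : 0 < ε) :
    (∀ j < k, ∃ y, kthArgmin F j = {y}) ∧
      dist (argminTuple e k F) (approxTuple e U r L k (voidPattern (cell U r) s L F)) < ε := by
  have key : ∀ j < k, ∃ y, kthArgmin F j = {y} ∧
      ∀ {V : Type _} [Zero V] (rep : (Fin r → Prop) → V),
        rankRep rep L (voidPattern (cell U r) s L F) j = rep (cell U r y) := fun j hj =>
    kthArgmin_of_good hs h.lower (fun y z hy hz hc => by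
      by_contra hne
      exact h.separated ⟨y, z, hne, hy, hz, hc⟩) h.distinct h.many hj
  refine ⟨fun j hj => (key j hj).imp fun y hy => hy.1, (dist_pi_lt_iff hε).2 fun j => ?_⟩
  obtain ⟨y, hy, hrep⟩ := key j j.2
  have hne : (kthArgmin F j).Nonempty := by rw [hy]; exact Set.singleton_nonempty y
  have hsome : hne.some = y := Set.mem_singleton_iff.1 (hy.subset hne.some_mem)
  rw [argminTuple, dif_pos hne, approxTuple, hrep, hsome]
  exact dist_cellRep_lt he hmesh y

theorem measureReal_not_isGood_le {Ω : Type*} [MeasurableSpace Ω] {P : Measure Ω}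
    [IsFiniteMeasure P] {U : ℕ → Set X} {r L k : ℕ} {s : ℕ → ℝ} {F : Ω → X → EReal}
    (h0 : ∀ᵐ ω ∂P, ∀ y, (s 0 : EReal) < F ω y) :
    P.real {ω | ¬IsGood U r L k s (F ω)} ≤ P.real {ω | HasClosePair U r (s L) (F ω)} +
      P.real {ω | ¬DistinctSlots L (voidPattern (cell U r) s L (F ω))} +
      P.real {ω | ¬HasManyPoints k (s L) (F ω)} := by
  have hsub : {ω | ¬IsGood U r L k s (F ω)} ≤ᵐ[P] (({ω | HasClosePair U r (s L) (F ω)} ∪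
      {ω | ¬DistinctSlots L (voidPattern (cell U r) s L (F ω))}) ∪
      {ω | ¬HasManyPoints k (s L) (F ω)} : Set Ω) := by
    filter_upwards [h0] with ω hω hbad
    by_contra hcon
    exact hbad ⟨hω, fun h => hcon (Or.inl (Or.inl h)),
      by_contra fun h => hcon (Or.inl (Or.inr h)), by_contra fun h => hcon (Or.inr h)⟩
  refine (ENNReal.toReal_mono (measure_ne_top _ _) (measure_mono_ae hsub)).trans ?_
  refine (measureReal_union_le _ _).trans ?_
  gcongr
  exact measureReal_union_le _ _

end GoodEvent

/-! ### Convergence of patterns and of argmins -/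

section Convergence

variable {Ω : Type*} [MeasurableSpace Ω] {P : Measure Ω} [IsProbabilityMeasure P]
  {ξ : ℕ → Ω → ℝ} {X : Type*} [MetricSpace X] [CompactSpace X] [MeasurableSpace X] [BorelSpace X]
  {U : ℕ → Set X} {m : Measure X} [IsProbabilityMeasure m] {x : ℕ → X} {lam g : X → ℝ}
  {ν : Measure (LSCFun X)} [IsProbabilityMeasure ν]

theorem IsUnitRateNoise.ae_lt_responseField (hξ : IsUnitRateNoise P ξ)
    (hx : Function.Injective x) (hlam0 : ∀ y, 0 < lam y) {c : ℝ} (hc : ∀ y, c < g y) (n : ℕ) :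
    ∀ᵐ ω ∂P, ∀ y, (c : EReal) < responseField lam g x ξ n ω y := by
  filter_upwards [ae_all_iff.2 hξ.nonneg] with ω hω
  refine (lt_pointFun_iff hx (t := fun _ => c)).2 fun i _ => ?_
  have h1 : 0 ≤ (n : ℝ) / lam (x i) * ξ i ω :=
    mul_nonneg (div_nonneg (Nat.cast_nonneg n) (hlam0 _).le) (hω i)
  have h2 := hc (x i)
  rw [responseVal]
  linarith

theorem IsUnitRateNoise.tendsto_measure_aboveCell (hξ : IsUnitRateNoise P ξ)
    (hx : IsEquidistributed x m) (hU : IsFineBasis U m) (hlam : Continuous lam)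
    (hlam0 : ∀ y, 0 < lam y) (hg : Continuous g) {c : ℝ} (hc : ∀ y, c < g y) {r : ℕ}
    (a : Fin r → Prop) (s : ℝ) :
    Tendsto (fun n => P.real (aboveCell U (responseField lam g x ξ n) r a s)) atTop
      (𝓝 (Real.exp (-cellExponent lam g m U r a s))) := by
  classical
  rw [← hU.voidExponent_update hlam hg hc]
  refine (hξ.tendsto_measure_lt_responseField hx hU hlam hlam0 hg
    (cellUniform_comp_cell U (Function.update (fun _ => c) a s))).congr fun n => ?_
  refine measureReal_congr ?_
  filter_upwards [hξ.ae_lt_responseField hx.inj hlam0 hc n] with ω hω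
  exact propext (lt_update_cell_iff hω)

/-- A random field is good, up to a null set, whenever its thresholds are. -/
theorem setOf_subset_voidPattern_ae_eq {Ω : Type*} [MeasurableSpace Ω] {P : Measure Ω}
    {F : Ω → X → EReal} {s : ℕ → ℝ} (hs : Monotone s) {r L : ℕ}
    (h0 : ∀ᵐ ω ∂P, ∀ y, (s 0 : EReal) < F ω y) {J : Finset ((Fin r → Prop) × ℕ)}
    (hJ : J ⊆ Finset.univ ×ˢ Finset.range (L + 1)) :
    {ω | ∀ y, (s (patternTop J (cell U r y)) : EReal) < F ω y} =ᵐ[P]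
      {ω | J ⊆ voidPattern (cell U r) s L (F ω)} := by
  filter_upwards [h0] with ω hω
  exact propext (subset_voidPattern_iff hs hω hJ).symm

theorem IsUnitRateNoise.nullMeasurableSet_subset_voidPattern (hξ : IsUnitRateNoise P ξ)
    (hx : Function.Injective x) (hlam0 : ∀ y, 0 < lam y) {s : ℕ → ℝ} (hs : Monotone s)
    (hc : ∀ y, s 0 < g y) (r L n : ℕ) (J : Finset ((Fin r → Prop) × ℕ))
    (hJ : J ⊆ Finset.univ ×ˢ Finset.range (L + 1)) :
    NullMeasurableSet {ω | J ⊆ voidPattern (cell U r) s L (responseField lam g x ξ n ω)} P :=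
  (hξ.measurableSet_lt_responseField hx n fun y =>
    s (patternTop J (cell U r y))).nullMeasurableSet.congr
    (setOf_subset_voidPattern_ae_eq hs (hξ.ae_lt_responseField hx hlam0 hc n) hJ)

theorem IsExtremeLaw.nullMeasurableSet_subset_voidPattern (hν : IsExtremeLaw lam m ν)
    (hU : IsFineBasis U m) (hlam : Continuous lam) (hlam0 : ∀ y, 0 < lam y) (hg : Continuous g)
    {s : ℕ → ℝ} (hs : Monotone s)
    (hc : ∀ y, s 0 < g y) (r L : ℕ) (J : Finset ((Fin r → Prop) × ℕ))
    (hJ : J ⊆ Finset.univ ×ˢ Finset.range (L + 1)) :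
    NullMeasurableSet {f | J ⊆ voidPattern (cell U r) s L (shiftField g f)} ν :=
  (hν.measure_lt_shiftField hU hlam hlam0 hg
    (cellUniform_comp_cell U fun a => s (patternTop J a))).1.congr
    (setOf_subset_voidPattern_ae_eq hs (hν.ae_lt_shiftField hc) hJ)

/-- Up to null sets both events are void events for the same step threshold, so the convergence is
that of void probabilities. Here the response functions meet the limit process. -/
theorem tendsto_measure_subset_voidPattern (hν : IsExtremeLaw lam m ν) (hξ : IsUnitRateNoise P ξ)
    (hx : IsEquidistributed x m)
    (hU : IsFineBasis U m) (hlam : Continuous lam) (hlam0 : ∀ y, 0 < lam y) (hg : Continuous g)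
    {s : ℕ → ℝ} (hs : Monotone s)
    (hc : ∀ y, s 0 < g y) (r L : ℕ) (J : Finset ((Fin r → Prop) × ℕ))
    (hJ : J ⊆ Finset.univ ×ˢ Finset.range (L + 1)) :
    Tendsto (fun n => P.real
      {ω | J ⊆ voidPattern (cell U r) s L (responseField lam g x ξ n ω)}) atTop
      (𝓝 (ν.real {f | J ⊆ voidPattern (cell U r) s L (shiftField g f)})) := by
  rw [← measureReal_congr (setOf_subset_voidPattern_ae_eq hs (hν.ae_lt_shiftField hc) hJ),
    (hν.measure_lt_shiftField hU hlam hlam0 hg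
    (cellUniform_comp_cell U fun a => s (patternTop J a))).2]
  refine (hξ.tendsto_measure_lt_responseField hx hU hlam hlam0 hg
    (cellUniform_comp_cell U fun a => s (patternTop J a))).congr fun n => ?_
  exact measureReal_congr
    (setOf_subset_voidPattern_ae_eq hs (hξ.ae_lt_responseField hx.inj hlam0 hc n) hJ)

/-- The discretization can be chosen such that the good event has probability close to one. -/
theorem exists_good_discretization [NullSingletonClass m] (hν : IsExtremeLaw lam m ν)
    (hξ : IsUnitRateNoise P ξ) (hx : IsEquidistributed x m)
    (hU : IsFineBasis U m) (hlam : Continuous lam) (hlam0 : ∀ y, 0 < lam y) (hg : Continuous g)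
    (k : ℕ) {ε : ℝ} (hε : 0 < ε) :
    ∃ (r L : ℕ) (s : ℕ → ℝ), Monotone s ∧ (∀ y, s 0 < g y) ∧
      (∀ y z, cell U r y = cell U r z → dist y z < ε) ∧
      ν.real {f | ¬IsGood U r L k s (shiftField g f)} ≤ ε ∧
      ∀ᶠ n in atTop, P.real {ω | ¬IsGood U r L k s (responseField lam g x ξ n ω)} ≤ ε := by
  classical
  have hX : (Set.univ : Set X).Nonempty := ⟨x 0, trivial⟩
  obtain ⟨y₁, -, h₁⟩ := isCompact_univ.exists_isMinOn hX hlam.continuousOn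
  obtain ⟨y₂, -, h₂⟩ := isCompact_univ.exists_isMaxOn hX hlam.continuousOn
  obtain ⟨y₃, -, h₃⟩ := isCompact_univ.exists_isMinOn hX hg.continuousOn
  obtain ⟨y₄, -, h₄⟩ := isCompact_univ.exists_isMaxOn hX hg.continuousOn
  have hB : ∀ y, lam y ≤ lam y₂ := fun y => h₂ (Set.mem_univ y)
  obtain ⟨c, hc⟩ : ∃ c, ∀ y, c < g y :=
    ⟨g y₃ - 1, fun y => by linarith [show g y₃ ≤ g y from h₃ (Set.mem_univ y)]⟩
  -- The depth `r₀` serves only to find `T`. Having many low points does not refer to cells, so a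
  -- finer depth `r` may be chosen afterwards, depending on `T`.
  obtain ⟨r₀, S, hS, hSpos⟩ := hU.exists_cells k
  -- choice of the level
  have hsumT : Tendsto (fun T => ∑ a ∈ S, Real.exp (-cellExponent lam g m U r₀ a T)) atTop
      (𝓝 0) := by
    have := tendsto_finsetSum S fun a ha => hU.tendsto_cellExponent hlam hg (hlam0 y₁)
      (fun y => h₁ (Set.mem_univ y)) (fun y => h₄ (Set.mem_univ y)) (hSpos a ha)
    simpa using this
  obtain ⟨T, hTsum, hT⟩ := ((hsumT.eventually (gt_mem_nhds (show 0 < ε / 8 by positivity))).and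
    (eventually_ge_atTop c)).exists
  -- choice of the cells
  obtain ⟨K, hK0, hK⟩ := hξ.eventually_measure_hasClosePair_le hx hU hlam hlam0 hg T
  have hcoll1 := (hU.tendsto_cellCollision.const_mul K)
  have hcoll2 := (hU.tendsto_cellCollision.const_mul ((lam y₂ * (T - c)) ^ 2))
  rw [mul_zero] at hcoll1 hcoll2
  obtain ⟨r, ⟨hr1, hr2⟩, hmesh⟩ := ((hcoll1.eventually
    (gt_mem_nhds (show 0 < ε / 8 by positivity))).and (hcoll2.eventually
    (gt_mem_nhds (show 0 < ε / 8 by positivity)))).and (hU.eventually_dist_lt hε) |>.exists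
  -- choice of the time slots
  obtain ⟨L, hL, hL0⟩ := (((tendsto_const_div_atTop_nhds_zero_nat
    ((lam y₂ * (T - c)) ^ 2)).eventually (gt_mem_nhds (show 0 < ε / 8 by positivity))).and
    (eventually_gt_atTop 0)).exists
  have hLpos : (0 : ℝ) < L := Nat.cast_pos.2 hL0
  set h : ℝ := (T - c) / L with hdef
  have hh : 0 ≤ h := div_nonneg (by linarith) hLpos.le
  set s : ℕ → ℝ := fun l => c + l * h with hs
  have hs0 : s 0 = c := by simp [hs]
  have hsL : s L = T := by simp only [hs, hdef]; field_simp; ring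
  have hsmono : Monotone s := monotone_nat_of_le_succ fun l => by
    simp only [hs]; push_cast; nlinarith
  have hc0 : ∀ y, s 0 < g y := by rw [hs0]; exact hc
  -- With `L` slots of length `(T - c)/L`, the bound is the square of `B (T - c)`, with `B` the
  -- maximum of `lam`, divided by `L`.
  have hslot : ν.real {f | ¬DistinctSlots L (voidPattern (cell U r) s L (shiftField g f))} ≤
      ε / 8 := by
    refine (hν.measure_not_distinctSlots_le hU hlam hlam0 hg hc hB r L hh (s := s)
      (fun l => by simp only [hs]; push_cast; ring)).trans (le_trans (le_of_eq ?_) hL.le)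
    rw [hdef]; field_simp
  refine ⟨r, L, s, hsmono, hc0, hmesh, ?_, ?_⟩
  · refine (measureReal_not_isGood_le (hν.ae_lt_shiftField hc0)).trans ?_
    rw [hsL]
    have h1 := hν.measure_hasClosePair_le hU hlam hlam0 hg hc hB hT r
    have h3 : ν.real {f | ¬HasManyPoints k T (shiftField g f)} ≤ ε / 8 := by
      refine ((measureReal_mono (not_hasManyPoints_subset (U := U) hS T) (measure_ne_top _ _)).trans
        (measureReal_biUnion_finset_le _ _)).trans (le_trans (le_of_eq ?_) hTsum.le)
      exact Finset.sum_congr rfl fun a _ => (hν.measure_aboveCell hU hlam hlam0 hg hc a T).2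
    linarith
  -- For the response functions slot collisions are not estimated directly. They are a property of
  -- the pattern, so the bound transfers from the limit, with `ε/8` relaxed to `ε/4`.
  · have hslotn := (tendsto_measure_finset_pred
      (fun n ω => voidPattern_subset (cell U r) s L (responseField lam g x ξ n ω))
      (fun f => voidPattern_subset (cell U r) s L (shiftField g f))
      (fun n => hξ.nullMeasurableSet_subset_voidPattern hx.inj hlam0 hsmono hc0 r L n)
      (hν.nullMeasurableSet_subset_voidPattern hU hlam hlam0 hg hsmono hc0 r L)
      (tendsto_measure_subset_voidPattern hν hξ hx hU hlam hlam0 hg hsmono hc0 r L)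
      fun κ => ¬DistinctSlots L κ).eventually (gt_mem_nhds (show _ < ε / 4 by linarith))
    have hmany := (tendsto_finsetSum S fun a _ => hξ.tendsto_measure_aboveCell hx hU hlam hlam0 hg
      hc a T).eventually (gt_mem_nhds hTsum)
    filter_upwards [hK r (ε / 8) (by positivity), hslotn, hmany] with n hn1 hn2 hn3
    refine (measureReal_not_isGood_le (hξ.ae_lt_responseField hx.inj hlam0 hc0 n)).trans ?_
    rw [hsL]
    have h3 : P.real {ω | ¬HasManyPoints k T (responseField lam g x ξ n ω)} ≤ ε / 8 :=
      ((measureReal_mono (not_hasManyPoints_subset (U := U) hS T) (measure_ne_top _ _)).trans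
        (measureReal_biUnion_finset_le _ _)).trans hn3.le
    linarith

variable {V : Type*} [NormedAddCommGroup V] [MeasurableSpace V] [BorelSpace V]
  [SecondCountableTopology V] {e : X → V}

/-- The argmins of an extreme value process are almost surely unique. -/
theorem IsExtremeLaw.ae_kthArgmin_eq_singleton [NullSingletonClass m] (hν : IsExtremeLaw lam m ν)
    (hξ : IsUnitRateNoise P ξ) (hx : IsEquidistributed x m)
    (hU : IsFineBasis U m) (hlam : Continuous lam) (hlam0 : ∀ y, 0 < lam y) (hg : Continuous g)
    (k : ℕ) : ∀ᵐ f ∂ν, ∀ j < k, ∃ y, kthArgmin (shiftField g f) j = {y} := by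
  have h : ν.real {f | ¬∀ j < k, ∃ y, kthArgmin (shiftField g f) j = {y}} ≤ 0 := by
    refine le_of_forall_pos_le_add fun ε hε => ?_
    obtain ⟨r, L, s, hs, hc, hmesh, hbad, -⟩ :=
      exists_good_discretization hν hξ hx hU hlam hlam0 hg k hε
    rw [zero_add]
    refine le_trans (measureReal_mono (s₂ := {f | ¬IsGood U r L k s (shiftField g f)})
      (fun f hf hgood => hf ?_) (measure_ne_top _ _)) hbad
    exact (IsGood.spec (e := fun _ => (0 : ℝ)) hgood hs (by simp) hmesh hε).1
  exact (measureReal_eq_zero_iff).1 (le_antisymm h measureReal_nonneg)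

theorem tendsto_measure_kthArgmin_eq_singleton [NullSingletonClass m] (hν : IsExtremeLaw lam m ν)
    (hξ : IsUnitRateNoise P ξ) (hx : IsEquidistributed x m)
    (hU : IsFineBasis U m) (hlam : Continuous lam) (hlam0 : ∀ y, 0 < lam y) (hg : Continuous g)
    (k : ℕ) : Tendsto (fun n => P {ω | ∀ j < k, ∃ y,
      kthArgmin (responseField lam g x ξ n ω) j = {y}}) atTop (𝓝 1) := by
  have h : Tendsto (fun n => P.real {ω | ∀ j < k, ∃ y,
      kthArgmin (responseField lam g x ξ n ω) j = {y}}) atTop (𝓝 1) := by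
    rw [Metric.tendsto_nhds]
    intro ε hε
    obtain ⟨r, L, s, hs, hc, hmesh, -, hbad⟩ :=
      exists_good_discretization hν hξ hx hU hlam hlam0 hg k (half_pos hε)
    filter_upwards [hbad] with n hn
    set A := {ω | ∀ j < k, ∃ y, kthArgmin (responseField lam g x ξ n ω) j = {y}} with hA
    have h1 : P.real Aᶜ ≤ ε / 2 := by
      refine le_trans (measureReal_mono
        (s₂ := {ω | ¬IsGood U r L k s (responseField lam g x ξ n ω)})
        (fun ω hω hgood => hω ?_) (measure_ne_top _ _)) hn
      exact (IsGood.spec (e := fun _ => (0 : ℝ)) hgood hs (by simp) hmesh (half_pos hε)).1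
    -- Subadditivity replaces the complement rule, so measurability of `A` is not required.
    have h2 : P.real Set.univ ≤ P.real A + P.real Aᶜ := by
      rw [← Set.union_compl_self A]; exact measureReal_union_le _ _
    rw [probReal_univ] at h2
    have h3 : P.real A ≤ 1 := measureReal_le_one
    rw [Real.dist_eq, abs_lt]
    constructor <;> linarith
  have := (ENNReal.continuous_ofReal.tendsto 1).comp h
  rw [ENNReal.ofReal_one] at this
  refine this.congr fun n => ?_
  exact ENNReal.ofReal_toReal (measure_ne_top _ _)

/-- The tuple is an almost sure limit of functions of void patterns. Discretizations with errors
`2⁻ⁱ` have summable failure probabilities, so by Borel-Cantelli almost every `f` is good from some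
index on. -/
theorem IsExtremeLaw.aemeasurable_argminTuple [NullSingletonClass m] (hν : IsExtremeLaw lam m ν)
    (hξ : IsUnitRateNoise P ξ) (hx : IsEquidistributed x m)
    (hU : IsFineBasis U m) (hlam : Continuous lam) (hlam0 : ∀ y, 0 < lam y) (hg : Continuous g)
    (he : ∀ y z, dist (e y) (e z) ≤ dist y z) (k : ℕ) :
    AEMeasurable (fun f => argminTuple e k (shiftField g f)) ν := by
  classical
  have hpos : ∀ i : ℕ, (0 : ℝ) < (1 / 2) ^ i := fun i => by positivity
  choose r L s hs hc hmesh hbad _ using fun i : ℕ =>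
    exists_good_discretization hν hξ hx hU hlam hlam0 hg k (hpos i)
  refine aemeasurable_of_tendsto_metrizable_ae atTop (f := fun i f =>
    approxTuple e U (r i) (L i) k (voidPattern (cell U (r i)) (s i) (L i) (shiftField g f)))
    (fun i => aemeasurable_finset (fun f => voidPattern_subset _ _ _ _)
      (hν.nullMeasurableSet_subset_voidPattern hU hlam hlam0 hg (hs i) (hc i) (r i) (L i)) _) ?_
  have hsum : ∑' i, ν {f | ¬IsGood U (r i) (L i) k (s i) (shiftField g f)} ≠ ⊤ := by
    refine ne_top_of_le_ne_top ?_ (ENNReal.tsum_le_tsum fun i =>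
      (ENNReal.le_ofReal_iff_toReal_le (measure_ne_top _ _) (hpos i).le).2 (hbad i))
    rw [← ENNReal.ofReal_tsum_of_nonneg (fun i => (hpos i).le) summable_geometric_two]
    exact ENNReal.ofReal_ne_top
  filter_upwards [ae_eventually_notMem hsum] with f hf
  rw [tendsto_iff_dist_tendsto_zero]
  refine squeeze_zero' (Eventually.of_forall fun _ => dist_nonneg) ?_
    (tendsto_pow_atTop_nhds_zero_of_lt_one (by norm_num : (0 : ℝ) ≤ 1 / 2) (by norm_num))
  filter_upwards [hf] with i hi
  rw [dist_comm]
  have hgood : IsGood U (r i) (L i) k (s i) (shiftField g f) := by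
    by_contra h
    exact hi h
  exact (hgood.spec (hs i) he (hmesh i) (hpos i)).2.le

/-- Two functions of a random element are close in mean if they are close with high probability. -/
theorem abs_integral_sub_integral_le {Ω V : Type*} [MeasurableSpace Ω] {P : Measure Ω}
    [IsProbabilityMeasure P] {φ : V → ℝ} {Y Z : Ω → V} {C δ ε : ℝ}
    (hC0 : 0 ≤ C)
    (hC : ∀ v w, |φ v - φ w| ≤ C) (hY : Integrable (fun ω => φ (Y ω)) P)
    (hZ : Integrable (fun ω => φ (Z ω)) P) {A : Set Ω} (hA : P.real A ≤ ε)
    (hclose : ∀ ω ∉ A, |φ (Y ω) - φ (Z ω)| ≤ δ) (hδ : 0 ≤ δ) :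
    |∫ ω, φ (Y ω) ∂P - ∫ ω, φ (Z ω) ∂P| ≤ δ + C * ε := by
  rw [← integral_sub hY hZ]
  refine abs_integral_le_integral_abs.trans ?_
  -- The exceptional set need not be measurable; its measurable hull has the same measure.
  set A' := toMeasurable P A with hA'
  have hmA' : MeasurableSet A' := measurableSet_toMeasurable P A
  have hint : Integrable (A'.indicator fun _ => C) P := (integrable_const C).indicator hmA'
  calc ∫ ω, |φ (Y ω) - φ (Z ω)| ∂P ≤ ∫ ω, (δ + A'.indicator (fun _ => C) ω) ∂P := by
        refine integral_mono (hY.sub hZ).abs ((integrable_const δ).add hint) fun ω => ?_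
        by_cases hω : ω ∈ A'
        · simp only [Set.indicator_of_mem hω]
          linarith [hC (Y ω) (Z ω)]
        · simp only [Set.indicator_of_notMem hω, add_zero]
          exact hclose ω fun h => hω (subset_toMeasurable P A h)
    _ = δ + C * P.real A := by
        rw [integral_add (integrable_const δ) hint, integral_indicator hmA', setIntegral_const,
          integral_const, probReal_univ, smul_eq_mul, smul_eq_mul, one_mul, hA',
          measureReal_def, measure_toMeasurable, ← measureReal_def, mul_comm C]
    _ ≤ δ + C * ε := by gcongr

/-- Convergence in distribution of the first `k` argmins. -/
theorem tendsto_integral_argminTuple [NullSingletonClass m] (hν : IsExtremeLaw lam m ν)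
    (hξ : IsUnitRateNoise P ξ) (hx : IsEquidistributed x m)
    (hU : IsFineBasis U m) (hlam : Continuous lam) (hlam0 : ∀ y, 0 < lam y) (hg : Continuous g)
    (he : ∀ y z, dist (e y) (e z) ≤ dist y z) (k : ℕ)
    (hmeas : ∀ n, AEMeasurable (fun ω => argminTuple e k (responseField lam g x ξ n ω)) P)
    {φ : (Fin k → V) → ℝ} {C : ℝ} (hC : ∀ v w, dist (φ v) (φ w) ≤ C) {M : NNReal}
    (hM : LipschitzWith M φ) :
    Tendsto (fun n => ∫ ω, φ (argminTuple e k (responseField lam g x ξ n ω)) ∂P) atTop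
      (𝓝 (∫ f, φ (argminTuple e k (shiftField g f)) ∂ν)) := by
  classical
  have hC0 : 0 ≤ C := dist_nonneg.trans (hC 0 0)
  have hbdd : ∀ v, ‖φ v‖ ≤ ‖φ 0‖ + C := fun v => by
    have := hC v 0
    rw [Real.dist_eq] at this
    have h2 := norm_sub_norm_le (φ v) (φ 0)
    rw [Real.norm_eq_abs (φ v - φ 0)] at h2
    linarith
  have hint : ∀ {Ω : Type _} [MeasurableSpace Ω] {Q : Measure Ω} [IsProbabilityMeasure Q]
      {Y : Ω → Fin k → V}, AEMeasurable Y Q → Integrable (fun ω => φ (Y ω)) Q := by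
    intro Ω _ Q _ Y hY
    exact Integrable.of_bound
      (hM.continuous.measurable.comp_aemeasurable hY).aestronglyMeasurable (‖φ 0‖ + C)
      (Eventually.of_forall fun ω => hbdd _)
  have hint' : ∀ {Q : Measure (LSCFun X)} [IsProbabilityMeasure Q]
      {Y : LSCFun X → Fin k → V}, AEMeasurable Y Q → Integrable (fun ω => φ (Y ω)) Q := by
    intro Q _ Y hY
    exact Integrable.of_bound
      (hM.continuous.measurable.comp_aemeasurable hY).aestronglyMeasurable (‖φ 0‖ + C)
      (Eventually.of_forall fun ω => hbdd _)
  rw [Metric.tendsto_nhds]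
  intro η hη
  -- Replacing the tuple by its approximation costs at most `Mε` on the good event and `Cε` off it.
  -- This happens twice, and the pattern convergence adds another `η/4`.
  set ε := η / (4 * (M + C + 1)) with hεdef
  have hε : 0 < ε := by positivity
  have hεη : (M + C) * ε < η / 4 := by
    rw [hεdef]
    have : (M + C) * (η / (4 * (M + C + 1))) = η / 4 * ((M + C) / (M + C + 1)) := by
      field_simp
    rw [this]
    refine mul_lt_of_lt_one_right (by positivity) ?_
    rw [div_lt_one (by positivity)]; linarith
  obtain ⟨r, L, s, hs, hc, hmesh, hbad, hbadn⟩ :=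
    exists_good_discretization hν hξ hx hU hlam hlam0 hg k hε
  have hnm := hν.nullMeasurableSet_subset_voidPattern hU hlam hlam0 hg hs hc r L
  have hnmn := fun n => hξ.nullMeasurableSet_subset_voidPattern (U := U) hx.inj hlam0 hs hc r L n
  have hlim := tendsto_integral_finset
      (fun n ω => voidPattern_subset (cell U r) s L (responseField lam g x ξ n ω))
      (fun f => voidPattern_subset (cell U r) s L (shiftField g f)) hnmn hnm
      (tendsto_measure_subset_voidPattern hν hξ hx hU hlam hlam0 hg hs hc r L)
      fun κ => φ (approxTuple e U r L k κ)
  have hclose : ∀ F : X → EReal, IsGood U r L k s F → |φ (argminTuple e k F) -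
      φ (approxTuple e U r L k (voidPattern (cell U r) s L F))| ≤ M * ε := by
    intro F hF
    rw [← Real.dist_eq]
    exact (hM.dist_le_mul _ _).trans (mul_le_mul_of_nonneg_left
      (hF.spec hs he hmesh hε).2.le M.2)
  have hν1 := abs_integral_sub_integral_le hC0 (fun v w => hC v w)
    (hint' (hν.aemeasurable_argminTuple hξ hx hU hlam hlam0 hg he k))
    (hint' (aemeasurable_finset (fun f => voidPattern_subset (cell U r) s L (shiftField g f)) hnm
      (approxTuple e U r L k))) hbad (fun f hf => hclose _ (not_not.1 hf))
    (mul_nonneg M.2 hε.le)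
  filter_upwards [hbadn, Metric.tendsto_nhds.1 hlim (η / 4) (by positivity)] with n hn1 hn2
  have hP1 := abs_integral_sub_integral_le hC0 (fun v w => hC v w)
    (hint (hmeas n))
    (hint (aemeasurable_finset (fun ω => voidPattern_subset (cell U r) s L
      (responseField lam g x ξ n ω)) (hnmn n)
      (approxTuple e U r L k))) hn1 (fun f hf => hclose _ (not_not.1 hf))
    (mul_nonneg M.2 hε.le)
  rw [Real.dist_eq] at hn2 ⊢
  rw [abs_lt] at hn2
  have h1 := abs_le.1 hν1
  have h2 := abs_le.1 hP1
  rw [abs_lt]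
  constructor <;> linarith [h1.1, h1.2, h2.1, h2.2, hn2.1, hn2.2]

end Convergence

theorem measurable_of_factorsThrough {Ω α V : Type*} [MeasurableSpace Ω] [MeasurableSpace α]
    [Countable α] [MeasurableSingletonClass α] [MeasurableSpace V] {R : Ω → α} (hR : Measurable R)
    {f : Ω → V} (h : ∀ ω ω', R ω = R ω' → f ω = f ω') : Measurable f := by
  rcases isEmpty_or_nonempty Ω with hΩ | hΩ
  · exact measurable_of_empty f
  have : f = (fun q => f (Function.invFun R q)) ∘ R := by
    funext ω
    exact h _ _ (Function.invFun_eq ⟨ω, rfl⟩).symm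
  rw [this]
  exact (measurable_of_countable _).comp hR

/-! ### Measurability of the argmins of the response functions -/

section PointFunMeasurable

variable {X : Type*} {x : ℕ → X}

theorem pointFun_le_pointFun_iff (hx : Function.Injective x) {n : ℕ} {v v' : ℕ → ℝ}
    (h : ∀ i < n, ∀ j < n, v i ≤ v j ↔ v' i ≤ v' j) (y z : X) :
    pointFun x n v y ≤ pointFun x n v z ↔ pointFun x n v' y ≤ pointFun x n v' z := by
  by_cases hz : ∃ j < n, x j = z
  · obtain ⟨j, hj, rfl⟩ := hz
    by_cases hy : ∃ i < n, x i = y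
    · obtain ⟨i, hi, rfl⟩ := hy
      simp only [pointFun_apply hx hi, pointFun_apply hx hj, EReal.coe_le_coe_iff]
      exact h i hi j hj
    · push Not at hy
      simp [pointFun_eq_top _ hy, pointFun_apply hx hj]
  · push Not at hz
    simp [pointFun_eq_top _ hz]

theorem argminTuple_congr [MetricSpace X] {V : Type*} [NormedAddCommGroup V] (e : X → V) (k : ℕ)
    {F F' : X → EReal} (h : ∀ y z, F y ≤ F z ↔ F' y ≤ F' z) :
    argminTuple e k F = argminTuple e k F' := by
  funext j
  have hS := kthArgmin_congr h j
  simp only [argminTuple]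
  generalize kthArgmin F j = S at hS
  subst hS
  rfl

/-- The argmins depend only on the pairwise comparisons of the `n` values, and these comparisons
form a measurable map into a finite set. -/
theorem IsUnitRateNoise.measurable_argminTuple [MetricSpace X] {V : Type*} [NormedAddCommGroup V]
    [MeasurableSpace V] {Ω : Type*} [MeasurableSpace Ω] {P : Measure Ω} {ξ : ℕ → Ω → ℝ}
    (hξ : IsUnitRateNoise P ξ) (hx : Function.Injective x) (lam g : X → ℝ) (e : X → V)
    (k n : ℕ) : Measurable fun ω => argminTuple e k (responseField lam g x ξ n ω) := by
  refine measurable_of_factorsThrough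
    (R := fun ω (i j : Fin n) => responseVal lam g x n (fun i => ξ i ω) i ≤
      responseVal lam g x n (fun i => ξ i ω) j) ?_ fun ω ω' h => ?_
  · refine measurable_pi_lambda _ fun i => measurable_pi_lambda _ fun j => ?_
    exact measurableSet_setOfPred.1 (measurableSet_le (((hξ.meas i).const_mul _).add_const _)
      (((hξ.meas j).const_mul _).add_const _))
  · refine argminTuple_congr e k (pointFun_le_pointFun_iff hx fun i hi j hj => ?_)
    exact iff_of_eq (congrFun (congrFun h ⟨i, hi⟩) ⟨j, hj⟩)

end PointFunMeasurable

/-! ### Finite Poisson processes -/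

section PoissonCluster

variable {Z : Type*} [MeasurableSpace Z]

theorem measurableSet_forall_lt_notMem {B : Set Z} (hB : MeasurableSet B) :
    MeasurableSet {p : ℕ × (ℕ → Z) | ∀ i < p.1, p.2 i ∉ B} := by
  have : {p : ℕ × (ℕ → Z) | ∀ i < p.1, p.2 i ∉ B} =
      ⋂ i, ({p | p.1 ≤ i} ∪ {p | p.2 i ∉ B}) := by
    ext p
    simp only [Set.mem_ofPred_eq, Set.mem_iInter, Set.mem_union]
    exact forall_congr' fun i => by rw [← not_lt, imp_iff_not_or]
  rw [this]
  refine MeasurableSet.iInter fun i => MeasurableSet.union ?_ ?_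
  · exact measurableSet_le measurable_fst measurable_const
  · have h : Measurable fun p : ℕ × (ℕ → Z) => p.2 i := (measurable_pi_apply i).comp measurable_snd
    exact h hB.compl

/-- The generating function of the Poisson law, used with `q` the probability that a single random
point misses a set. -/
theorem integral_pow_poissonMeasure (r : NNReal) (q : ℝ) :
    ∫ n, q ^ n ∂poissonMeasure r = Real.exp (-(r * (1 - q))) := by
  rw [integral_poissonMeasure]
  have h : HasSum (fun n : ℕ => Real.exp (-r) * ((r * q) ^ n / n.factorial))
      (Real.exp (-r) * Real.exp (r * q)) := by
    have := NormedSpace.expSeries_div_hasSum_exp ((r : ℝ) * q)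
    rw [← Real.exp_eq_exp_ℝ] at this
    exact this.mul_left _
  have h2 : -((r : ℝ) * (1 - q)) = -r + r * q := by ring
  rw [h2, Real.exp_add, ← h.tsum_eq]
  refine tsum_congr fun n => ?_
  rw [smul_eq_mul, mul_pow]
  ring

/-- A Poisson process with finite intensity measure, as a random number of random points. -/
theorem exists_poissonCluster (κ : Measure Z) [IsFiniteMeasure κ] (hκ : κ ≠ 0) :
    ∃ Q : Measure (ℕ × (ℕ → Z)), IsProbabilityMeasure Q ∧ ∀ B, MeasurableSet B →
      Q {p | ∀ i < p.1, p.2 i ∉ B} = ENNReal.ofReal (Real.exp (-κ.real B)) := by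
  have hne : κ Set.univ ≠ 0 := fun h => hκ (Measure.measure_univ_eq_zero.1 h)
  have : NeZero κ := ⟨hκ⟩
  set κ' : Measure Z := (κ Set.univ)⁻¹ • κ with hκ'
  have hprob : IsProbabilityMeasure κ' := isProbabilityMeasureSMul
  set r : NNReal := (κ Set.univ).toNNReal with hr
  have hrκ : (r : ℝ) = κ.real Set.univ := rfl
  refine ⟨(poissonMeasure r).prod (Measure.infinitePi fun _ : ℕ => κ'), inferInstance,
    fun B hB => ?_⟩
  rw [Measure.prod_apply (measurableSet_forall_lt_notMem hB)]
  -- Given their number `n`, the points are independent with the normalized law `κ'`.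
  have hsec : ∀ n : ℕ, Measure.infinitePi (fun _ : ℕ => κ')
      (Prod.mk n ⁻¹' {p : ℕ × (ℕ → Z) | ∀ i < p.1, p.2 i ∉ B}) =
      ENNReal.ofReal (κ'.real Bᶜ ^ n) := by
    intro n
    have : Prod.mk n ⁻¹' {p : ℕ × (ℕ → Z) | ∀ i < p.1, p.2 i ∉ B} =
        Set.pi (Finset.range n) fun _ => Bᶜ := by
      ext z; simp
    rw [this, Measure.infinitePi_pi _ fun _ _ => hB.compl, Finset.prod_const, Finset.card_range,
      ENNReal.ofReal_pow measureReal_nonneg, ofReal_measureReal]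
  simp only [hsec]
  have hle : κ'.real Bᶜ ≤ 1 := measureReal_le_one
  rw [← ofReal_integral_eq_lintegral_ofReal, integral_pow_poissonMeasure]
  · congr 3
    have h1 : κ'.real Bᶜ = 1 - κ'.real B := probReal_compl_eq_one_sub hB
    have h2 : κ'.real B = (κ.real Set.univ)⁻¹ * κ.real B := by
      simp [hκ', measureReal_def]
    have h3 : κ.real Set.univ ≠ 0 := by
      rw [measureReal_def]
      exact (ENNReal.toReal_ne_zero).2 ⟨hne, measure_ne_top _ _⟩
    rw [hrκ, h1, h2]
    field_simp
    ring
  · refine Integrable.of_bound (Measurable.of_discrete).aestronglyMeasurable 1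
      (Eventually.of_forall fun n => ?_)
    rw [Real.norm_eq_abs, abs_of_nonneg (pow_nonneg measureReal_nonneg n)]
    exact pow_le_one₀ measureReal_nonneg hle
  · exact Eventually.of_forall fun n => pow_nonneg measureReal_nonneg n

end PoissonCluster

/-! ### Lower semicontinuous functions from marked points -/

section MarkedPoints

variable {I X : Type*}

/-- Only finitely many marks lie below `t + 1`. Either there are none, or the infimum is attained
among them; in both cases the strict inequality survives. -/
theorem lt_iInf_iff_of_locallyFinite {τ : I → ℝ} {S : Set I}
    (hS : ∀ t, {i | i ∈ S ∧ τ i ≤ t}.Finite) (t : ℝ) :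
    (t : EReal) < ⨅ i ∈ S, (τ i : EReal) ↔ ∀ i ∈ S, t < τ i := by
  constructor
  · intro h i hi
    exact EReal.coe_lt_coe_iff.1 (h.trans_le (iInf₂_le i hi))
  · intro h
    rcases {i | i ∈ S ∧ τ i ≤ t + 1}.eq_empty_or_nonempty with he | hne
    · refine lt_of_lt_of_le (EReal.coe_lt_coe_iff.2 (lt_add_one t)) (le_iInf₂ fun i hi => ?_)
      refine EReal.coe_le_coe_iff.2 (le_of_not_ge fun hle => ?_)
      exact Set.eq_empty_iff_forall_notMem.1 he i ⟨hi, hle⟩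
    · obtain ⟨i₀, hi₀, hmin⟩ := Set.exists_min_image _ τ (hS (t + 1)) hne
      refine lt_of_lt_of_le (EReal.coe_lt_coe_iff.2 (h i₀ hi₀.1)) (le_iInf₂ fun i hi => ?_)
      refine EReal.coe_le_coe_iff.2 ?_
      rcases le_or_gt (τ i) (t + 1) with hle | hgt
      · exact hmin i ⟨hi, hle⟩
      · exact hi₀.2.trans hgt.le

/-- The function whose value at `y` is the smallest mark `τ i` of the points `Y i = y`, `i ∈ A`. -/
noncomputable def markFun (A : Set I) (Y : I → X) (τ : I → ℝ) (y : X) : EReal :=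
  ⨅ i ∈ {i | i ∈ A ∧ Y i = y}, (τ i : EReal)

variable {A : Set I} {Y : I → X} {τ : I → ℝ}

theorem infOn_markFun (C : Set X) :
    infOn (markFun A Y τ) C = ⨅ i ∈ {i | i ∈ A ∧ Y i ∈ C}, (τ i : EReal) := by
  refine le_antisymm (le_iInf₂ fun i hi => ?_) (le_iInf₂ fun y hy => le_iInf₂ fun i hi => ?_)
  · exact (iInf₂_le (Y i) hi.2).trans (iInf₂_le i ⟨hi.1, rfl⟩)
  · refine iInf₂_le i ⟨hi.1, ?_⟩
    rw [hi.2]; exact hy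

theorem lt_infOn_markFun_iff (hA : ∀ t, {i | i ∈ A ∧ τ i ≤ t}.Finite) (C : Set X) (t : ℝ) :
    (t : EReal) < infOn (markFun A Y τ) C ↔ ∀ i ∈ A, Y i ∈ C → t < τ i := by
  rw [infOn_markFun, lt_iInf_iff_of_locallyFinite fun t => (hA t).subset fun i hi =>
    ⟨hi.1.1, hi.2⟩]
  exact ⟨fun h i hi hC => h i ⟨hi, hC⟩, fun h i hi => h i hi.1 hi.2⟩

theorem markFun_nonneg (hτ : ∀ i, 0 ≤ τ i) (y : X) : 0 ≤ markFun A Y τ y :=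
  le_iInf₂ fun i _ => by exact_mod_cast hτ i

/-- Sublevel sets at real levels are finite, hence closed. -/
theorem lowerSemicontinuous_markFun [TopologicalSpace X] [T1Space X]
    (hA : ∀ t, {i | i ∈ A ∧ τ i ≤ t}.Finite) (hτ : ∀ i, 0 ≤ τ i) :
    LowerSemicontinuous (markFun A Y τ) := by
  rw [lowerSemicontinuous_iff_isClosed_preimage]
  intro t
  induction t with
  | bot =>
    convert isClosed_empty
    refine Set.eq_empty_of_forall_notMem fun y hy => ?_
    exact (EReal.bot_lt_zero.trans_le (markFun_nonneg hτ y)).not_ge hy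
  | top =>
    convert isClosed_univ
    exact Set.eq_univ_of_forall fun y => (le_top : markFun A Y τ y ≤ ⊤)
  | coe t =>
    have : markFun A Y τ ⁻¹' Set.Iic (t : EReal) = Y '' {i | i ∈ A ∧ τ i ≤ t} := by
      ext y
      have h := lt_iInf_iff_of_locallyFinite (τ := τ) (S := {i | i ∈ A ∧ Y i = y})
        (fun t => (hA t).subset fun i hi => ⟨hi.1.1, hi.2⟩) t
      rw [Set.mem_preimage, Set.mem_Iic, ← not_lt, markFun, h]
      simp only [Set.mem_ofPred_eq, Set.mem_image]
      push Not
      constructor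
      · rintro ⟨i, ⟨h1, h2⟩, h3⟩
        exact ⟨i, ⟨h1, h3⟩, h2⟩
      · rintro ⟨i, ⟨h1, h3⟩, h2⟩
        exact ⟨i, ⟨h1, h2⟩, h3⟩
    rw [this]
    exact ((hA t).image Y).isClosed

end MarkedPoints

/-- The half-line above `⊥` is a countable union of half-lines with real endpoints. Events comparing
minima with real levels therefore suffice to test independence. -/
theorem EReal.borel_eq_generateFrom_Ioi_coe :
    borel EReal = MeasurableSpace.generateFrom (Set.range fun t : ℝ => Set.Ioi (t : EReal)) := by
  refine le_antisymm ?_ (MeasurableSpace.generateFrom_le ?_)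
  · rw [borel_eq_generateFrom_Ioi]
    refine MeasurableSpace.generateFrom_le ?_
    rintro _ ⟨a, rfl⟩
    induction a with
    | bot =>
      have : Set.Ioi (⊥ : EReal) = ⋃ n : ℕ, Set.Ioi (((-(n : ℝ) : ℝ)) : EReal) := by
        ext y
        simp only [Set.mem_Ioi, Set.mem_iUnion]
        constructor
        · intro hy
          obtain ⟨r, hr⟩ := EReal.lt_iff_exists_real_btwn.1 hy
          obtain ⟨n, hn⟩ := exists_nat_gt (-r)
          exact ⟨n, (EReal.coe_lt_coe_iff.2 (by linarith)).trans hr.2⟩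
        · rintro ⟨n, hn⟩
          exact (EReal.bot_lt_coe _).trans hn
      rw [this]
      exact @MeasurableSet.iUnion _ _ (_) _ _ fun n =>
        MeasurableSpace.measurableSet_generateFrom ⟨_, rfl⟩
    | top =>
      rw [Set.Ioi_top]
      exact @MeasurableSet.empty _ (_)
    | coe t => exact MeasurableSpace.measurableSet_generateFrom ⟨t, rfl⟩
  · rintro _ ⟨t, rfl⟩
    exact measurableSet_Ioi

/-! ### The Poisson process in space-time, slab by slab -/

section Slabs

variable {X : Type*}

/-- The points of a sequence of point clusters, the `k`-th one with marks at least `k`, as a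
function with the marks as values. -/
noncomputable def slabFun (ω : ℕ → ℕ × (ℕ → X × ℝ)) : X → EReal :=
  markFun {p : ℕ × ℕ | p.2 < (ω p.1).1} (fun p => ((ω p.1).2 p.2).1)
    fun p => max ((ω p.1).2 p.2).2 p.1

/-- Taking the maximum of each mark with its slab index makes this hold for every `ω`, without an
exceptional null set: only slabs of index at most `t` contribute, each with finitely many points. -/
theorem finite_slab_marks_le (ω : ℕ → ℕ × (ℕ → X × ℝ)) (t : ℝ) :
    {p : ℕ × ℕ | p ∈ {p : ℕ × ℕ | p.2 < (ω p.1).1} ∧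
      max ((ω p.1).2 p.2).2 (p.1 : ℝ) ≤ t}.Finite := by
  obtain ⟨R, hR⟩ := exists_nat_gt t
  refine ((Set.finite_lt_nat R).biUnion fun k _ =>
    (Set.finite_lt_nat (ω k).1).image fun i => (k, i)).subset ?_
  rintro ⟨k, i⟩ ⟨hi, ht⟩
  have hk : k < R := by
    have : (k : ℝ) < R := ((le_max_right _ _).trans ht).trans_lt hR
    exact_mod_cast this
  exact Set.mem_biUnion (show k ∈ {k | k < R} from hk) ⟨i, hi, rfl⟩

theorem slab_marks_nonneg (ω : ℕ → ℕ × (ℕ → X × ℝ)) (p : ℕ × ℕ) :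
    0 ≤ max ((ω p.1).2 p.2).2 (p.1 : ℝ) :=
  (Nat.cast_nonneg _).trans (le_max_right _ _)

/-- The part of the `k`-th slab over `C` with marks at most `t`. -/
def slabBelow (C : Set X) (t : ℝ) (k : ℕ) : Set (X × ℝ) :=
  C ×ˢ {T | max T (k : ℝ) ≤ t}

theorem lt_infOn_slabFun_iff (ω : ℕ → ℕ × (ℕ → X × ℝ)) (C : Set X) (t : ℝ) :
    (t : EReal) < infOn (slabFun ω) C ↔
      ∀ k, ∀ i < (ω k).1, (ω k).2 i ∉ slabBelow C t k := by
  rw [slabFun, lt_infOn_markFun_iff (finite_slab_marks_le ω)]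
  constructor
  · intro h k i hi hmem
    exact (h (k, i) hi hmem.1).not_ge hmem.2
  · rintro h ⟨k, i⟩ hi hC
    exact lt_of_not_ge fun hle => h k i hi ⟨hC, hle⟩

theorem slabBelow_eq_empty {C : Set X} {t : ℝ} {k : ℕ} (h : t < k) : slabBelow C t k = ∅ :=
  Set.eq_empty_of_forall_notMem fun _ hz => ((le_max_right _ _).trans hz.2).not_gt h

/-- The length is written as an increment in `k` so that the sum over slabs telescopes. -/
theorem measureReal_slab_interval (t : ℝ) (k : ℕ) :
    (volume.restrict (Set.Ioc (k : ℝ) (k + 1))).real {T | max T (k : ℝ) ≤ t} =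
      min ((k + 1 : ℕ) : ℝ) (max t 0) - min (k : ℝ) (max t 0) := by
  have hm : MeasurableSet {T : ℝ | max T (k : ℝ) ≤ t} :=
    measurableSet_le (measurable_id.max measurable_const) measurable_const
  rw [measureReal_restrict_apply hm]
  have : {T : ℝ | max T (k : ℝ) ≤ t} ∩ Set.Ioc (k : ℝ) (k + 1) =
      Set.Ioc (k : ℝ) (min (k + 1) t) := by
    ext T
    constructor
    · rintro ⟨h1, h2⟩
      exact ⟨h2.1, le_min h2.2 ((le_max_left _ _).trans h1)⟩
    · rintro ⟨h1, h2⟩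
      have h3 := h2.trans (min_le_right _ _)
      exact ⟨max_le h3 (h1.le.trans h3), h1, h2.trans (min_le_left _ _)⟩
  rw [this, Real.volume_real_Ioc]
  have hk : (0 : ℝ) ≤ k := Nat.cast_nonneg k
  push_cast
  rcases le_or_gt t k with h | h
  · rw [min_eq_right (by linarith : t ≤ k + 1), max_eq_right (by linarith : t - k ≤ 0),
      min_eq_right (max_le (by linarith) (by linarith)), min_eq_right (max_le h hk), sub_self]
  · rw [max_eq_left (by linarith : (0 : ℝ) ≤ t), min_eq_left h.le, max_eq_left]
    rw [sub_nonneg]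
    exact le_min (by linarith) h.le

variable [MeasurableSpace X]

theorem measurableSet_slabBelow {C : Set X} (hC : MeasurableSet C) (t : ℝ) (k : ℕ) :
    MeasurableSet (slabBelow C t k) :=
  hC.prod (measurableSet_le (measurable_id.max measurable_const) measurable_const)

theorem measureReal_biUnion_slabBelow (M : Measure X) [IsFiniteMeasure M] {ι : Type*}
    {C : ι → Set X} (hC : ∀ j, MeasurableSet (C j)) (hd : ∀ i j, i ≠ j → Disjoint (C i) (C j))
    (t : ι → ℝ) (S : Finset ι) (k : ℕ) :
    (M.prod (volume.restrict (Set.Ioc (k : ℝ) (k + 1)))).real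
        (⋃ j ∈ S, slabBelow (C j) (t j) k) =
      ∑ j ∈ S, M.real (C j) *
        (min ((k + 1 : ℕ) : ℝ) (max (t j) 0) - min (k : ℝ) (max (t j) 0)) := by
  rw [measureReal_biUnion_finset]
  · refine Finset.sum_congr rfl fun j _ => ?_
    rw [slabBelow, measureReal_prod_prod, measureReal_slab_interval]
  · intro i _ j _ hij
    exact Set.Disjoint.set_prod_left (hd i j hij) _ _
  · exact fun j _ => measurableSet_slabBelow (hC j) _ _

/-- The slabs are independent, and in each of them the event is the avoidance of a disjoint union of
product sets. The exponents telescope over the slabs to `M(C j) max(t j, 0)`. -/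
theorem measure_forall_lt_infOn_slabFun (M : Measure X) [IsFiniteMeasure M]
    {Q : ℕ → Measure (ℕ × (ℕ → X × ℝ))} [∀ k, IsProbabilityMeasure (Q k)]
    (hQ : ∀ (k : ℕ) (B : Set (X × ℝ)), MeasurableSet B → Q k {p | ∀ i < p.1, p.2 i ∉ B} =
      ENNReal.ofReal (Real.exp
        (-(M.prod (volume.restrict (Set.Ioc (k : ℝ) (k + 1)))).real B)))
    {ι : Type*} {C : ι → Set X} (hC : ∀ j, MeasurableSet (C j))
    (hd : ∀ i j, i ≠ j → Disjoint (C i) (C j)) (t : ι → ℝ) (S : Finset ι) :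
    Measure.infinitePi Q {ω | ∀ j ∈ S, (t j : EReal) < infOn (slabFun ω) (C j)} =
      ∏ j ∈ S, ENNReal.ofReal (Real.exp (-(M.real (C j) * max (t j) 0))) := by
  -- Slabs beyond all thresholds impose nothing, so only finitely many coordinates matter.
  obtain ⟨R, hR⟩ : ∃ R : ℕ, ∀ j ∈ S, max (t j) 0 < R := by
    obtain ⟨b, hb⟩ := (S.finite_toSet.image fun j => max (t j) 0).bddAbove
    obtain ⟨R, hR⟩ := exists_nat_gt b
    exact ⟨R, fun j hj => (hb ⟨j, hj, rfl⟩).trans_lt hR⟩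
  have hset : {ω | ∀ j ∈ S, (t j : EReal) < infOn (slabFun ω) (C j)} =
      Set.pi (Finset.range R) fun k =>
        {p : ℕ × (ℕ → X × ℝ) | ∀ i < p.1, p.2 i ∉ ⋃ j ∈ S, slabBelow (C j) (t j) k} := by
    ext ω
    simp only [lt_infOn_slabFun_iff, Set.mem_pi, Set.mem_ofPred_eq, Set.mem_iUnion, not_exists]
    constructor
    · intro h k _ i hi j hj
      exact h j hj k i hi
    · intro h j hj k i hi
      by_cases hk : k < R
      · exact h k (by simpa using hk) i hi j hj
      · have h1 : t j < k := by
          have h2 : (R : ℝ) ≤ k := by exact_mod_cast not_lt.1 hk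
          exact ((le_max_left _ _).trans_lt (hR j hj)).trans_le h2
        rw [slabBelow_eq_empty h1]
        exact Set.notMem_empty _
  have hB : ∀ k, MeasurableSet (⋃ j ∈ S, slabBelow (C j) (t j) k) := fun k =>
    S.measurableSet_biUnion fun j _ => measurableSet_slabBelow (hC j) _ _
  rw [hset, Measure.infinitePi_pi _ fun k _ => measurableSet_forall_lt_notMem (hB k)]
  simp only [hQ _ _ (hB _), measureReal_biUnion_slabBelow M hC hd]
  rw [← ENNReal.ofReal_prod_of_nonneg fun _ _ => (Real.exp_pos _).le,
    ← ENNReal.ofReal_prod_of_nonneg fun _ _ => (Real.exp_pos _).le,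
    ← Real.exp_sum, ← Real.exp_sum, Finset.sum_neg_distrib, Finset.sum_neg_distrib,
    Finset.sum_comm]
  congr 3
  refine Finset.sum_congr rfl fun j hj => ?_
  rw [← Finset.mul_sum, Finset.sum_range_sub fun k : ℕ => min (k : ℝ) (max (t j) 0),
    min_eq_right (hR j hj).le]
  simp

end Slabs

/-! ### Existence of the extreme value process -/

section Existence

variable {X : Type*} [MetricSpace X] [CompactSpace X] [MeasurableSpace X] [BorelSpace X]

/-- `slabFun` as an element of `𝒮(X)`. -/
noncomputable def slabLSCFun (ω : ℕ → ℕ × (ℕ → X × ℝ)) : LSCFun X :=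
  ⟨slabFun ω, lowerSemicontinuous_markFun (finite_slab_marks_le ω) (slab_marks_nonneg ω),
    fun y => (EReal.bot_lt_zero.trans_le (markFun_nonneg (slab_marks_nonneg ω) y)).ne'⟩

theorem measurable_slabLSCFun : Measurable (slabLSCFun (X := X)) := by
  refine measurable_generateFrom ?_
  rintro _ ⟨K, t, hK, rfl⟩
  have : slabLSCFun ⁻¹' {f : LSCFun X | (t : EReal) < infOn f.1 K} =
      ⋂ k, (fun ω : ℕ → ℕ × (ℕ → X × ℝ) => ω k) ⁻¹'
        {p | ∀ i < p.1, p.2 i ∉ slabBelow K t k} := by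
    ext ω
    simp only [Set.mem_iInter]
    exact lt_infOn_slabFun_iff ω K t
  rw [this]
  exact MeasurableSet.iInter fun k => measurable_pi_apply k
    (measurableSet_forall_lt_notMem (measurableSet_slabBelow hK.isClosed.measurableSet t k))

/-- The events that a minimum exceeds a real level form a generating π-system: the intersection of
two of them is the event for the larger level. -/
theorem iIndepFun_infOn_of_forall_lt {ν : Measure (LSCFun X)} {ι : Type*} {C : ι → Set X}
    (hC : ∀ i, IsClosed (C i))
    (h : ∀ (t : ι → ℝ) (S : Finset ι), ν {f | ∀ j ∈ S, (t j : EReal) < infOn f.1 (C j)} =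
      ∏ j ∈ S, ν {f | (t j : EReal) < infOn f.1 (C j)}) :
    iIndepFun (fun (i : ι) (f : LSCFun X) => infOn f.1 (C i)) ν := by
  refine iIndepSets.iIndep (m := fun i => MeasurableSpace.comap
      (fun f : LSCFun X => infOn f.1 (C i)) inferInstance) ?_
    (fun i => Set.range fun t : ℝ => {f : LSCFun X | (t : EReal) < infOn f.1 (C i)}) ?_ ?_ ?_
  · intro i
    rw [BorelSpace.measurable_eq (α := EReal), EReal.borel_eq_generateFrom_Ioi_coe,
      MeasurableSpace.comap_generateFrom]
    refine MeasurableSpace.generateFrom_le ?_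
    rintro _ ⟨_, ⟨t, rfl⟩, rfl⟩
    exact measurableSet_lt_infOn (hC i) t
  · rintro i _ ⟨s, rfl⟩ _ ⟨t, rfl⟩ _
    refine ⟨max s t, ?_⟩
    ext f
    have : ((max s t : ℝ) : EReal) = max (s : EReal) t := EReal.coe_strictMono.monotone.map_max
    simp only [Set.mem_ofPred_eq, Set.mem_inter_iff, this, max_lt_iff]
  · intro i
    rw [BorelSpace.measurable_eq (α := EReal), EReal.borel_eq_generateFrom_Ioi_coe,
      MeasurableSpace.comap_generateFrom, ← Set.range_comp]
    rfl
  · rw [iIndepSets_iff]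
    intro S F hF
    choose! t ht using hF
    have h1 : ⋂ i ∈ S, F i = {f | ∀ j ∈ S, (t j : EReal) < infOn f.1 (C j)} := by
      ext f
      simp only [Set.mem_iInter, Set.mem_ofPred_eq]
      refine forall₂_congr fun j hj => ?_
      rw [← ht j hj]
      rfl
    rw [h1, h t S]
    exact Finset.prod_congr rfl fun j hj => by rw [← ht j hj]

/-- The extreme value process exists: it is a Poisson process on `X × [0, ∞)` with intensity
`lam dm × dt`. -/
theorem exists_isExtremeLaw (m : Measure X) [IsProbabilityMeasure m] {lam : X → ℝ}
    (hlam : Continuous lam) (hlam0 : ∀ y, 0 < lam y) :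
    ∃ ν : Measure (LSCFun X), IsProbabilityMeasure ν ∧ IsExtremeLaw lam m ν := by
  have hint : Integrable lam m := hlam.integrable_of_hasCompactSupport
    (HasCompactSupport.of_compactSpace lam)
  set M : Measure X := m.withDensity fun y => ENNReal.ofReal (lam y) with hM
  have hMfin : IsFiniteMeasure M := isFiniteMeasure_withDensity_ofReal hint.2
  have hMC : ∀ C, MeasurableSet C → M.real C = ∫ y in C, lam y ∂m := by
    intro C hC
    rw [measureReal_def, hM, withDensity_apply _ hC,
      ← ofReal_integral_eq_lintegral_ofReal hint.integrableOn
        (Eventually.of_forall fun y => (hlam0 y).le),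
      ENNReal.toReal_ofReal (integral_nonneg fun y => (hlam0 y).le)]
  -- The cluster construction normalizes the intensity, so each slab must have positive mass.
  have hM0 : M ≠ 0 := by
    intro h0
    rw [hM, withDensity_eq_zero_iff (by fun_prop)] at h0
    have : ∀ᵐ y ∂m, False := by
      filter_upwards [h0] with y hy
      exact (ENNReal.ofReal_pos.2 (hlam0 y)).ne' hy
    exact IsProbabilityMeasure.ne_zero m (ae_eq_bot.1 (eventually_false_iff_eq_bot.1 this))
  have hκ0 : ∀ k : ℕ, M.prod (volume.restrict (Set.Ioc (k : ℝ) (k + 1))) ≠ 0 := by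
    intro k h
    have h1 := congrArg (fun κ : Measure (X × ℝ) => κ Set.univ) h
    simp only [Measure.coe_zero, Pi.zero_apply] at h1
    rw [← Set.univ_prod_univ, Measure.prod_prod, Measure.restrict_apply_univ, Real.volume_Ioc,
      mul_eq_zero] at h1
    rcases h1 with h1 | h1
    · exact hM0 (Measure.measure_univ_eq_zero.1 h1)
    · simp at h1
  choose Q hQp hQ using fun k : ℕ =>
    exists_poissonCluster (M.prod (volume.restrict (Set.Ioc (k : ℝ) (k + 1)))) (hκ0 k)
  have hjoint : ∀ {ι : Type} (C : ι → Set X), (∀ i, IsClosed (C i)) →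
      (∀ i j, i ≠ j → Disjoint (C i) (C j)) → ∀ (t : ι → ℝ) (S : Finset ι),
      (Measure.infinitePi Q).map slabLSCFun {f | ∀ j ∈ S, (t j : EReal) < infOn f.1 (C j)} =
        ∏ j ∈ S, ENNReal.ofReal (Real.exp (-((∫ y in C j, lam y ∂m) * max (t j) 0))) := by
    intro ι C hC hd t S
    have hmeas : MeasurableSet {f : LSCFun X | ∀ j ∈ S, (t j : EReal) < infOn f.1 (C j)} := by
      have : {f : LSCFun X | ∀ j ∈ S, (t j : EReal) < infOn f.1 (C j)} =
          ⋂ j ∈ S, {f : LSCFun X | (t j : EReal) < infOn f.1 (C j)} := by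
        ext f; simp
      rw [this]
      exact S.measurableSet_biInter fun j _ => measurableSet_lt_infOn (hC j) _
    rw [Measure.map_apply measurable_slabLSCFun hmeas]
    refine (measure_forall_lt_infOn_slabFun M hQ (fun j => (hC j).measurableSet) hd t S).trans ?_
    exact Finset.prod_congr rfl fun j _ => by rw [hMC _ (hC j).measurableSet]
  have hone : ∀ C, IsClosed C → ∀ t : ℝ,
      (Measure.infinitePi Q).map slabLSCFun {f | (t : EReal) < infOn f.1 C} =
        ENNReal.ofReal (Real.exp (-((∫ y in C, lam y ∂m) * max t 0))) := by
    intro C hC t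
    have := hjoint (fun _ : Unit => C) (fun _ => hC) (fun i j hij => (hij rfl).elim)
      (fun _ => t) {()}
    simpa using this
  refine ⟨(Measure.infinitePi Q).map slabLSCFun,
    Measure.isProbabilityMeasure_map measurable_slabLSCFun.aemeasurable, ⟨?_, ?_⟩⟩
  · intro C hC t ht
    rw [hone C hC t, max_eq_left ht]
  · intro n C hC hd
    refine iIndepFun_infOn_of_forall_lt hC fun t S => ?_
    rw [hjoint C hC hd t S]
    exact Finset.prod_congr rfl fun j _ => (hone (C j) (hC j) (t j)).symm

end Existence

/-! ### Transfer to the closed domain -/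

section ClosureMeasure

variable {d : ℕ} {D : Set (EuclideanSpace ℝ (Fin d))} {ρ : EuclideanSpace ℝ (Fin d) → ℝ}

/-- The measure `ρ(y) dy` on `D`, as a measure on `closure D`. -/
noncomputable def closureMeasure (D : Set (EuclideanSpace ℝ (Fin d)))
    (ρ : EuclideanSpace ℝ (Fin d) → ℝ) : Measure (closure D) :=
  ((volume.restrict D).withDensity fun y => ENNReal.ofReal (ρ y)).comap Subtype.val

theorem measurableEmbedding_closure :
    MeasurableEmbedding (Subtype.val : closure D → EuclideanSpace ℝ (Fin d)) :=
  MeasurableEmbedding.subtype_coe isClosed_closure.measurableSet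

theorem closureMeasure_apply (s : Set (closure D)) : closureMeasure D ρ s =
    (volume.restrict D).withDensity (fun y => ENNReal.ofReal (ρ y)) (Subtype.val '' s) :=
  measurableEmbedding_closure.comap_apply _ _

theorem isProbabilityMeasure_closureMeasure (hDo : IsOpen D) (hρ_nonneg : ∀ y ∈ D, 0 ≤ ρ y)
    (hρ_int : IntegrableOn ρ D) (hρ_one : ∫ y in D, ρ y = 1) :
    IsProbabilityMeasure (closureMeasure D ρ) := by
  constructor
  rw [closureMeasure_apply, Set.image_univ, Subtype.range_coe,
    withDensity_apply _ isClosed_closure.measurableSet,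
    Measure.restrict_restrict isClosed_closure.measurableSet,
    Set.inter_eq_right.2 subset_closure, ← ofReal_integral_eq_lintegral_ofReal hρ_int
      ((ae_restrict_iff' hDo.measurableSet).2 (Eventually.of_forall hρ_nonneg)), hρ_one,
    ENNReal.ofReal_one]

theorem nullSingletonClass_closureMeasure [Nontrivial (EuclideanSpace ℝ (Fin d))] :
    NullSingletonClass (closureMeasure D ρ) := by
  constructor
  intro y
  rw [closureMeasure_apply, Set.image_singleton]
  exact (withDensity_absolutelyContinuous _ _).trans Measure.absolutelyContinuous_restrict
    (measure_singleton _)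

theorem setIntegral_closureMeasure (hDo : IsOpen D) (hρ_nonneg : ∀ y ∈ D, 0 ≤ ρ y)
    (hρ_int : IntegrableOn ρ D) (φ : EuclideanSpace ℝ (Fin d) → ℝ) {C : Set (closure D)}
    (hC : MeasurableSet C) : ∫ y in C, φ y ∂closureMeasure D ρ =
      ∫ y in Subtype.val '' C, D.indicator (fun y => φ y * ρ y) y := by
  have hs : MeasurableSet (Subtype.val '' C : Set (EuclideanSpace ℝ (Fin d))) :=
    measurableEmbedding_closure.measurableSet_image.2 hC
  have h1 := measurableEmbedding_closure.setIntegral_map (μ := closureMeasure D ρ) φ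
    (Subtype.val '' C)
  rw [Set.preimage_image_eq _ Subtype.val_injective] at h1
  rw [← h1, closureMeasure, measurableEmbedding_closure.map_comap, Subtype.range_coe,
    Measure.restrict_restrict hs,
    Set.inter_eq_left.2 (by rintro _ ⟨y, _, rfl⟩; exact y.2),
    setIntegral_withDensity_eq_setIntegral_toReal_smul₀
      (hρ_int.aestronglyMeasurable.aemeasurable.ennreal_ofReal.mono_measure
        Measure.restrict_le_self)
      (Eventually.of_forall fun _ => ENNReal.ofReal_lt_top) _ hs,
    setIntegral_indicator hDo.measurableSet, Measure.restrict_restrict hs]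
  refine setIntegral_congr_fun (hs.inter hDo.measurableSet) fun y hy => ?_
  simp only [ENNReal.toReal_ofReal (hρ_nonneg y hy.2), smul_eq_mul, mul_comm]

theorem integral_closureMeasure (hDo : IsOpen D) (hρ_nonneg : ∀ y ∈ D, 0 ≤ ρ y)
    (hρ_int : IntegrableOn ρ D) (φ : EuclideanSpace ℝ (Fin d) → ℝ) :
    ∫ y, φ y ∂closureMeasure D ρ = ∫ y in D, φ y * ρ y := by
  have h := setIntegral_closureMeasure hDo hρ_nonneg hρ_int φ MeasurableSet.univ
  rwa [setIntegral_univ, Set.image_univ, Subtype.range_coe, setIntegral_indicator hDo.measurableSet,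
    Set.inter_eq_right.2 subset_closure] at h

/-- A continuous function on the compact closure extends to a bounded continuous function on the
whole space by Tietze's theorem. -/
theorem isEquidistributed_closureMeasure (hDo : IsOpen D) (hDb : Bornology.IsBounded D)
    (hρ_nonneg : ∀ y ∈ D, 0 ≤ ρ y) (hρ_int : IntegrableOn ρ D)
    {x : ℕ → EuclideanSpace ℝ (Fin d)} (hxD : ∀ i, x i ∈ D) (hx : Function.Injective x)
    (hx_conv : ∀ φ : BoundedContinuousFunction (EuclideanSpace ℝ (Fin d)) ℝ,
      Tendsto (fun n : ℕ => (1 / (n : ℝ)) * ∑ i ∈ Finset.range n, φ (x i)) atTop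
        (𝓝 (∫ y in D, φ y * ρ y))) :
    IsEquidistributed (fun i => (⟨x i, subset_closure (hxD i)⟩ : closure D))
      (closureMeasure D ρ) := by
  have : CompactSpace (closure D) := isCompact_iff_compactSpace.1 hDb.isCompact_closure
  refine ⟨fun i j hij => hx (congrArg Subtype.val hij), fun φ hφ => ?_⟩
  obtain ⟨Φ, -, hΦ⟩ := BoundedContinuousFunction.exists_extension_norm_eq_of_isClosedEmbedding
    (BoundedContinuousFunction.mkOfCompact ⟨φ, hφ⟩)
    (isClosed_closure (s := D)).isClosedEmbedding_subtypeVal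
  have hval : ∀ y : closure D, φ y = Φ y := fun y => (congrFun hΦ y).symm
  simp only [hval, integral_closureMeasure hDo hρ_nonneg hρ_int Φ]
  exact hx_conv Φ

/-- The density `ρ` is absorbed into the reference measure. What remains as intensity is `lam`,
which in the application is continuous and positive on a compact space, whereas `ρ` may vanish or be
unbounded near the boundary. -/
theorem isExtremeValueLaw_iff (hDo : IsOpen D) (hDb : Bornology.IsBounded D)
    (hρ_nonneg : ∀ y ∈ D, 0 ≤ ρ y) (hρ_int : IntegrableOn ρ D)
    (lam : EuclideanSpace ℝ (Fin d) → ℝ) (ν : Measure (LSCFun (closure D))) :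
    haveI : CompactSpace (closure D) := isCompact_iff_compactSpace.1 hDb.isCompact_closure
    IsExtremeValueLaw D (D.indicator fun y => lam y * ρ y) ν ↔
      IsProbabilityMeasure ν ∧
        IsExtremeLaw (fun y : closure D => lam y) (closureMeasure D ρ) ν := by
  have hC : ∀ C : Set (closure D), IsClosed C → _ := fun C hC =>
    setIntegral_closureMeasure hDo hρ_nonneg hρ_int lam hC.measurableSet
  constructor
  · intro h
    exact ⟨h.isProbabilityMeasure, fun C hCc t ht => by
      rw [hC C hCc]; exact h.exponential C hCc t ht, h.indep⟩
  · rintro ⟨h1, h2⟩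
    exact ⟨h1, fun C hCc t ht => by
      rw [← hC C hCc]; exact h2.exponential C hCc t ht, h2.indep⟩

theorem responseFun_eq_pointFun {x : ℕ → EuclideanSpace ℝ (Fin d)} (hxD : ∀ i, x i ∈ D)
    (lam g : EuclideanSpace ℝ (Fin d) → ℝ) (n : ℕ) (z : ℕ → ℝ) :
    responseFun D lam g x n z =
      pointFun (fun i => (⟨x i, subset_closure (hxD i)⟩ : closure D)) n
        (responseVal (fun y : closure D => lam y) (fun y : closure D => g y)
          (fun i => ⟨x i, subset_closure (hxD i)⟩) n z) := by
  funext y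
  simp only [responseFun, pointFun, Subtype.ext_iff, responseVal]

end ClosureMeasure

/-! ### Weak convergence and the theorem -/

section Distribution

variable {Ω : Type*} [MeasurableSpace Ω] {P : Measure Ω} [IsProbabilityMeasure P]
  {ξ : ℕ → Ω → ℝ} {X : Type*} [MetricSpace X] [CompactSpace X] [MeasurableSpace X] [BorelSpace X]
  {U : ℕ → Set X} {m : Measure X} [IsProbabilityMeasure m] {x : ℕ → X} {lam g : X → ℝ}
  {ν : Measure (LSCFun X)} [IsProbabilityMeasure ν]
  {V : Type*} [NormedAddCommGroup V] [MeasurableSpace V] [BorelSpace V]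
  [SecondCountableTopology V] {e : X → V}

/-- Bounded Lipschitz functions suffice to test weak convergence. -/
theorem tendstoInDistribution_argminTuple [NullSingletonClass m] (hν : IsExtremeLaw lam m ν)
    (hξ : IsUnitRateNoise P ξ) (hx : IsEquidistributed x m)
    (hU : IsFineBasis U m) (hlam : Continuous lam) (hlam0 : ∀ y, 0 < lam y) (hg : Continuous g)
    (he : ∀ y z, dist (e y) (e z) ≤ dist y z) (k : ℕ) :
    TendstoInDistribution (fun n ω => argminTuple e k (responseField lam g x ξ n ω)) atTop
      (fun f => argminTuple e k (shiftField g f)) (fun _ => P) ν := by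
  have h1 : ∀ n, AEMeasurable (fun ω => argminTuple e k (responseField lam g x ξ n ω)) P :=
    fun n => (hξ.measurable_argminTuple hx.inj lam g e k n).aemeasurable
  have h2 := hν.aemeasurable_argminTuple hξ hx hU hlam hlam0 hg he k
  refine ⟨h1, h2, tendsto_iff_forall_lipschitz_integral_tendsto.2 ?_⟩
  rintro φ ⟨C, hC⟩ ⟨M, hM⟩
  have hφ := hM.continuous
  simp only [ProbabilityMeasure.coe_mk]
  rw [integral_map h2 hφ.aestronglyMeasurable]
  simp only [integral_map (h1 _) hφ.aestronglyMeasurable]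
  exact tendsto_integral_argminTuple hν hξ hx hU hlam hlam0 hg he k h1 hC hM

end Distribution

theorem theorem2 {d : ℕ} (D : Set (EuclideanSpace ℝ (Fin d)))
    (hDo : IsOpen D) (hDc : IsConnected D) (hDb : Bornology.IsBounded D)
    (lam g ρ : EuclideanSpace ℝ (Fin d) → ℝ)
    (hlam : ContinuousOn lam (closure D)) (hlam_pos : ∀ y ∈ closure D, 0 < lam y)
    (hg : ContinuousOn g (closure D))
    (hρ : ContinuousOn ρ D) (hρ_nonneg : ∀ y ∈ D, 0 ≤ ρ y)
    (hρ_int : IntegrableOn ρ D) (hρ_one : ∫ y in D, ρ y = 1)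
    (x : ℕ → EuclideanSpace ℝ (Fin d)) (hxD : ∀ i, x i ∈ D) (hx : Function.Injective x)
    (hx_conv : ∀ φ : BoundedContinuousFunction (EuclideanSpace ℝ (Fin d)) ℝ,
      Tendsto (fun n : ℕ => (1 / (n : ℝ)) * ∑ i ∈ Finset.range n, φ (x i)) atTop
        (𝓝 (∫ y in D, φ y * ρ y)))
    {Ω : Type*} [MeasurableSpace Ω] (P : Measure Ω) [IsProbabilityMeasure P]
    (ξ : ℕ → Ω → ℝ) (hξ_meas : ∀ i, Measurable (ξ i))
    (hξ_nonneg : ∀ i, ∀ᵐ ω ∂P, 0 ≤ ξ i ω) (hξ_indep : iIndepFun ξ P)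
    (hξ_cdf : ∃ A δ : ℝ, 0 < δ ∧ ∀ i, ∀ t : ℝ, 0 ≤ t → t ≤ δ →
      |P.real {ω | ξ i ω ≤ t} - t| ≤ A * t ^ 2) :
    (∃ ν : Measure (LSCFun (closure D)),
      IsExtremeValueLaw D (D.indicator fun y => lam y * ρ y) ν) ∧
    ∀ (ν : Measure (LSCFun (closure D))) [IsProbabilityMeasure ν],
      IsExtremeValueLaw D (D.indicator fun y => lam y * ρ y) ν → ∀ k : ℕ,
        (∀ᵐ f ∂ν, ∀ j < k, ∃ y, kthArgmin (addReal f g) j = {y}) ∧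
        Tendsto (fun n : ℕ => P {ω | ∀ j < k, ∃ y,
          kthArgmin (responseFun D lam g x n fun i => ξ i ω) j = {y}}) atTop (𝓝 1) ∧
        TendstoInDistribution
          (fun (n : ℕ) (ω : Ω) => firstArgmins k (responseFun D lam g x n fun i => ξ i ω))
          atTop
          (fun f : LSCFun (closure D) => firstArgmins k (addReal f g))
          (fun _ => P) ν := by
  -- Two distinct points exclude dimension zero, so that singletons are Lebesgue null.
  have : Nontrivial (EuclideanSpace ℝ (Fin d)) := ⟨x 0, x 1, hx.ne zero_ne_one⟩
  have : CompactSpace (closure D) := isCompact_iff_compactSpace.1 hDb.isCompact_closure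
  have : Nonempty (closure D) := ⟨⟨x 0, subset_closure (hxD 0)⟩⟩
  have := isProbabilityMeasure_closureMeasure hDo hρ_nonneg hρ_int hρ_one
  have : NullSingletonClass (closureMeasure D ρ) := nullSingletonClass_closureMeasure
  have hlamc : Continuous fun y : closure D => lam y := continuousOn_iff_continuous_domRestrict.1 hlam
  have hgc : Continuous fun y : closure D => g y := continuousOn_iff_continuous_domRestrict.1 hg
  have hlam0 : ∀ y : closure D, 0 < lam y := fun y => hlam_pos y y.2
  have hlaw := isExtremeValueLaw_iff hDo hDb hρ_nonneg hρ_int lam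
  refine ⟨?_, fun ν _ hν k => ?_⟩
  · obtain ⟨ν, hν⟩ := exists_isExtremeLaw (closureMeasure D ρ) hlamc hlam0
    exact ⟨ν, (hlaw ν).2 hν⟩
  · have hν' := ((hlaw ν).1 hν).2
    have hξ : IsUnitRateNoise P ξ := ⟨hξ_meas, hξ_nonneg, hξ_indep, hξ_cdf⟩
    have hxe := isEquidistributed_closureMeasure hDo hDb hρ_nonneg hρ_int hxD hx hx_conv
    obtain ⟨U, hU⟩ := exists_isFineBasis (closureMeasure D ρ)
    simp only [responseFun_eq_pointFun hxD]
    exact ⟨hν'.ae_kthArgmin_eq_singleton hξ hxe hU hlamc hlam0 hgc k,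
      tendsto_measure_kthArgmin_eq_singleton hν' hξ hxe hU hlamc hlam0 hgc k,
      tendstoInDistribution_argminTuple hν' hξ hxe hU hlamc hlam0 hgc (e := Subtype.val)
        (fun y z => le_rfl) k⟩
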